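/- Conventions. $\widehat{\mathbb R}^3=\mathbb R^3\cup\{\infty\}\cong S^3$, and "circle" includes straight lines. A Dupin cyclide is given by a polar decomposition of $\mathbb{RP}^5=P(\mathbb R^{4,2})$ into two projective planes $P_1,P_2$ of signature $(++-)$; the points of $P_i$ on the Lie quadric form the two families of oriented spheres enveloping the cyclide. A *non-singular cyclidic patch* is either (a) a map $f:[0,1]^2\to\widehat{\mathbb R}^3$ for which $f(u,v)$ is the contact point of $s_1(u)$ and $s_2(v)$, where $s_1,s_2$ are injective continuous parametrizations over $[0,1]$ of arcs of the two families of spheres enveloping a Dupin cyclide, containing no point spheres, or (b) a *spherical patch*: an injective continuous map $f$ of $[0,1]^2$ into a sphere or plane whose coordinate lines are circular arcs, the circles of the two families intersecting orthogonally. The coordinate lines of $f$ are its curvature lines, and patches are considered up to increasing reparametrizations of $u$ and of $v$. A *cyclidic cube* consists of eight vertices in $\mathbb R^3$, labelled by $\{0,1\}^3$, and orthonormal frames $B=(t^{(1)},t^{(2)},t^{(3)})$ at the vertices such that each of the six vertex quadrilaterals is circular and embedded, and such that the frames at two vertices $x,x_i$ neighbouring in direction $i$ are related by the reflection in the perpendicular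 bisecting plane of $x,x_i$ composed with $t^{(i)}\mapsto -t^{(i)}$. Its six faces $f^{(l)},f^{(l)}_l$ $(l=1,2,3)$ are the cyclidic patches with the respective four vertices, whose boundary arcs are tangent to the frame vectors. It is *non-singular* if its faces are non-singular cyclidic patches, opposite faces are disjoint, and adjacent faces intersect only along their common boundary arc. **Statement.** Consider a non-singular cyclidic cube whose eight vertices do not all lie on one circle, and let $\{i,j,k\}=\{1,2,3\}$. Then the pair $f^{(i)},f^{(i)}_i$ of opposite faces extends uniquely to a smooth one-parameter family of cyclidic patches whose boundary curves are curvature lines of the four remaining faces $f^{(j)},f^{(j)}_j,f^{(k)},f^{(k)}_k$. That is, there is a smooth map $\Phi:[0,1]\times[0,1]^2\to\widehat{\mathbb R}^3$ such that each $\Phi_t=\Phi(t,\cdot,\cdot)$ is an immersion and a non-singular cyclidic patch, the vertex $\Phi_t(0,0)$ moves with non-zero velocity, $\Phi_0=f^{(i)}$ and $\Phi_1=f^{(i)}_i$ as patches, and for each $t$ the four boundary curves of $\Phi_t$ are curvature lines of the four remaining faces, respectively. Every other such family $\Psi$ is obtained from $\Phi$ by an increasing reparametrization of $t$ (and of the patches).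 Moreover, every non-singular cyclidic patch whose four boundary curves are curvature lines of the four remaining faces, respectively, equals $\Phi_t$ for exactly one $t\in[0,1]$. -/

import Mathlib

open Set Filter Topology
open scoped ContDiff

noncomputable section

namespace Cyclidic

/-! ### Lie sphere geometry of the compactified space -/

/-- Euclidean three-space. -/
abbrev E3 : Type := EuclideanSpace ℝ (Fin 3)

/-- The compactified space: `ℝ³` together with one point at infinity. -/
abbrev Space : Type := OnePoint E3

/-- Homogeneous coordinates of Lie sphere geometry: `(c, a, b, r)` stands for the vector
`c + a e₀ + b e_∞ + r e_r`. -/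
abbrev LieVec : Type := E3 × ℝ × ℝ × ℝ

/-- The scalar product of signature `(4,2)`: `e₀`, `e_∞` are isotropic with `⟨e₀, e_∞⟩ = -1/2`,
the vector `e_r` has square `-1`, and both blocks are orthogonal to `ℝ³` and to each other. -/
def lie (v w : LieVec) : ℝ :=
  inner ℝ v.1 w.1 - (v.2.1 * w.2.2.1 + v.2.2.1 * w.2.1) / 2 - v.2.2.2 * w.2.2.2

/-- The `e_r`-coordinate. An isotropic vector is a point sphere iff this coordinate vanishes. -/
def rad (v : LieVec) : ℝ := v.2.2.2

/-- Homogeneous coordinates of the point spheres: the multiple of `x + e₀ + |x|² e_∞` whose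
`e₀`- and `e_∞`-coordinates add up to one, and `e_∞` for the point at infinity. This is an embedding
of the compactified space onto a round three-sphere (an inverse stereographic projection), so
smoothness of a map into the compactified space is smoothness of its composition with `pt`. -/
def pt : Space → LieVec
  | none => (0, 0, 1, 0)
  | some x => (1 + ‖x‖ ^ 2)⁻¹ • (x, 1, ‖x‖ ^ 2, 0)

/-- The unit interval. -/
abbrev I : Set ℝ := Icc 0 1

/-! ### Cyclidic patches

A patch is given by a parametrization `f u v`, of which only the values for `u, v ∈ [0,1]` matter;
its coordinate lines are its curvature lines. -/

/-- Linear subspaces of signature `(++-)`, i.e. projective planes of that signature. -/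
def IsCyclidicPlane (P : Submodule ℝ LieVec) : Prop :=
  ∃ a b c : LieVec, P = Submodule.span ℝ {a, b, c} ∧
    lie a a = 1 ∧ lie b b = 1 ∧ lie c c = -1 ∧ lie a b = 0 ∧ lie a c = 0 ∧ lie b c = 0

/-- `s` parametrizes, over `[0,1]`, a closed arc of the conic in which the projective plane `P`
meets the Lie quadric, and none of the spheres of the arc is a point sphere. -/
structure IsSphereArc (P : Submodule ℝ LieVec) (s : ℝ → LieVec) : Prop where
  continuous : ContinuousOn s I
  mem : ∀ u ∈ I, s u ∈ P
  isotropic : ∀ u ∈ I, lie (s u) (s u) = 0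
  injective : ∀ u ∈ I, ∀ u' ∈ I, u ≠ u' → LinearIndependent ℝ ![s u, s u']
  not_point : ∀ u ∈ I, rad (s u) ≠ 0

/-- A non-singular patch of a Dupin cyclide. The cyclide is a polar pair of planes `P₁`, `P₂` of
signature `(++-)`; the patch is obtained by letting two spheres run through arcs of the two
enveloping families, and `f u v` is the point of the contact element spanned by
`s₁ u` and `s₂ v`. Singular points of a cyclide are the point spheres of the two families. -/
def IsDupinPatch (f : ℝ → ℝ → Space) : Prop :=
  ∃ P₁ P₂ : Submodule ℝ LieVec, IsCyclidicPlane P₁ ∧ IsCyclidicPlane P₂ ∧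
    (∀ p ∈ P₁, ∀ q ∈ P₂, lie p q = 0) ∧
    ∃ s₁ s₂ : ℝ → LieVec, IsSphereArc P₁ s₁ ∧ IsSphereArc P₂ s₂ ∧
      ∀ u ∈ I, ∀ v ∈ I, pt (f u v) ∈ Submodule.span ℝ {s₁ u, s₂ v}

/-- `c` represents a circle on the (non-point) sphere `s`: a spacelike vector orthogonal to `s` and
`e_r`. The circle consists of the points of `s` which are orthogonal to `c`; two circles on `s`
intersect at a right angle iff their vectors are orthogonal. -/
def IsCircleOn (s c : LieVec) : Prop :=
  rad c = 0 ∧ lie c s = 0 ∧ 0 < lie c c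

/-- A non-singular spherical patch: a patch of a sphere or plane `s`, parametrized injectively in
such a way that the coordinate lines are circular arcs and the circles of the two families
intersect orthogonally. -/
def IsSphericalPatch (f : ℝ → ℝ → Space) : Prop :=
  ContinuousOn (fun p : ℝ × ℝ => f p.1 p.2) (I ×ˢ I) ∧
  InjOn (fun p : ℝ × ℝ => f p.1 p.2) (I ×ˢ I) ∧
  ∃ s : LieVec, lie s s = 0 ∧ rad s ≠ 0 ∧
    ∃ c₁ c₂ : ℝ → LieVec,
      (∀ u ∈ I, IsCircleOn s (c₁ u)) ∧ (∀ v ∈ I, IsCircleOn s (c₂ v)) ∧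
      (∀ u ∈ I, ∀ v ∈ I, lie (c₁ u) (c₂ v) = 0) ∧
      ∀ u ∈ I, ∀ v ∈ I, lie (pt (f u v)) s = 0 ∧
        lie (pt (f u v)) (c₁ u) = 0 ∧ lie (pt (f u v)) (c₂ v) = 0

/-- Non-singular cyclidic patches, spherical patches being included as degenerate ones. -/
def IsPatch (f : ℝ → ℝ → Space) : Prop := IsDupinPatch f ∨ IsSphericalPatch f

/-- The point set of a patch. -/
def image (f : ℝ → ℝ → Space) : Set Space := (fun p : ℝ × ℝ => f p.1 p.2) '' (I ×ˢ I)

/-- Increasing reparametrizations of the unit interval. -/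
def IsReparam (α : ℝ → ℝ) : Prop := StrictMonoOn α I ∧ α '' I = I

/-- Two parametrizations describe the same patch (with the same labelling of its sides): they
differ by reparametrizations of the two curvature line parameters. -/
def SamePatch (f g : ℝ → ℝ → Space) : Prop :=
  ∃ α β : ℝ → ℝ, IsReparam α ∧ IsReparam β ∧ ∀ u ∈ I, ∀ v ∈ I, f u v = g (α u) (β v)

/-! ### Cyclidic cubes -/

/-- The points of `S` lie on a generalized circle, i.e. on a circle or a straight line. -/
def OnCircle (S : Set E3) : Prop := Collinear ℝ S ∨ EuclideanGeometry.Concyclic S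

/-- `(x, x₁, x₁₂, x₂)` are four distinct points on a generalized circle which form an embedded
quadrilateral, i.e. `x, x₁₂` separate `x₁, x₂`. For the latter, an inversion centred at `x` maps the
circle to a line, on which the image of `x₁₂` lies between those of `x₁` and `x₂`. -/
def IsEmbeddedCircularQuad (x x₁ x₁₂ x₂ : E3) : Prop :=
  [x, x₁, x₁₂, x₂].Nodup ∧ OnCircle {x, x₁, x₁₂, x₂} ∧
    Sbtw ℝ (EuclideanGeometry.inversion x 1 x₁) (EuclideanGeometry.inversion x 1 x₁₂)
      (EuclideanGeometry.inversion x 1 x₂)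

/-- The linear part of the reflection in the perpendicular bisecting plane of the segment from
`x` to `y`. -/
def refl (x y v : E3) : E3 :=
  v - (2 * (inner ℝ (y - x) v / inner ℝ (y - x) (y - x))) • (y - x)

/-- The neighbour of the vertex `ε` of the cube in direction `i`. -/
def shift (ε : Fin 3 → Bool) (i : Fin 3) : Fin 3 → Bool := Function.update ε i true

/-- A cyclidic cube (elementary hexahedron of a three-dimensional cyclidic net in `ℝ³`): eight
vertices whose six faces are embedded circular quadrilaterals, and orthonormal frames at
the vertices, such that the frames at neighbouring vertices are related by the reflection in the
bisecting plane, composed with the change of sign of the vector in the direction of the edge. -/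
structure Cube where
  x : (Fin 3 → Bool) → E3
  B : (Fin 3 → Bool) → Fin 3 → E3
  circular : ∀ ε i j, i ≠ j → ε i = false → ε j = false →
    IsEmbeddedCircularQuad (x ε) (x (shift ε i)) (x (shift (shift ε i) j)) (x (shift ε j))
  orthonormal : ∀ ε, Orthonormal ℝ (B ε)
  evolution : ∀ ε i, ε i = false → ∀ l,
    B (shift ε i) l =
      if l = i then -refl (x ε) (x (shift ε i)) (B ε l) else refl (x ε) (x (shift ε i)) (B ε l)

/-- The vertex whose coordinates in the directions `i`, `i + 1`, `i + 2` (modulo three) are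
`b`, `c`, `d`. -/
def corner (i : Fin 3) (b c d : Bool) : Fin 3 → Bool :=
  fun l => if l = i then b else if l = i + 1 then c else d

/-- The end points of the unit interval. -/
def bit (b : Bool) : ℝ := if b then 1 else 0

/-- The Euclidean position of a finite point (the value at infinity is irrelevant). -/
def toE3 : Space → E3
  | none => 0
  | some x => x

/-- The curve `γ`, starting at a finite point for the parameter `0`, leaves that point in the
direction of the unit tangent vector `t`. -/
def HasDirection (γ : ℝ → Space) (t : E3) : Prop :=
  Tendsto (fun u => ‖toE3 (γ u) - toE3 (γ 0)‖⁻¹ • (toE3 (γ u) - toE3 (γ 0))) (𝓝[>] 0) (𝓝 t)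

/-- `face i b` (for `i : Fin 3`, `b : Bool`) are the six faces of the cube `Q`: the face `face i b`
is the (non-singular) cyclidic patch determined by the four vertices with `i`-th coordinate `b` and
by the frame at the first one of them. Its two curvature line parameters belong to the directions
`i + 1` and `i + 2` (modulo three), in this order. -/
structure Cube.IsFaces (Q : Cube) (face : Fin 3 → Bool → ℝ → ℝ → Space) : Prop where
  patch : ∀ i b, IsPatch (face i b)
  vertices : ∀ i b c d, face i b (bit c) (bit d) = ((Q.x (corner i b c d) : E3) : Space)
  frame₁ : ∀ i b, HasDirection (fun u => face i b u 0) (Q.B (corner i b false false) (i + 1))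
  frame₂ : ∀ i b, HasDirection (fun v => face i b 0 v) (Q.B (corner i b false false) (i + 2))

/-- Non-singularity of a cyclidic cube with the given faces: opposite faces are disjoint and
adjacent faces intersect only along their common boundary arc. -/
structure NonsingularFaces (face : Fin 3 → Bool → ℝ → ℝ → Space) : Prop where
  opposite : ∀ i, Disjoint (image (face i false)) (image (face i true))
  adjacent₁ : ∀ i b c,
    image (face i b) ∩ image (face (i + 1) c) ⊆ (fun v => face i b (bit c) v) '' I
  adjacent₂ : ∀ i b d,
    image (face i b) ∩ image (face (i + 2) d) ⊆ (fun u => face i b u (bit d)) '' I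

/-! ### Families of patches between opposite faces -/

/-- The four boundary curves of the patch `g` (parametrized by the directions `i + 1`, `i + 2`) are
curvature lines of the four faces different from `face i false` and `face i true`: each boundary
curve is a coordinate line, with constant `i`-parameter `τ`, of the corresponding face.
(Modulo three, `face (i + 2) b` is parametrized by the directions `i`, `i + 1`, and `face (i + 1) b`
by the directions `i + 2`, `i`.) -/
def BoundaryOnFaces (face : Fin 3 → Bool → ℝ → ℝ → Space) (i : Fin 3) (g : ℝ → ℝ → Space) : Prop :=
  ∀ b : Bool,
    (∃ τ ∈ I, (fun u => g u (bit b)) '' I = (fun u => face (i + 2) b τ u) '' I) ∧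
    (∃ τ ∈ I, (fun v => g (bit b) v) '' I = (fun v => face (i + 1) b v τ) '' I)

/-- `Φ` is a smooth one-parameter family of non-singular cyclidic patches `Φ t`, `t ∈ [0,1]`, which
extends the pair of opposite faces `face i false`, `face i true`, and the boundary
curves of whose members are curvature lines of the four other faces. Smooth means that
`(t, u, v) ↦ Φ t u v` is smooth, that each `Φ t` is an immersion and that the vertex `Φ t 0 0`
moves with non-zero velocity. -/
structure IsSmoothFamily (face : Fin 3 → Bool → ℝ → ℝ → Space) (i : Fin 3)
    (Φ : ℝ → ℝ → ℝ → Space) : Prop where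
  smooth : ContDiffOn ℝ ∞ (fun p : ℝ × ℝ × ℝ => pt (Φ p.1 p.2.1 p.2.2)) (I ×ˢ I ×ˢ I)
  immersion : ∀ t ∈ I, ∀ p ∈ I ×ˢ I,
    Function.Injective (fderivWithin ℝ (fun q : ℝ × ℝ => pt (Φ t q.1 q.2)) (I ×ˢ I) p)
  velocity : ∀ t ∈ I, derivWithin (fun t => pt (Φ t 0 0)) I t ≠ 0
  patch : ∀ t ∈ I, IsPatch (Φ t)
  start : SamePatch (Φ 0) (face i false)
  finish : SamePatch (Φ 1) (face i true)
  boundary : ∀ t ∈ I, BoundaryOnFaces face i (Φ t)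

end Cyclidic

end

open Set Filter Topology
open scoped ContDiff

namespace Cyclidic

/-! ### The scalar product -/

/-! Points of the compactified space are isotropic vectors with `rad = 0` and positive trace. Two
such vectors have a non-positive product, which vanishes only if the points coincide. Möbius
transformations act on them as isometries, inversions being reflections in spacelike vectors.

The proof rests on a normal form. Every non-singular patch, Dupin or spherical, is up to
reparametrization `P + y(u) / r(u) + z(v) / q(v)`, where `y` and `z` are quadratic numerators in two
mutually orthogonal planes and `r`, `q` are quadratic weights, positive on `[0,1]`. For a Dupin
patch this is the difference of the two spheres of a contact element, both scaled to `rad = 1`; for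
a spherical patch it comes from two orthogonal pencils of circles. The product of two points is then
a negative combination of `(u - u')²` and `(v - v')²` (`PatchData.IsPre.lie_F`), which yields
injectivity and immersion. Conversely, every normal form with positive weights is a patch
(`PatchData.IsGood.isPatch`).

Two consequences matter. The reflection in `Z` maps the side `v = 0` to the side `v = 1`, and all
lines `u = const` are circular arcs with one and the same direction vector (`reflect_F`,
`exists_line`). Moreover the four vertices and the two directions at the first vertex determine the
patch (`PatchData.IsPre.std_eq`).

For a cube, the four lateral faces thus provide reflections `m`, `n`, `m'`, `n'` carrying one edge
`A₁(t)` of direction `i` to the other three, the evolution of the frames making the transversal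
directions fit. At either end of the edge the four reflection vectors lie in the three-dimensional
space of the circle through the vertices of that end face. The two circles differ, since otherwise
all eight vertices would lie on one circle, so the four vectors lie in a common plane. The two
compositions `n' ∘ m` and `m' ∘ n` agree at the first vertex and therefore everywhere
(`reflect_comp_eq`): for every `t` the points `A₁, A₂, A₃, A₄` satisfy a linear relation with
coefficients smooth in `t`, and a patch spans them (`exists_tube_relation`, `exists_tube`). Its
weights stay positive because a zero would be a common point of two opposite faces.

For uniqueness, adjacent faces meet only along their common arc, so the four boundary curves of a
patch `g` belong to one and the same `t`; then `g` shares vertices and two sides with `Φ_t` and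
equals it. Any other family is therefore `Φ` along some function `θ`, and the non-zero velocity of
the vertex together with Rolle's theorem makes `θ` injective. -/

theorem lie_comm (v w : LieVec) : lie v w = lie w v := by
  simp only [lie, real_inner_comm w.1 v.1]; ring

theorem lie_add_left (u v w : LieVec) : lie (u + v) w = lie u w + lie v w := by
  simp only [lie, Prod.fst_add, Prod.snd_add, inner_add_left]; ring

theorem lie_smul_left (c : ℝ) (v w : LieVec) : lie (c • v) w = c * lie v w := by
  simp only [lie, Prod.smul_fst, Prod.smul_snd, real_inner_smul_left, smul_eq_mul]; ring

theorem lie_add_right (u v w : LieVec) : lie u (v + w) = lie u v + lie u w := by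
  rw [lie_comm, lie_add_left, lie_comm v, lie_comm w]

theorem lie_smul_right (c : ℝ) (v w : LieVec) : lie v (c • w) = c * lie v w := by
  rw [lie_comm, lie_smul_left, lie_comm w]

theorem lie_neg_left (v w : LieVec) : lie (-v) w = -lie v w := by
  rw [← neg_one_smul ℝ v, lie_smul_left]; ring

theorem lie_neg_right (v w : LieVec) : lie v (-w) = -lie v w := by
  rw [← neg_one_smul ℝ w, lie_smul_right]; ring

theorem lie_sub_left (u v w : LieVec) : lie (u - v) w = lie u w - lie v w := by
  rw [sub_eq_add_neg, lie_add_left, lie_neg_left]; ring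

theorem lie_sub_right (u v w : LieVec) : lie u (v - w) = lie u v - lie u w := by
  rw [sub_eq_add_neg, lie_add_right, lie_neg_right]; ring

@[simp] theorem lie_zero_left (v : LieVec) : lie 0 v = 0 := by
  simpa using lie_smul_left 0 0 v

@[simp] theorem lie_zero_right (v : LieVec) : lie v 0 = 0 := by
  simpa using lie_smul_right 0 v 0

/-- The scalar product as a bilinear form. -/
noncomputable def lieForm : LinearMap.BilinForm ℝ LieVec :=
  LinearMap.mk₂ ℝ lie lie_add_left lie_smul_left lie_add_right lie_smul_right

@[simp] theorem lieForm_apply (v w : LieVec) : lieForm v w = lie v w := rfl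

theorem rad_add (v w : LieVec) : rad (v + w) = rad v + rad w := rfl
theorem rad_sub (v w : LieVec) : rad (v - w) = rad v - rad w := rfl
theorem rad_neg (v : LieVec) : rad (-v) = -rad v := rfl
theorem rad_smul (c : ℝ) (v : LieVec) : rad (c • v) = c * rad v := rfl
@[simp] theorem rad_zero : rad 0 = 0 := rfl

/-- The sum of the coordinates with respect to `e₀` and `e_∞`. -/
def tr (v : LieVec) : ℝ := v.2.1 + v.2.2.1

theorem tr_sub (v w : LieVec) : tr (v - w) = tr v - tr w := by simp [tr]; ring
theorem tr_neg (v : LieVec) : tr (-v) = -tr v := by simp [tr]; ring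
theorem tr_smul (c : ℝ) (v : LieVec) : tr (c • v) = c * tr v := by simp [tr]; ring
@[simp] theorem tr_zero : tr 0 = 0 := by simp [tr]

theorem continuous_lie : Continuous fun p : LieVec × LieVec => lie p.1 p.2 := by
  unfold lie; fun_prop

theorem continuous_rad : Continuous rad := by unfold rad; fun_prop
theorem continuous_tr : Continuous tr := by unfold tr; fun_prop

theorem continuousOn_lie {X : Type*} [TopologicalSpace X] {f g : X → LieVec} {s : Set X}
    (hf : ContinuousOn f s) (hg : ContinuousOn g s) : ContinuousOn (fun x => lie (f x) (g x)) s :=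
  Continuous.comp_continuousOn (g := fun p : LieVec × LieVec => lie p.1 p.2)
    (f := fun x => (f x, g x)) continuous_lie (hf.prodMk hg)

theorem contDiff_lie : ContDiff ℝ ∞ fun p : LieVec × LieVec => lie p.1 p.2 := by
  unfold lie
  refine ContDiff.sub (ContDiff.sub (ContDiff.inner ℝ ?_ ?_) ?_) ?_ <;> fun_prop

theorem contDiff_tr : ContDiff ℝ ∞ tr := by unfold tr; fun_prop

theorem eq_zero_of_lie_eq_zero {v : LieVec} (h : ∀ w, lie v w = 0) : v = 0 := by
  have h1 := h (v.1, 0, 0, 0)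
  have h2 := h (0, 1, 0, 0)
  have h3 := h (0, 0, 1, 0)
  have h4 := h (0, 0, 0, 1)
  simp [lie] at h1 h2 h3 h4
  ext1
  · simpa using h1
  · ext1
    · simpa using h3
    · ext1
      · simpa using h2
      · simpa using h4

/-- Up to a factor, `tr` is the product with the timelike vector `e₀ + e_∞`; on its orthogonal
complement inside `rad = 0` the form is positive definite. All sign arguments about points reduce to
this. -/
theorem lie_self_of_tr_eq_zero {v : LieVec} (hr : rad v = 0) (ht : tr v = 0) :
    lie v v = ‖v.1‖ ^ 2 + v.2.1 ^ 2 := by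
  simp only [lie, real_inner_self_eq_norm_sq]
  simp only [rad] at hr
  simp only [tr] at ht
  rw [hr, show v.2.2.1 = -v.2.1 by linarith]; ring

theorem lie_self_nonneg_of_tr_eq_zero {v : LieVec} (hr : rad v = 0) (ht : tr v = 0) :
    0 ≤ lie v v := by
  rw [lie_self_of_tr_eq_zero hr ht]; positivity

theorem eq_zero_of_tr_eq_zero {v : LieVec} (hr : rad v = 0) (ht : tr v = 0) (h : lie v v = 0) :
    v = 0 := by
  rw [lie_self_of_tr_eq_zero hr ht] at h
  have h1 : v.2.1 = 0 := by nlinarith [sq_nonneg ‖v.1‖, sq_nonneg v.2.1]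
  have h2 : ‖v.1‖ = 0 := by nlinarith [sq_nonneg ‖v.1‖, sq_nonneg v.2.1]
  simp only [rad] at hr
  simp only [tr] at ht
  ext1
  · simpa using h2
  · ext1
    · exact h1
    · ext1
      · change v.2.2.1 = 0; linarith
      · exact hr

/-! ### Points of the compactified space as isotropic vectors -/

/-- Homogeneous coordinates, of positive trace, of a point of the compactified space. -/
structure IsPt (v : LieVec) : Prop where
  rad : rad v = 0
  null : lie v v = 0
  pos : 0 < tr v

theorem IsPt.ne_zero {v : LieVec} (h : IsPt v) : v ≠ 0 := by
  rintro rfl; simpa using h.pos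

theorem IsPt.smul {v : LieVec} (h : IsPt v) {c : ℝ} (hc : 0 < c) : IsPt (c • v) :=
  ⟨by rw [rad_smul, h.rad, mul_zero], by rw [lie_smul_left, lie_smul_right, h.null]; ring,
    by rw [tr_smul]; exact mul_pos hc h.pos⟩

theorem tr_ne_zero {v : LieVec} (hr : rad v = 0) (hn : lie v v = 0) (h : v ≠ 0) :
    tr v ≠ 0 := fun ht => h (eq_zero_of_tr_eq_zero hr ht hn)

/-- A vector orthogonal to a point is spacelike or a multiple of it. -/
theorem IsPt.lie_self_nonneg {P b : LieVec} (hP : IsPt P) (hb : Cyclidic.rad b = 0)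
    (h : lie P b = 0) : 0 ≤ lie b b := by
  have := hP.pos
  -- Subtracting a multiple of `P` does not change the square; this multiple makes the trace zero.
  have h1 : lie (b - (tr b / tr P) • P) (b - (tr b / tr P) • P) = lie b b := by
    simp only [lie_sub_left, lie_sub_right, lie_smul_left, lie_smul_right, hP.null, lie_comm b P, h]
    ring
  rw [← h1]
  apply lie_self_nonneg_of_tr_eq_zero
  · rw [rad_sub, rad_smul, hb, hP.rad]; ring
  · rw [tr_sub, tr_smul]; field_simp; ring

theorem IsPt.eq_smul {P b : LieVec} (hP : IsPt P) (hb : Cyclidic.rad b = 0)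
    (h : lie P b = 0) (hbb : lie b b = 0) : b = (tr b / tr P) • P := by
  have := hP.pos
  have h1 : lie (b - (tr b / tr P) • P) (b - (tr b / tr P) • P) = lie b b := by
    simp only [lie_sub_left, lie_sub_right, lie_smul_left, lie_smul_right, hP.null, lie_comm b P, h]
    ring
  rw [← sub_eq_zero]
  apply eq_zero_of_tr_eq_zero
  · rw [rad_sub, rad_smul, hb, hP.rad]; ring
  · rw [tr_sub, tr_smul]; field_simp; ring
  · rw [h1, hbb]

/-- The reversed Cauchy–Schwarz inequality on the light cone: `tr w • v - tr v • w` has trace zero,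
and its non-negative square is `-2 * tr v * tr w * lie v w`. -/
theorem IsPt.lie_nonpos {v w : LieVec} (hv : IsPt v) (hw : IsPt w) : lie v w ≤ 0 := by
  have h1 := hv.pos
  have h2 := hw.pos
  have h : 0 ≤ lie (tr w • v - tr v • w) (tr w • v - tr v • w) := by
    apply lie_self_nonneg_of_tr_eq_zero
    · rw [rad_sub, rad_smul, rad_smul, hv.rad, hw.rad]; ring
    · rw [tr_sub, tr_smul, tr_smul]; ring
  simp only [lie_sub_left, lie_sub_right, lie_smul_left, lie_smul_right, hv.null, hw.null,
    lie_comm w v] at h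
  by_contra hc
  nlinarith [mul_pos (mul_pos h1 h2) (not_le.mp hc)]

theorem IsPt.eq_smul_of_lie {v w : LieVec} (hv : IsPt v) (hw : IsPt w) (h : lie v w = 0) :
    w = (tr w / tr v) • v := hv.eq_smul hw.rad h hw.null

/-- The point with given homogeneous coordinates. -/
noncomputable def toSpace (v : LieVec) : Space :=
  open Classical in if v.2.1 = 0 then OnePoint.infty else (((v.2.1)⁻¹ • v.1 : E3) : Space)

theorem toSpace_smul {c : ℝ} (hc : c ≠ 0) (v : LieVec) : toSpace (c • v) = toSpace v := by
  unfold toSpace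
  by_cases h : v.2.1 = 0
  · simp [h]
  · have : (c • v).2.1 ≠ 0 := by simpa using ⟨hc, h⟩
    rw [if_neg h, if_neg this]
    congr 1
    simp only [Prod.smul_fst, Prod.smul_snd, smul_smul, smul_eq_mul]
    congr 1
    field_simp

theorem pt_coe (x : E3) : pt (x : Space) = (1 + ‖x‖ ^ 2)⁻¹ • (x, 1, ‖x‖ ^ 2, 0) := rfl
theorem pt_infty : pt (OnePoint.infty : Space) = (0, 0, 1, 0) := rfl

/-- Homogeneous coordinates of a finite point. -/
noncomputable def lift (x : E3) : LieVec := (x, 1, ‖x‖ ^ 2, 0)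

theorem isPt_lift (x : E3) : IsPt (lift x) :=
  ⟨rfl, by simp [lie, lift], by simp only [tr, lift]; positivity⟩

theorem isPt_pt (x : Space) : IsPt (pt x) := by
  induction x using OnePoint.rec with
  | infty => exact ⟨rfl, by simp [lie, pt_infty], by simp [tr, pt_infty]⟩
  | coe x => exact (isPt_lift x).smul (by positivity)

theorem tr_pt (x : Space) : tr (pt x) = 1 := by
  induction x using OnePoint.rec with
  | infty => simp [tr, pt_infty]
  | coe x =>
    rw [pt_coe, tr_smul]
    have : (1 + ‖x‖ ^ 2) ≠ 0 := by positivity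
    simp [tr, this]

theorem toSpace_lift (x : E3) : toSpace (lift x) = x := by
  simp [toSpace, lift]

theorem toSpace_pt (x : Space) : toSpace (pt x) = x := by
  induction x using OnePoint.rec with
  | infty => simp [toSpace, pt_infty]
  | coe x => rw [pt_coe, toSpace_smul (by positivity)]; exact toSpace_lift x

theorem pt_injective : Function.Injective pt := fun x y h => by
  rw [← toSpace_pt x, h, toSpace_pt]

theorem pt_toSpace {v : LieVec} (hv : IsPt v) : pt (toSpace v) = (tr v)⁻¹ • v := by
  have hn := hv.null
  have hp := hv.pos
  have hr := hv.rad
  obtain ⟨x, a, b, r⟩ := v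
  simp only [lie, tr, rad, real_inner_self_eq_norm_sq] at hn hp hr ⊢
  subst hr
  by_cases h : a = 0
  · subst h
    have hx : x = 0 := by
      have : ‖x‖ ^ 2 = 0 := by linarith
      simpa using this
    subst hx
    have hb : b ≠ 0 := by intro h; simp [h] at hp
    simp [toSpace, pt_infty, hb]
  · have hb : b = ‖x‖ ^ 2 / a := by field_simp; linarith
    have h3 : a + b ≠ 0 := hp.ne'
    simp only [toSpace, if_neg h, pt_coe, norm_smul, mul_pow]
    have e : (1 + ‖a⁻¹‖ ^ 2 * ‖x‖ ^ 2)⁻¹ = (a + b)⁻¹ * a := by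
      have : ‖a⁻¹‖ ^ 2 = a⁻¹ ^ 2 := by simp
      have h4 : 1 + a⁻¹ ^ 2 * ‖x‖ ^ 2 = (a + b) * a⁻¹ := by rw [hb]; field_simp
      rw [this, h4, mul_inv, inv_inv]
    rw [e]
    have : ‖a⁻¹‖ ^ 2 = a⁻¹ ^ 2 := by simp
    simp only [Prod.smul_mk, smul_smul, smul_eq_mul, Prod.mk.injEq]
    refine ⟨?_, ?_, ?_, ?_⟩
    · congr 1; field_simp
    · ring
    · rw [this, hb]; field_simp
    · ring

theorem toSpace_eq_iff {v w : LieVec} (hv : IsPt v) (hw : IsPt w) :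
    toSpace v = toSpace w ↔ lie v w = 0 := by
  constructor
  · intro h
    have h1 := congrArg pt h
    rw [pt_toSpace hv, pt_toSpace hw] at h1
    have h2 := hw.pos
    have : w = tr w • (tr v)⁻¹ • v := by rw [h1, smul_smul, mul_inv_cancel₀ h2.ne', one_smul]
    rw [this, lie_smul_right, lie_smul_right, hv.null]; ring
  · intro h
    rw [hv.eq_smul_of_lie hw h, toSpace_smul (div_pos hw.pos hv.pos).ne']

theorem lie_neg_of_ne {v w : LieVec} (hv : IsPt v) (hw : IsPt w) (h : toSpace v ≠ toSpace w) :
    lie v w < 0 :=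
  lt_of_le_of_ne (hv.lie_nonpos hw) fun h' => h ((toSpace_eq_iff hv hw).2 h')

theorem exists_smul_of_toSpace_eq {v w : LieVec} (hv : IsPt v) (hw : IsPt w)
    (h : toSpace v = toSpace w) : ∃ c : ℝ, 0 < c ∧ w = c • v :=
  ⟨_, div_pos hw.pos hv.pos, hv.eq_smul_of_lie hw ((toSpace_eq_iff hv hw).1 h)⟩

/-- Only infinity needs care: there the `ℝ³`- and `e₀`-coordinates tend to zero and the
`e_∞`-coordinate to one. -/
theorem continuous_pt : Continuous pt := by
  rw [OnePoint.continuous_iff]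
  constructor
  · rw [coclosedCompact_eq_cocompact]
    have hN : Tendsto (fun x : E3 => ‖x‖) (cocompact E3) atTop := tendsto_norm_cocompact_atTop
    have h1 : Tendsto (fun x : E3 => (1 + ‖x‖ ^ 2)⁻¹) (cocompact E3) (𝓝 0) :=
      tendsto_inv_atTop_zero.comp
        (tendsto_atTop_add_const_left _ _ ((tendsto_pow_atTop two_ne_zero).comp hN))
    have h2 : Tendsto (fun x : E3 => (1 + ‖x‖ ^ 2)⁻¹ • x) (cocompact E3) (𝓝 0) := by
      rw [tendsto_zero_iff_norm_tendsto_zero]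
      refine squeeze_zero' (Eventually.of_forall fun x => norm_nonneg _) ?_
        (tendsto_inv_atTop_zero.comp hN)
      filter_upwards [hN.eventually_gt_atTop 0] with x hx
      rw [norm_smul, Function.comp_apply, norm_inv, Real.norm_of_nonneg (by positivity)]
      rw [inv_mul_eq_div, div_le_iff₀ (by positivity)]
      field_simp; nlinarith
    have h3 : Tendsto (fun x : E3 => (1 + ‖x‖ ^ 2)⁻¹ * ‖x‖ ^ 2) (cocompact E3) (𝓝 1) := by
      have : (fun x : E3 => (1 + ‖x‖ ^ 2)⁻¹ * ‖x‖ ^ 2) = fun x => 1 - (1 + ‖x‖ ^ 2)⁻¹ := by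
        funext x
        have : (1 + ‖x‖ ^ 2) ≠ 0 := by positivity
        field_simp; ring
      rw [this]; simpa using h1.const_sub 1
    have h4 : ∀ x : E3, pt (x : Space) = ((1 + ‖x‖ ^ 2)⁻¹ • x, (1 + ‖x‖ ^ 2)⁻¹,
        (1 + ‖x‖ ^ 2)⁻¹ * ‖x‖ ^ 2, 0) := fun x => by simp [pt_coe]
    simp only [h4, pt_infty]
    exact h2.prodMk_nhds (h1.prodMk_nhds (h3.prodMk_nhds tendsto_const_nhds))
  · have : (fun x : E3 => pt x) = fun x => (1 + ‖x‖ ^ 2)⁻¹ • ((x, 1, ‖x‖ ^ 2, 0) : LieVec) := rfl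
    rw [this]
    have h1 : Continuous fun x : E3 => (1 + ‖x‖ ^ 2)⁻¹ :=
      Continuous.inv₀ (by fun_prop) fun x => by positivity
    have h2 : Continuous fun x : E3 => ((x, 1, ‖x‖ ^ 2, 0) : LieVec) := by fun_prop
    exact h1.smul h2

/-- A continuous injection from a compact space to a Hausdorff space. Continuity of maps into the
compactified space can thus be checked on homogeneous coordinates. -/
theorem isClosedEmbedding_pt : IsClosedEmbedding pt :=
  continuous_pt.isClosedEmbedding pt_injective

/-! ### Inversions -/

/-- The reflection in the hyperplane orthogonal to `n`. -/
noncomputable def reflect (n : LieVec) : LieVec →ₗ[ℝ] LieVec :=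
  -- The form of a transvection makes the determinant `-1` immediate.
  LinearMap.transvection (-(2 / lie n n) • lieForm n) n

theorem reflect_apply (n v : LieVec) : reflect n v = v - (2 * lie n v / lie n n) • n := by
  simp only [reflect, LinearMap.transvection.apply, LinearMap.smul_apply, lieForm_apply,
    sub_eq_add_neg, ← neg_smul, smul_eq_mul]
  congr 2; ring

theorem lie_reflect {n : LieVec} (hn : lie n n ≠ 0) (v w : LieVec) :
    lie (reflect n v) (reflect n w) = lie v w := by
  simp only [reflect_apply, lie_sub_left, lie_sub_right, lie_smul_left, lie_smul_right,
    lie_comm v n]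
  field_simp; ring

theorem reflect_reflect {n : LieVec} (hn : lie n n ≠ 0) (v : LieVec) :
    reflect n (reflect n v) = v := by
  simp only [reflect_apply, lie_sub_right, lie_smul_right, sub_sub, ← add_smul]
  rw [sub_eq_self]
  convert zero_smul ℝ n
  field_simp; ring

theorem reflect_of_lie_eq_zero {n v : LieVec} (h : lie n v = 0) : reflect n v = v := by
  simp [reflect_apply, h]

theorem rad_reflect {n : LieVec} (hn : rad n = 0) (v : LieVec) : rad (reflect n v) = rad v := by
  rw [reflect_apply, rad_sub, rad_smul, hn]; ring

theorem det_reflect {n : LieVec} (hn : lie n n ≠ 0) : LinearMap.det (reflect n) = -1 := by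
  rw [reflect, LinearMap.transvection.det]
  simp only [LinearMap.smul_apply, lieForm_apply, smul_eq_mul]
  field_simp; norm_num

/-- With negative trace, `-v` would be a point having a positive product with `P`, against
`IsPt.lie_nonpos`. -/
theorem isPt_of_lie_neg {P v : LieVec} (hP : IsPt P) (hr : rad v = 0) (hn : lie v v = 0)
    (h : lie P v < 0) : IsPt v := by
  refine ⟨hr, hn, ?_⟩
  by_contra hc
  have h0 : v ≠ 0 := by rintro rfl; simp at h
  have h1 : tr v < 0 := lt_of_le_of_ne (not_lt.mp hc) (tr_ne_zero hr hn h0)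
  have h2 : IsPt (-v) := ⟨by rw [rad_neg, hr, neg_zero],
    by rw [lie_neg_left, lie_neg_right, hn]; ring, by rw [tr_neg]; linarith⟩
  have := hP.lie_nonpos h2
  rw [lie_neg_right] at this
  linarith

theorem isPt_reflect {P n : LieVec} (hP : IsPt P) (hr : rad n = 0) (hn : 0 < lie n n) :
    IsPt (reflect n P) := by
  by_cases h : lie n P = 0
  · rwa [reflect_of_lie_eq_zero h]
  · refine isPt_of_lie_neg hP (by rw [rad_reflect hr, hP.rad])
      (by rw [lie_reflect hn.ne', hP.null]) ?_
    rw [reflect_apply, lie_sub_right, lie_smul_right, hP.null, lie_comm P n]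
    have : 0 < lie n P * lie n P / lie n n := div_pos (mul_self_pos.mpr h) hn
    have e : 0 - 2 * lie n P / lie n n * lie n P = -2 * (lie n P * lie n P / lie n n) := by ring
    rw [e]; linarith

/-! ### Conic arcs -/

/-- `P + y / r`, where `y = u² Y + 2 u (1 - u) B` and `r` is given by `weight`, is a conic arc in
the affine plane through `P` with directions `Y`, `B`. -/
noncomputable def weight (P Y B : LieVec) (u : ℝ) : ℝ :=
  (1 - u) ^ 2 + u ^ 2 - 2 * u * (1 - u) * (lie B Y / lie P Y)

/-- The numerator of a conic arc. -/
noncomputable def numer (Y B : LieVec) (u : ℝ) : LieVec := u ^ 2 • Y + (2 * u * (1 - u)) • B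

/-- The relations under which `P + y / r` is a curve of isotropic vectors. -/
structure IsPreArc (P Y B : LieVec) : Prop where
  radY : rad Y = 0
  radB : rad B = 0
  PB : lie P B = 0
  neg : lie P Y < 0
  YY : lie Y Y = -2 * lie P Y
  BB : lie B B = -lie P Y / 2

/-- Data describing a patch: the point of the patch with parameters `u`, `v` is
`P + y(u) / r(u) + z(v) / q(v)` for two conic arcs with orthogonal planes. -/
structure PatchData where
  P : LieVec
  Y : LieVec
  B : LieVec
  Z : LieVec
  C : LieVec

namespace PatchData

/-- The first weight. -/
noncomputable def r (D : PatchData) (u : ℝ) : ℝ := weight D.P D.Y D.B u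
/-- The second weight. -/
noncomputable def q (D : PatchData) (v : ℝ) : ℝ := weight D.P D.Z D.C v
/-- The first numerator. -/
noncomputable def y (D : PatchData) (u : ℝ) : LieVec := numer D.Y D.B u
/-- The second numerator. -/
noncomputable def z (D : PatchData) (v : ℝ) : LieVec := numer D.Z D.C v

/-- Homogeneous coordinates of the points of the patch. -/
noncomputable def F (D : PatchData) (u v : ℝ) : LieVec :=
  (D.r u * D.q v) • D.P + D.q v • D.y u + D.r u • D.z v

/-- The patch described by the data. -/
noncomputable def std (D : PatchData) (u v : ℝ) : Space := toSpace (D.F u v)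

/-- The algebraic relations between patch data. -/
structure IsPre (D : PatchData) : Prop where
  pt : IsPt D.P
  arc₁ : IsPreArc D.P D.Y D.B
  arc₂ : IsPreArc D.P D.Z D.C
  YZ : lie D.Y D.Z = 0
  YC : lie D.Y D.C = 0
  BZ : lie D.B D.Z = 0
  BC : lie D.B D.C = 0

/-- Data of a non-singular patch. -/
structure IsGood (D : PatchData) : Prop extends IsPre D where
  r_pos : ∀ u ∈ I, 0 < D.r u
  q_pos : ∀ v ∈ I, 0 < D.q v

/-- Interchanging the parameters. -/
def swap (D : PatchData) : PatchData := ⟨D.P, D.Z, D.C, D.Y, D.B⟩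

end PatchData

theorem weight_zero (P Y B : LieVec) : weight P Y B 0 = 1 := by simp [weight]
theorem weight_one (P Y B : LieVec) : weight P Y B 1 = 1 := by simp [weight]
theorem numer_zero (Y B : LieVec) : numer Y B 0 = 0 := by simp [numer]
theorem numer_one (Y B : LieVec) : numer Y B 1 = Y := by simp [numer]

/-- The lengths of `Y` and `B` are chosen for this identity. It makes the product of `r P + y` at
`u` and at `u'` equal to `lie P Y * (u - u') ^ 2`; in particular these vectors are isotropic. -/
theorem IsPreArc.lie_numer {P Y B : LieVec} (h : IsPreArc P Y B) (u u' : ℝ) :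
    lie (numer Y B u) (numer Y B u') = lie P Y *
      ((u - u') ^ 2 - weight P Y B u * u' ^ 2 - weight P Y B u' * u ^ 2) := by
  have h0 := h.neg.ne
  simp only [numer, weight, lie_add_left, lie_add_right, lie_smul_left, lie_smul_right, h.YY, h.BB,
    lie_comm Y B]
  field_simp; ring

theorem IsPreArc.lie_P_numer {P Y B : LieVec} (h : IsPreArc P Y B) (u : ℝ) :
    lie P (numer Y B u) = u ^ 2 * lie P Y := by
  simp only [numer, lie_add_right, lie_smul_right, h.PB]; ring

theorem IsPreArc.rad_numer {P Y B : LieVec} (h : IsPreArc P Y B) (u : ℝ) :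
    rad (numer Y B u) = 0 := by
  simp only [numer, rad_add, rad_smul, h.radY, h.radB]; ring

theorem continuous_weight (P Y B : LieVec) : Continuous (weight P Y B) := by
  unfold weight; fun_prop

theorem continuous_numer (Y B : LieVec) : Continuous (numer Y B) := by
  unfold numer; fun_prop

/-! ### Metric properties of the normal form -/

namespace PatchData

variable {D : PatchData}

theorem IsPre.swap (h : D.IsPre) : D.swap.IsPre :=
  ⟨h.pt, h.arc₂, h.arc₁, by rw [lie_comm]; exact h.YZ, by rw [lie_comm]; exact h.BZ,
    by rw [lie_comm]; exact h.YC, by rw [lie_comm]; exact h.BC⟩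

theorem IsGood.swap (h : D.IsGood) : D.swap.IsGood := ⟨h.toIsPre.swap, h.q_pos, h.r_pos⟩

theorem F_swap (u v : ℝ) : D.swap.F u v = D.F v u := by
  simp only [F, r, q, y, z, PatchData.swap]
  rw [mul_comm]; abel

theorem std_swap (u v : ℝ) : D.swap.std u v = D.std v u := by simp only [std, F_swap]

theorem IsPre.lie_y_z (h : D.IsPre) (u v : ℝ) : lie (D.y u) (D.z v) = 0 := by
  simp only [y, z, numer, lie_add_left, lie_add_right, lie_smul_left, lie_smul_right, h.YZ, h.YC,
    h.BZ, h.BC]; ring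

/-- The two planes are orthogonal, so the contributions of the two arcs just add up. Both
coefficients `lie P Y` and `lie P Z` are negative; hence isotropy on the diagonal, strict negativity
off it, and later the immersion property. -/
theorem IsPre.lie_F (h : D.IsPre) (u v u' v' : ℝ) :
    lie (D.F u v) (D.F u' v') = D.q v * D.q v' * lie D.P D.Y * (u - u') ^ 2 +
      D.r u * D.r u' * lie D.P D.Z * (v - v') ^ 2 := by
  have e1 := h.arc₁.lie_numer u u'
  have e2 := h.arc₂.lie_numer v v'
  have e3 := h.lie_y_z u v'
  have e4 := h.lie_y_z u' v
  rw [lie_comm] at e4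
  have e5 := h.arc₁.lie_P_numer u
  have e6 := h.arc₁.lie_P_numer u'
  have e7 := h.arc₂.lie_P_numer v
  have e8 := h.arc₂.lie_P_numer v'
  simp only [F, lie_add_left, lie_add_right, lie_smul_left, lie_smul_right, e3, e4, h.pt.null,
    lie_comm (D.y u) D.P, lie_comm (D.z v) D.P]
  simp only [r, q, y, z, e1, e2, e5, e6, e7, e8]
  ring

theorem IsPre.rad_F (h : D.IsPre) (u v : ℝ) : rad (D.F u v) = 0 := by
  simp only [F, y, z, rad_add, rad_smul, h.pt.rad, h.arc₁.rad_numer, h.arc₂.rad_numer]; ring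

theorem F_zero_zero : D.F 0 0 = D.P := by
  simp [F, r, q, y, z, weight_zero, numer_zero]

theorem IsGood.isPt_F (h : D.IsGood) {u v : ℝ} (hu : u ∈ I) (hv : v ∈ I) : IsPt (D.F u v) := by
  have hr := h.r_pos u hu
  have hq := h.q_pos v hv
  by_cases h0 : u = 0 ∧ v = 0
  · rw [h0.1, h0.2, F_zero_zero]; exact h.pt
  · refine isPt_of_lie_neg h.pt (h.rad_F u v) (by rw [h.lie_F]; ring) ?_
    have := h.lie_F 0 0 u v
    rw [F_zero_zero] at this
    rw [this]
    have h1 := h.arc₁.neg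
    have h2 := h.arc₂.neg
    simp only [r, q, weight_zero] at hr hq ⊢
    simp only [zero_sub, neg_sq, one_mul]
    rcases not_and_or.mp h0 with h3 | h3
    · have : 0 < weight D.P D.Z D.C v * u ^ 2 := by positivity
      have : 0 ≤ weight D.P D.Y D.B u * v ^ 2 := by positivity
      nlinarith
    · have : 0 ≤ weight D.P D.Z D.C v * u ^ 2 := by positivity
      have : 0 < weight D.P D.Y D.B u * v ^ 2 := by positivity
      nlinarith

theorem IsGood.injOn (h : D.IsGood) {u v u' v' : ℝ} (hu : u ∈ I) (hv : v ∈ I) (hu' : u' ∈ I)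
    (hv' : v' ∈ I) (he : D.std u v = D.std u' v') : u = u' ∧ v = v' := by
  have h1 := (toSpace_eq_iff (h.isPt_F hu hv) (h.isPt_F hu' hv')).1 he
  rw [h.lie_F] at h1
  have hr := mul_pos (h.r_pos u hu) (h.r_pos u' hu')
  have hq := mul_pos (h.q_pos v hv) (h.q_pos v' hv')
  have h3 : 0 < D.q v * D.q v' * -lie D.P D.Y := mul_pos hq (neg_pos.2 h.arc₁.neg)
  have h4 : 0 < D.r u * D.r u' * -lie D.P D.Z := mul_pos hr (neg_pos.2 h.arc₂.neg)
  have h5 : (u - u') ^ 2 = 0 := by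
    have := mul_nonneg h3.le (sq_nonneg (u - u'))
    have := mul_nonneg h4.le (sq_nonneg (v - v'))
    have h6 : D.q v * D.q v' * -lie D.P D.Y * (u - u') ^ 2 = 0 := by linarith
    exact (mul_eq_zero.mp h6).resolve_left h3.ne'
  rw [h5] at h1
  have h6 : (v - v') ^ 2 = 0 := by
    have h6 : D.r u * D.r u' * -lie D.P D.Z * (v - v') ^ 2 = 0 := by linarith
    exact (mul_eq_zero.mp h6).resolve_left h4.ne'
  exact ⟨sub_eq_zero.mp (by simpa using h5), sub_eq_zero.mp (by simpa using h6)⟩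

theorem continuous_F : Continuous fun p : ℝ × ℝ => D.F p.1 p.2 := by
  have h1 := continuous_weight D.P D.Y D.B
  have h2 := continuous_weight D.P D.Z D.C
  have h3 := continuous_numer D.Y D.B
  have h4 := continuous_numer D.Z D.C
  unfold F r q y z
  fun_prop

theorem IsGood.continuousOn_std (h : D.IsGood) :
    ContinuousOn (fun p : ℝ × ℝ => D.std p.1 p.2) (I ×ˢ I) := by
  rw [isClosedEmbedding_pt.isInducing.continuousOn_iff]
  have : ContinuousOn (fun p : ℝ × ℝ => (tr (D.F p.1 p.2))⁻¹ • D.F p.1 p.2) (I ×ˢ I) := by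
    have h1 : ContinuousOn (fun p : ℝ × ℝ => tr (D.F p.1 p.2)) (I ×ˢ I) :=
      (continuous_tr.comp continuous_F).continuousOn
    exact (h1.inv₀ fun p hp => (h.isPt_F hp.1 hp.2).pos.ne').smul continuous_F.continuousOn
  exact this.congr fun p hp => pt_toSpace (h.isPt_F hp.1 hp.2)

end PatchData

/-! ### The normal form describes a patch -/

/-- The vector `e_r`. -/
def er : LieVec := (0, 0, 0, 1)

theorem lie_er (v : LieVec) : lie v er = -rad v := by simp [lie, er, rad]

theorem rad_er : rad er = 1 := rfl

/-- Five linear equations in six unknowns. -/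
theorem exists_orthogonal (f : Fin 5 → LieVec) : ∃ n ≠ 0, ∀ i, lie n (f i) = 0 := by
  let L : LieVec →ₗ[ℝ] (Fin 5 → ℝ) := LinearMap.pi fun i => lieForm (f i)
  have h : LinearMap.ker L ≠ ⊥ := by
    apply LinearMap.ker_ne_bot_of_finrank_lt
    simp [Module.finrank_prod]
  obtain ⟨n, hn, h0⟩ := (Submodule.ne_bot_iff _).1 h
  refine ⟨n, h0, fun i => ?_⟩
  have := congrFun (LinearMap.mem_ker.1 hn) i
  rw [lie_comm]
  simpa [L] using this

/-- The plane is spanned by `s`, `Y`, `B`. The isotropic vectors `s` and `s + Y`, whose product is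
`-k`, yield the pair `a`, `c` of squares `1` and `-1`; the correction `m • s` makes `B` orthogonal
to `s + Y` as well as to `s`. -/
theorem exists_cyclidicPlane {s Y B : LieVec} (hs : lie s s = 0) (hY : lie Y Y = -2 * lie s Y)
    (hneg : lie s Y < 0) (hB : lie s B = 0) (hBB : 0 < lie B B) :
    ∃ Pl : Submodule ℝ LieVec, IsCyclidicPlane Pl ∧ s ∈ Pl ∧ Y ∈ Pl ∧ B ∈ Pl ∧
      ∀ w, lie s w = 0 → lie Y w = 0 → lie B w = 0 → ∀ p ∈ Pl, lie p w = 0 := by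
  set k := -lie s Y with hk
  have hk0 : 0 < k := by linarith
  set m := lie B Y / k with hm
  have hmk : lie B Y = m * k := by rw [hm]; field_simp
  set β := Real.sqrt (lie B B) with hβ
  have hβ0 : 0 < β := Real.sqrt_pos.2 hBB
  have hββ : lie B B = β ^ 2 := (Real.sq_sqrt hBB.le).symm
  let a := s - (1 / (2 * k)) • (s + Y)
  let c := s + (1 / (2 * k)) • (s + Y)
  let b := β⁻¹ • (B + m • s)
  have hsY : lie s Y = -k := by linarith
  have hYY : lie Y Y = 2 * k := by rw [hY, hsY]; ring
  refine ⟨Submodule.span ℝ {a, b, c}, ⟨a, b, c, rfl, ?_, ?_, ?_, ?_, ?_, ?_⟩, ?_⟩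
  · simp only [a, lie_add_left, lie_add_right, lie_sub_left, lie_sub_right, lie_smul_left,
      lie_smul_right, hs, hsY, hYY, lie_comm Y s]
    field_simp; ring
  · simp only [b, lie_add_left, lie_add_right, lie_smul_left, lie_smul_right, hs, hββ, hB,
      lie_comm B s]
    field_simp; ring
  · simp only [c, lie_add_left, lie_add_right, lie_smul_left,
      lie_smul_right, hs, hsY, hYY, lie_comm Y s]
    field_simp; ring
  · simp only [a, b, lie_add_left, lie_add_right, lie_sub_left, lie_smul_left,
      lie_smul_right, hs, hsY, hB, lie_comm Y s, lie_comm Y B, hmk]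
    field_simp; ring
  · simp only [a, c, lie_add_left, lie_add_right, lie_sub_left, lie_smul_left,
      lie_smul_right, hs, hsY, hYY, lie_comm Y s]
    field_simp; ring
  · simp only [b, c, lie_add_left, lie_add_right, lie_smul_left,
      lie_smul_right, hs, hsY, hB, lie_comm B s, hmk]
    field_simp; ring
  · have ha : a ∈ Submodule.span ℝ {a, b, c} := Submodule.subset_span (by simp)
    have hb : b ∈ Submodule.span ℝ {a, b, c} := Submodule.subset_span (by simp)
    have hc : c ∈ Submodule.span ℝ {a, b, c} := Submodule.subset_span (by simp)
    have h1 : s = (1 / 2 : ℝ) • (a + c) := by simp only [a, c]; module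
    have hs' : s ∈ Submodule.span ℝ {a, b, c} := by
      rw [h1]; exact Submodule.smul_mem _ _ (Submodule.add_mem _ ha hc)
    have h2 : Y = k • (c - a) - s := by
      have : k • (c - a) = (k * (1 / k)) • (s + Y) := by
        simp only [a, c]
        rw [show (1 / k) = 2 * (1 / (2 * k)) by field_simp]; module
      rw [this, mul_one_div_cancel hk0.ne']; module
    have hY' : Y ∈ Submodule.span ℝ {a, b, c} := by
      rw [h2]
      exact Submodule.sub_mem _ (Submodule.smul_mem _ _ (Submodule.sub_mem _ hc ha)) hs'
    have h3 : B = β • b - m • s := by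
      simp only [b, smul_smul, mul_inv_cancel₀ hβ0.ne']; module
    have hB' : B ∈ Submodule.span ℝ {a, b, c} := by
      rw [h3]
      exact Submodule.sub_mem _ (Submodule.smul_mem _ _ hb) (Submodule.smul_mem _ _ hs')
    refine ⟨hs', hY', hB', fun w w1 w2 w3 p hp => ?_⟩
    induction hp using Submodule.span_induction with
    | mem x hx =>
      rcases hx with rfl | rfl | rfl
      · simp only [a, lie_sub_left, lie_smul_left, lie_add_left, w1, w2]; ring
      · simp only [b, lie_smul_left, lie_add_left, w1, w3]; ring
      · simp only [c, lie_smul_left, lie_add_left, w1, w2]; ring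
    | zero => simp
    | add x y _ _ hx hy => rw [lie_add_left, hx, hy]; ring
    | smul c x _ hx => rw [lie_smul_left, hx]; ring

/-- A direction of the conic arc, orthogonal to its points: a multiple of the derivative. -/
noncomputable def tangent (P Y B : LieVec) (u : ℝ) : LieVec :=
  (u * (1 - u) - u ^ 2 * (lie B Y / lie P Y)) • Y + (1 - 2 * u) • B

theorem IsPreArc.lie_tangent {P Y B : LieVec} (h : IsPreArc P Y B) (u : ℝ) :
    lie (tangent P Y B u) (tangent P Y B u) = weight P Y B u ^ 2 * (-lie P Y / 2) := by
  have h0 := h.neg.ne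
  simp only [tangent, weight, lie_add_left, lie_add_right, lie_smul_left, lie_smul_right, h.YY,
    h.BB, lie_comm Y B]
  field_simp; ring

theorem IsPreArc.lie_numer_tangent {P Y B : LieVec} (h : IsPreArc P Y B) (u : ℝ) :
    weight P Y B u * lie P (tangent P Y B u) + lie (numer Y B u) (tangent P Y B u) = 0 := by
  have h0 := h.neg.ne
  simp only [tangent, weight, numer, lie_add_left, lie_add_right, lie_smul_left, lie_smul_right,
    h.YY, h.BB, h.PB, lie_comm Y B]
  field_simp; ring

/-- A unit normal `N` at `P`, orthogonal also to `Z`, gives the sphere `N + er`, which touches the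
patch at `P` and contains the line `u = 0`. If it contains `Y` too, the whole patch lies on it;
otherwise enveloping spheres are obtained by moving it along the two arcs. -/
theorem PatchData.IsGood.isPatch {D : PatchData} (h : D.IsGood) : IsPatch D.std := by
  obtain ⟨n, hn0, hn⟩ := exists_orthogonal ![er, D.P, D.Z, D.C, D.B]
  have hnr : rad n = 0 := by
    have := hn 0
    simp only [Matrix.cons_val_zero, lie_er] at this; linarith
  have hnP : lie n D.P = 0 := hn 1
  have hnZ : lie n D.Z = 0 := hn 2
  have hnC : lie n D.C = 0 := hn 3
  have hnB : lie n D.B = 0 := hn 4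
  have hPY := h.arc₁.neg
  have hPZ := h.arc₂.neg
  -- Being orthogonal to the point `P`, the vector `n` is spacelike or a multiple of `P`; the latter
  -- contradicts `lie P Z < 0`.
  have hnn : 0 < lie n n := by
    refine lt_of_le_of_ne (h.pt.lie_self_nonneg hnr (by rw [lie_comm, hnP])) fun h0 => ?_
    have h1 := h.pt.eq_smul hnr (by rw [lie_comm, hnP]) h0.symm
    rw [h1, lie_smul_left] at hnZ
    rcases mul_eq_zero.mp hnZ with h2 | h2
    · exact hn0 (by rw [h1, h2, zero_smul])
    · linarith
  obtain ⟨N, hNr, hNN, hNP, hNZ, hNC, hNB⟩ : ∃ N : LieVec, rad N = 0 ∧ lie N N = 1 ∧ lie N D.P = 0 ∧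
      lie N D.Z = 0 ∧ lie N D.C = 0 ∧ lie N D.B = 0 := by
    have hs := Real.mul_self_sqrt hnn.le
    have hs0 := (Real.sqrt_pos.2 hnn).ne'
    refine ⟨(Real.sqrt (lie n n))⁻¹ • n, ?_, ?_, ?_, ?_, ?_, ?_⟩ <;>
      simp only [rad_smul, lie_smul_left, lie_smul_right, hnr, hnP, hnZ, hnC, hnB, mul_zero]
    field_simp; linarith
  clear hn0 hn hnr hnP hnZ hnC hnB hnn n
  -- The number `μ` measures how far the end point `P + Y` is from lying on the sphere `N + er`; it
  -- decides between spherical and Dupin patches.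
  obtain ⟨μ, hNY⟩ : ∃ μ, lie N D.Y = -μ * lie D.P D.Y :=
    ⟨-lie N D.Y / lie D.P D.Y, by rw [neg_div, neg_neg, div_mul_cancel₀ _ hPY.ne]⟩
  have hNe : lie N er = 0 := by rw [lie_er, hNr, neg_zero]
  have hee : lie er er = -1 := by rw [lie_er, rad_er]
  have heP : lie D.P er = 0 := by rw [lie_er, h.pt.rad, neg_zero]
  have heY : lie D.Y er = 0 := by rw [lie_er, h.arc₁.radY, neg_zero]
  have heB : lie D.B er = 0 := by rw [lie_er, h.arc₁.radB, neg_zero]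
  have heZ : lie D.Z er = 0 := by rw [lie_er, h.arc₂.radY, neg_zero]
  have heC : lie D.C er = 0 := by rw [lie_er, h.arc₂.radB, neg_zero]
  have hPB := h.arc₁.PB
  have hPC := h.arc₂.PB
  have hyz := h.YZ
  have hyc := h.YC
  have hbz := h.BZ
  have hbc := h.BC
  by_cases hμ0 : μ = 0
  · right
    rw [hμ0, neg_zero, zero_mul] at hNY
    refine ⟨h.continuousOn_std, fun p hp p' hp' he => ?_, N + er, ?_, ?_,
      tangent D.P D.Y D.B, tangent D.P D.Z D.C, ?_, ?_, ?_, ?_⟩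
    · obtain ⟨h1, h2⟩ := h.injOn hp.1 hp.2 hp'.1 hp'.2 he
      exact Prod.ext h1 h2
    · simp only [lie_add_left, lie_add_right, hNN, hNe, hee, lie_comm er N]; ring
    · rw [rad_add, hNr, rad_er]; norm_num
    · refine fun u hu => ⟨?_, ?_, ?_⟩
      · simp only [tangent, rad_add, rad_smul, h.arc₁.radY, h.arc₁.radB]; ring
      · simp only [tangent, lie_add_left, lie_add_right, lie_smul_left, heY, heB,
          lie_comm D.Y N, lie_comm D.B N, hNY, hNB]; ring
      · rw [h.arc₁.lie_tangent]
        exact mul_pos (pow_pos (h.r_pos u hu) 2) (by linarith)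
    · refine fun u hu => ⟨?_, ?_, ?_⟩
      · simp only [tangent, rad_add, rad_smul, h.arc₂.radY, h.arc₂.radB]; ring
      · simp only [tangent, lie_add_left, lie_add_right, lie_smul_left, heZ, heC,
          lie_comm D.Z N, lie_comm D.C N, hNZ, hNC]; ring
      · rw [h.arc₂.lie_tangent]
        exact mul_pos (pow_pos (h.q_pos u hu) 2) (by linarith)
    · intro u _ v _
      simp only [tangent, lie_add_left, lie_add_right, lie_smul_left, lie_smul_right, hyz, hyc,
        hbz, hbc]; ring
    · intro u hu v hv
      rw [PatchData.std, pt_toSpace (h.isPt_F hu hv)]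
      simp only [lie_smul_left]
      refine ⟨mul_eq_zero_of_right _ ?_, mul_eq_zero_of_right _ ?_, mul_eq_zero_of_right _ ?_⟩
      · simp only [F, y, z, numer, lie_add_left, lie_smul_left, heP, heY, heB, heZ,
          heC, lie_add_right, lie_comm D.P N, lie_comm D.Y N, lie_comm D.B N, lie_comm D.Z N,
          lie_comm D.C N, hNP, hNY, hNB, hNZ, hNC]; ring
      · have h1 := h.arc₁.lie_numer_tangent u
        have h2 : lie (D.z v) (tangent D.P D.Y D.B u) = 0 := by
          simp only [z, numer, tangent, lie_add_left, lie_add_right, lie_smul_left, lie_smul_right,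
            lie_comm D.Z D.Y, lie_comm D.C D.Y, lie_comm D.Z D.B, lie_comm D.C D.B, hyz, hyc,
            hbz, hbc]; ring
        simp only [F, r, y, lie_add_left, lie_smul_left, h2]
        linear_combination (D.q v) * h1
      · have h1 := h.arc₂.lie_numer_tangent v
        have h2 : lie (D.y u) (tangent D.P D.Z D.C v) = 0 := by
          simp only [y, numer, tangent, lie_add_left, lie_add_right, lie_smul_left, lie_smul_right,
            hyz, hyc, hbz, hbc]; ring
        simp only [F, q, z, lie_add_left, lie_smul_left, h2]
        linear_combination (D.r u) * h1
  · left
    have hμ2 : 0 < μ ^ 2 := by positivity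
    obtain ⟨P₁, hP₁, s1, Y1, B1, o1⟩ := exists_cyclidicPlane (s := N + er) (Y := -μ • D.Y) (B := D.B)
      (by simp only [lie_add_left, lie_add_right, hNN, hNe, hee, lie_comm er N]; ring)
      (by simp only [lie_add_left, lie_smul_left, lie_smul_right, hNY, lie_comm er D.Y, heY,
            h.arc₁.YY]; ring)
      (by simp only [lie_add_left, lie_smul_right, hNY, lie_comm er D.Y, heY]; nlinarith)
      (by simp only [lie_add_left, hNB, lie_comm er D.B, heB]; ring)
      (by rw [h.arc₁.BB]; linarith)
    obtain ⟨P₂, hP₂, s2, Z2, C2, o2⟩ := exists_cyclidicPlane (s := N + er + μ • D.P)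
      (Y := μ • D.Z) (B := D.C)
      (by simp only [lie_add_left, lie_add_right, lie_smul_left, lie_smul_right, hNN, hNe, hee,
            lie_comm er N, hNP, lie_comm D.P N, lie_comm er D.P, heP, h.pt.null]; ring)
      (by simp only [lie_add_left, lie_smul_left, lie_smul_right, hNZ, lie_comm er D.Z, heZ,
            h.arc₂.YY]; ring)
      (by simp only [lie_add_left, lie_smul_left, lie_smul_right, hNZ, lie_comm er D.Z, heZ]
          nlinarith)
      (by simp only [lie_add_left, lie_smul_left, hNC, lie_comm er D.C, heC, hPC]; ring)
      (by rw [h.arc₂.BB]; linarith)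
    have Y1' : D.Y ∈ P₁ := by
      have := P₁.smul_mem (-μ)⁻¹ Y1
      rwa [smul_smul, inv_mul_cancel₀ (neg_ne_zero.2 hμ0), one_smul] at this
    have Z2' : D.Z ∈ P₂ := by
      have := P₂.smul_mem μ⁻¹ Z2
      rwa [smul_smul, inv_mul_cancel₀ hμ0, one_smul] at this
    -- With `s₁ = r (N + er) - μ y` and `s₂ = q (N + er + μ P) + μ z` one has `r s₂ - q s₁ = μ F`,
    -- so the point of the patch lies in the contact element. The radii are `r` and `q`, which are
    -- positive.
    refine ⟨P₁, P₂, hP₁, hP₂, ?_, fun u => D.r u • (N + er) - μ • D.y u,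
      fun v => D.q v • (N + er + μ • D.P) + μ • D.z v, ?_, ?_, ?_⟩
    · intro p hp q hq
      rw [lie_comm]
      refine o2 p ?_ ?_ ?_ q hq
      · rw [lie_comm]; refine o1 _ ?_ ?_ ?_ p hp
        · simp only [lie_add_left, lie_add_right, lie_smul_right, hNN, hNe, hee,
            lie_comm er N, hNP, lie_comm er D.P, heP]; ring
        · simp only [lie_add_right, lie_smul_left, lie_smul_right, heY, lie_comm D.Y N,
            hNY, lie_comm D.Y D.P]; ring
        · simp only [lie_add_right, lie_smul_right, heB, lie_comm D.B N,
            hNB, lie_comm D.B D.P, hPB]; ring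
      · rw [lie_comm]; refine o1 _ ?_ ?_ ?_ p hp
        · simp only [lie_add_left, lie_smul_right, hNZ, lie_comm er D.Z, heZ]; ring
        · simp only [lie_smul_left, lie_smul_right, hyz]; ring
        · simp only [lie_smul_right, hbz]; ring
      · rw [lie_comm]; refine o1 _ ?_ ?_ ?_ p hp
        · simp only [lie_add_left, hNC, lie_comm er D.C, heC]; ring
        · simp only [lie_smul_left, hyc]; ring
        · exact hbc
    -- For `u = u'` this is isotropy; for `u ≠ u'` the product is non-zero, so the two isotropic
    -- vectors are independent.
    · have key : ∀ u u', lie (D.r u • (N + er) - μ • D.y u) (D.r u' • (N + er) - μ • D.y u') =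
          μ ^ 2 * (lie D.P D.Y * (u - u') ^ 2) := by
        intro u u'
        have e1 := h.arc₁.lie_numer u u'
        have e2 : ∀ u, lie N (D.y u) = -μ * lie D.P D.Y * u ^ 2 := fun u => by
          simp only [y, numer, lie_add_right, lie_smul_right, hNY, hNB]; ring
        have e3 : ∀ u, lie (D.y u) er = 0 := fun u => by
          rw [lie_er, y, h.arc₁.rad_numer, neg_zero]
        simp only [lie_add_left, lie_add_right, lie_sub_left, lie_sub_right, lie_smul_left,
          lie_smul_right, e2, e3, hNN, hee, hNe, lie_comm er N, lie_comm er (D.y _),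
          lie_comm (D.y _) N]
        simp only [y, e1, r]; ring
      have hrad : ∀ u, rad (D.r u • (N + er) - μ • D.y u) = D.r u := fun u => by
        rw [rad_sub, rad_smul, rad_smul, rad_add, hNr, rad_er, y, h.arc₁.rad_numer]; ring
      refine ⟨?_, ?_, ?_, ?_, ?_⟩
      · have h1 : Continuous D.r := continuous_weight _ _ _
        have h2 : Continuous D.y := continuous_numer _ _
        fun_prop
      · intro u _
        refine P₁.sub_mem (P₁.smul_mem _ s1) (P₁.smul_mem _ ?_)
        exact P₁.add_mem (P₁.smul_mem _ Y1') (P₁.smul_mem _ B1)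
      · intro u _; rw [key]; ring
      · intro u hu u' hu' hne
        rw [LinearIndependent.pair_iff]
        intro x w hxw
        have hL : μ ^ 2 * (lie D.P D.Y * (u - u') ^ 2) ≠ 0 :=
          mul_ne_zero hμ2.ne' (mul_ne_zero hPY.ne (pow_ne_zero 2 (sub_ne_zero.2 hne)))
        constructor
        · have := congrArg (fun a => lie a (D.r u' • (N + er) - μ • D.y u')) hxw
          simp only [lie_add_left, lie_smul_left, key, lie_zero_left, sub_self] at this
          rcases mul_eq_zero.mp (show x * (μ ^ 2 * (lie D.P D.Y * (u - u') ^ 2)) = 0 by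
            linear_combination this) with h1 | h1
          · exact h1
          · exact absurd h1 hL
        · have := congrArg (fun a => lie a (D.r u • (N + er) - μ • D.y u)) hxw
          simp only [lie_add_left, lie_smul_left, key, lie_zero_left, sub_self] at this
          rcases mul_eq_zero.mp (show w * (μ ^ 2 * (lie D.P D.Y * (u - u') ^ 2)) = 0 by
            linear_combination this) with h1 | h1
          · exact h1
          · exact absurd h1 hL
      · intro u hu; rw [hrad]; exact (h.r_pos u hu).ne'
    · have key : ∀ u u', lie (D.q u • (N + er + μ • D.P) + μ • D.z u)
          (D.q u' • (N + er + μ • D.P) + μ • D.z u') = μ ^ 2 * (lie D.P D.Z * (u - u') ^ 2) := by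
        intro u u'
        have e1 := h.arc₂.lie_numer u u'
        have e2 : ∀ u, lie N (D.z u) = 0 := fun u => by
          simp only [z, numer, lie_add_right, lie_smul_right, hNZ, hNC]; ring
        have e3 : ∀ u, lie (D.z u) er = 0 := fun u => by
          rw [lie_er, z, h.arc₂.rad_numer, neg_zero]
        have e4 := h.arc₂.lie_P_numer
        simp only [lie_add_left, lie_add_right, lie_smul_left,
          lie_smul_right, e2, e3, hNN, hee, hNe, lie_comm er N, lie_comm er (D.z _),
          lie_comm (D.z _) N, lie_comm (D.z _) D.P, hNP, lie_comm D.P N, h.pt.null, heP,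
          lie_comm er D.P]
        simp only [z, e1, e4, q]; ring
      have hrad : ∀ u, rad (D.q u • (N + er + μ • D.P) + μ • D.z u) = D.q u := fun u => by
        rw [rad_add, rad_smul, rad_smul, rad_add, rad_add, rad_smul, hNr, rad_er, h.pt.rad, z,
          h.arc₂.rad_numer]; ring
      refine ⟨?_, ?_, ?_, ?_, ?_⟩
      · have h1 : Continuous D.q := continuous_weight _ _ _
        have h2 : Continuous D.z := continuous_numer _ _
        fun_prop
      · intro u _
        refine P₂.add_mem (P₂.smul_mem _ s2) (P₂.smul_mem _ ?_)
        exact P₂.add_mem (P₂.smul_mem _ Z2') (P₂.smul_mem _ C2)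
      · intro u _; rw [key]; ring
      · intro u hu u' hu' hne
        rw [LinearIndependent.pair_iff]
        intro x w hxw
        have hL : μ ^ 2 * (lie D.P D.Z * (u - u') ^ 2) ≠ 0 :=
          mul_ne_zero hμ2.ne' (mul_ne_zero hPZ.ne (pow_ne_zero 2 (sub_ne_zero.2 hne)))
        constructor
        · have := congrArg (fun a => lie a (D.q u' • (N + er + μ • D.P) + μ • D.z u')) hxw
          simp only [lie_add_left (x • _), lie_smul_left x, lie_smul_left w, key, lie_zero_left,
            sub_self] at this
          rcases mul_eq_zero.mp (show x * (μ ^ 2 * (lie D.P D.Z * (u - u') ^ 2)) = 0 by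
            linear_combination this) with h1 | h1
          · exact h1
          · exact absurd h1 hL
        · have := congrArg (fun a => lie a (D.q u • (N + er + μ • D.P) + μ • D.z u)) hxw
          simp only [lie_add_left (x • _), lie_smul_left x, lie_smul_left w, key, lie_zero_left,
            sub_self] at this
          rcases mul_eq_zero.mp (show w * (μ ^ 2 * (lie D.P D.Z * (u - u') ^ 2)) = 0 by
            linear_combination this) with h1 | h1
          · exact h1
          · exact absurd h1 hL
      · intro u hu; rw [hrad]; exact (h.q_pos u hu).ne'
    · intro u hu v hv
      rw [PatchData.std, pt_toSpace (h.isPt_F hu hv), Submodule.mem_span_pair]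
      refine ⟨-((tr (D.F u v))⁻¹ * μ⁻¹ * D.q v), (tr (D.F u v))⁻¹ * μ⁻¹ * D.r u, ?_⟩
      have : D.F u v = μ⁻¹ • (D.r u • (D.q v • (N + er + μ • D.P) + μ • D.z v) -
          D.q v • (D.r u • (N + er) - μ • D.y u)) := by
        have e : D.r u • (D.q v • (N + er + μ • D.P) + μ • D.z v) -
          D.q v • (D.r u • (N + er) - μ • D.y u) = μ • D.F u v := by simp only [F]; module
        rw [e, smul_smul, inv_mul_cancel₀ hμ0, one_smul]
      generalize (tr (D.F u v))⁻¹ = T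
      rw [this]
      module

/-! ### Reparametrizations -/

theorem zero_mem_I : (0 : ℝ) ∈ I := ⟨le_refl _, zero_le_one⟩
theorem one_mem_I : (1 : ℝ) ∈ I := ⟨zero_le_one, le_refl _⟩

theorem isReparam_of_injOn {α : ℝ → ℝ} (hc : ContinuousOn α I) (hi : InjOn α I) (h0 : α 0 = 0)
    (h1 : α 1 = 1) : IsReparam α := by
  have hm : StrictMonoOn α I :=
    hc.strictMonoOn_of_injOn_Icc zero_le_one (by rw [h0, h1]; exact zero_le_one) hi
  refine ⟨hm, Subset.antisymm ?_ ?_⟩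
  · rintro _ ⟨u, hu, rfl⟩
    exact ⟨h0 ▸ hm.monotoneOn zero_mem_I hu hu.1, h1 ▸ hm.monotoneOn hu one_mem_I hu.2⟩
  · have := intermediate_value_Icc zero_le_one hc
    rwa [h0, h1] at this

namespace IsReparam

variable {α β : ℝ → ℝ}

theorem mem (h : IsReparam α) {u : ℝ} (hu : u ∈ I) : α u ∈ I := by
  have := mem_image_of_mem α hu
  rwa [h.2] at this

theorem surj (h : IsReparam α) {u : ℝ} (hu : u ∈ I) : ∃ w ∈ I, α w = u := by
  rw [← h.2] at hu; exact hu

theorem injOn (h : IsReparam α) : InjOn α I := h.1.injOn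

theorem map_zero (h : IsReparam α) : α 0 = 0 := by
  obtain ⟨w, hw, e⟩ := h.surj zero_mem_I
  have := h.1.monotoneOn zero_mem_I hw hw.1
  exact le_antisymm (e ▸ this) (h.mem zero_mem_I).1

theorem map_one (h : IsReparam α) : α 1 = 1 := by
  obtain ⟨w, hw, e⟩ := h.surj one_mem_I
  have := h.1.monotoneOn hw one_mem_I hw.2
  exact le_antisymm (h.mem one_mem_I).2 (e ▸ this)

theorem comp (h : IsReparam α) (h' : IsReparam β) : IsReparam (α ∘ β) :=
  ⟨fun u hu v hv huv => h.1 (h'.mem hu) (h'.mem hv) (h'.1 hu hv huv), by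
    rw [image_comp, h'.2, h.2]⟩

theorem exists_inv (h : IsReparam α) :
    ∃ β, IsReparam β ∧ (∀ u ∈ I, α (β u) = u) ∧ ∀ u ∈ I, β (α u) = u := by
  have hb : ∀ u ∈ I, Function.invFunOn α I u ∈ I := fun u hu =>
    Function.invFunOn_mem (h.surj hu)
  have hr : ∀ u ∈ I, α (Function.invFunOn α I u) = u := fun u hu =>
    Function.invFunOn_eq (h.surj hu)
  have hl : ∀ u ∈ I, Function.invFunOn α I (α u) = u := fun u hu =>
    h.injOn (hb _ (h.mem hu)) hu (hr _ (h.mem hu))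
  refine ⟨_, ⟨fun u hu v hv huv => ?_, Subset.antisymm ?_ ?_⟩, hr, hl⟩
  · rw [← h.1.lt_iff_lt (hb u hu) (hb v hv), hr u hu, hr v hv]; exact huv
  · rintro _ ⟨u, hu, rfl⟩; exact hb u hu
  · intro u hu; exact ⟨α u, h.mem hu, hl u hu⟩

theorem image_comp_eq (h : IsReparam α) {X : Type*} (f : ℝ → X) :
    (fun u => f (α u)) '' I = f '' I := by
  conv_rhs => rw [← h.2, image_image]

end IsReparam

theorem SamePatch.symm {f g : ℝ → ℝ → Space} (h : SamePatch f g) : SamePatch g f := by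
  obtain ⟨α, β, hα, hβ, e⟩ := h
  obtain ⟨α', hα', ar, -⟩ := hα.exists_inv
  obtain ⟨β', hβ', br, -⟩ := hβ.exists_inv
  exact ⟨α', β', hα', hβ', fun u hu v hv => by
    rw [e _ (hα'.mem hu) _ (hβ'.mem hv), ar u hu, br v hv]⟩

theorem SamePatch.trans {f g k : ℝ → ℝ → Space} (h : SamePatch f g) (h' : SamePatch g k) :
    SamePatch f k := by
  obtain ⟨α, β, hα, hβ, e⟩ := h
  obtain ⟨α', β', hα', hβ', e'⟩ := h'
  exact ⟨α' ∘ α, β' ∘ β, hα'.comp hα, hβ'.comp hβ, fun u hu v hv => by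
    rw [e u hu v hv, e' _ (hα.mem hu) _ (hβ.mem hv)]; rfl⟩

/-- The intermediate value theorem, in the form that turns non-degeneracy of a patch into positivity
of a weight. -/
theorem pos_of_ne_zero {X : Type*} [TopologicalSpace X] {s : Set X} (hs : IsPreconnected s)
    {f : X → ℝ} (hf : ContinuousOn f s) (hne : ∀ x ∈ s, f x ≠ 0) {x₀ : X} (h₀ : x₀ ∈ s)
    (hpos : 0 < f x₀) : ∀ x ∈ s, 0 < f x := by
  intro x hx
  by_contra hc
  obtain ⟨w, hw, e⟩ := hs.intermediate_value hx h₀ hf ⟨not_lt.mp hc, hpos.le⟩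
  exact hne w hw e

/-! ### Arcs of conics -/

/-- The conic is parametrized rationally by the lines through its point with parameter `0`: `α = l /
(l + μ)`. The weight at `α u` becomes `l / (l + μ) ^ 2`, so it is positive, and since `α` is onto
the weight is positive on all of the interval. -/
theorem exists_reparam_of_conic {l μ : ℝ → ℝ} {m : ℝ} (hl : ContinuousOn l I)
    (hμ : ContinuousOn μ I) (l0 : l 0 = 0) (μ0 : μ 0 = 0) (l1 : l 1 = 1) (μ1 : μ 1 = 0)
    (conic : ∀ u ∈ I, l u ^ 2 + 2 * m * l u * μ u + μ u ^ 2 = l u)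
    (lpos : ∀ u ∈ I, u ≠ 0 → 0 < l u) (μpos : ∀ u ∈ Ioo (0 : ℝ) 1, 0 < μ u)
    (inj : ∀ u ∈ I, ∀ u' ∈ I, l u = l u' → μ u = μ u' → u = u') :
    ∃ α, IsReparam α ∧
      (∀ u ∈ I, ((1 - α u) ^ 2 + α u ^ 2 + 2 * α u * (1 - α u) * m) * l u = α u ^ 2) ∧
      (∀ u ∈ I, ((1 - α u) ^ 2 + α u ^ 2 + 2 * α u * (1 - α u) * m) * μ u = α u * (1 - α u)) ∧
      ∀ u ∈ I, 0 < (1 - u) ^ 2 + u ^ 2 + 2 * u * (1 - u) * m := by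
  -- At `u = 0` the quotient is `0 / 0 = 0`, which is the required value.
  set α : ℝ → ℝ := fun u => l u / (l u + μ u) with hα
  have μnn : ∀ u ∈ I, 0 ≤ μ u := fun u hu => by
    rcases eq_or_lt_of_le hu.1 with h | h
    · rw [← h, μ0]
    · rcases eq_or_lt_of_le hu.2 with h' | h'
      · rw [h', μ1]
      · exact (μpos u ⟨h, h'⟩).le
  have lnn : ∀ u ∈ I, 0 ≤ l u := fun u hu => by
    by_cases h : u = 0
    · rw [h, l0]
    · exact (lpos u hu h).le
  have spos : ∀ u ∈ I, u ≠ 0 → 0 < l u + μ u := fun u hu h =>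
    add_pos_of_pos_of_nonneg (lpos u hu h) (μnn u hu)
  have α0 : α 0 = 0 := by simp [hα, l0]
  have α1 : α 1 = 1 := by simp [hα, l1, μ1]
  have hr : ∀ u ∈ I, u ≠ 0 → (1 - α u) ^ 2 + α u ^ 2 + 2 * α u * (1 - α u) * m =
      l u / (l u + μ u) ^ 2 := fun u hu h => by
    have := spos u hu h
    have h1 : 1 - α u = μ u / (l u + μ u) := by simp only [hα]; field_simp; ring
    rw [h1]
    simp only [hα]
    rw [div_pow, div_pow, ← add_div, eq_div_iff (by positivity)]
    field_simp
    linear_combination conic u hu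
  have e1 : ∀ u ∈ I, ((1 - α u) ^ 2 + α u ^ 2 + 2 * α u * (1 - α u) * m) * l u = α u ^ 2 := by
    intro u hu
    by_cases h : u = 0
    · simp [h, α0, l0]
    · rw [hr u hu h]; simp only [hα]; rw [div_pow]; ring
  have e2 : ∀ u ∈ I, ((1 - α u) ^ 2 + α u ^ 2 + 2 * α u * (1 - α u) * m) * μ u =
      α u * (1 - α u) := by
    intro u hu
    by_cases h : u = 0
    · simp [h, α0, μ0]
    · have := spos u hu h
      rw [hr u hu h]; simp only [hα]; field_simp; ring
  have hinj : InjOn α I := by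
    intro u hu u' hu' he
    by_cases h : u = 0
    · by_contra hne
      have h' : u' ≠ 0 := fun h' => hne (h.trans h'.symm)
      have : 0 < α u' := div_pos (lpos u' hu' h') (spos u' hu' h')
      rw [← he, h, α0] at this; exact lt_irrefl _ this
    · by_cases h' : u' = 0
      · have : 0 < α u := div_pos (lpos u hu h) (spos u hu h)
        rw [he, h', α0] at this; exact absurd this (lt_irrefl _)
      · have hp : 0 < (1 - α u) ^ 2 + α u ^ 2 + 2 * α u * (1 - α u) * m := by
          rw [hr u hu h]; exact div_pos (lpos u hu h) (pow_pos (spos u hu h) 2)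
        have a1 := e1 u hu
        have a2 := e2 u hu
        have b1 := e1 u' hu'
        have b2 := e2 u' hu'
        rw [← he] at b1 b2
        exact inj u hu u' hu' (mul_left_cancel₀ hp.ne' (a1.trans b1.symm))
          (mul_left_cancel₀ hp.ne' (a2.trans b2.symm))
  have hcont : ContinuousOn α I := by
    intro u hu
    by_cases h : u = 0
    · subst h
      -- The equation of the conic gives `l ≤ (1 + |m|) * (l + μ) ^ 2`, whence continuity at the
      -- point where the quotient degenerates.
      have hb : ∀ u ∈ I, ‖α u‖ ≤ (1 + |m|) * (l u + μ u) := by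
        intro u hu
        by_cases h : u = 0
        · rw [h, α0, l0, μ0]; simp
        · have h1 := spos u hu h
          rw [Real.norm_of_nonneg (div_nonneg (lnn u hu) h1.le), div_le_iff₀ h1]
          have h2 := conic u hu
          have h3 := mul_nonneg (lnn u hu) (μnn u hu)
          have h4 := le_abs_self m
          have h5 := abs_nonneg m
          nlinarith [mul_le_mul_of_nonneg_right h4 h3, mul_nonneg h5 (sq_nonneg (l u)),
            mul_nonneg h5 (sq_nonneg (μ u))]
      have ht : Tendsto (fun u => (1 + |m|) * (l u + μ u)) (𝓝[I] 0) (𝓝 0) := by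
        have h1 : Tendsto l (𝓝[I] 0) (𝓝 (l 0)) := hl 0 hu
        have h2 : Tendsto μ (𝓝[I] 0) (𝓝 (μ 0)) := hμ 0 hu
        have h3 := (h1.add h2).const_mul (1 + |m|)
        rwa [l0, μ0, add_zero, mul_zero] at h3
      change Tendsto α (𝓝[I] 0) (𝓝 (α 0))
      rw [α0]
      exact squeeze_zero_norm' (eventually_mem_nhdsWithin.mono hb) ht
    · exact (hl u hu).div ((hl u hu).add (hμ u hu)) (spos u hu h).ne'
  have hrep := isReparam_of_injOn hcont hinj α0 α1
  refine ⟨α, hrep, e1, e2, fun w hw => ?_⟩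
  obtain ⟨u, hu, rfl⟩ := hrep.surj hw
  by_cases h : u = 0
  · simp [h, α0]
  · rw [hr u hu h]; exact div_pos (lpos u hu h) (pow_pos (spos u hu h) 2)

/-- The vector `B` spans the part of `U` orthogonal to `P` and is scaled to the length required by
`IsPreArc`. The parameter `1 / 2` serves to show that the curve leaves the line through its end
points. -/
theorem exists_direction {P : LieVec} (hP : IsPt P) {Y : ℝ → LieVec} {U : Submodule ℝ LieVec}
    (hU : Module.finrank ℝ U ≤ 2) (hrad : ∀ w ∈ U, rad w = 0) (hYU : ∀ u ∈ I, Y u ∈ U)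
    (h0 : Y 0 = 0) (hpt : ∀ u ∈ I, IsPt (P + Y u))
    (hinj : ∀ u ∈ I, ∀ u' ∈ I, u ≠ u' → lie (P + Y u) (P + Y u') < 0) :
    ∃ B ∈ U, IsPreArc P (Y 1) B ∧ ∀ u ∈ I, ∃ x y : ℝ, Y u = x • Y 1 + y • B := by
  have hh : (1 / 2 : ℝ) ∈ I := ⟨by norm_num, by norm_num⟩
  have hL : lie P (Y 1) < 0 := by
    have := hinj 0 zero_mem_I 1 one_mem_I zero_ne_one
    rwa [h0, add_zero, lie_add_right, hP.null, zero_add] at this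
  have hYY : lie (Y 1) (Y 1) = -2 * lie P (Y 1) := by
    have := (hpt 1 one_mem_I).null
    simp only [lie_add_left, lie_add_right, hP.null, lie_comm (Y 1) P] at this
    linarith
  -- The span of `P` and `Y 1` contains only two isotropic lines, those of the end points `P` and `P
  -- + Y 1`.
  have hno : ∀ x y : ℝ, Y (1 / 2) ≠ x • Y 1 + y • P := by
    intro x y he
    have h1 := (hpt _ hh).null
    have h2 := hinj 0 zero_mem_I _ hh (by norm_num)
    have h3 := hinj 1 one_mem_I _ hh (by norm_num)
    rw [h0, add_zero] at h2
    simp only [he, lie_add_left, lie_add_right, lie_smul_left, lie_smul_right, hP.null, hYY,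
      lie_comm (Y 1) P] at h1 h2 h3
    have h4 : lie P (Y 1) * (x * (1 + y - x)) = 0 := by linarith
    rcases mul_eq_zero.mp h4 with h5 | h5
    · exact hL.ne h5
    · rcases mul_eq_zero.mp h5 with h6 | h6
      · rw [h6] at h2; simp at h2
      · have : x = 1 + y := by linarith
        rw [this] at h3
        have : (0 : ℝ) < 0 := by linarith
        exact lt_irrefl _ this
  have hY1U := hYU 1 one_mem_I
  obtain ⟨w, hwU, hw⟩ : ∃ w ∈ U, w ∉ Submodule.span ℝ {Y 1} := by
    refine ⟨Y (1 / 2), hYU _ hh, fun h => ?_⟩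
    obtain ⟨x, hx⟩ := Submodule.mem_span_singleton.1 h
    exact hno x 0 (by rw [← hx]; simp)
  have hY10 : Y 1 ≠ 0 := by rintro h; rw [h] at hL; simp at hL
  have hspan : Submodule.span ℝ {Y 1, w} = U := by
    apply Submodule.eq_of_le_of_finrank_le
    · rw [Submodule.span_le]; rintro _ (rfl | rfl) <;> assumption
    · have hli : LinearIndependent ℝ ![Y 1, w] := by
        rw [LinearIndependent.pair_iff' hY10]
        intro a ha
        exact hw (Submodule.mem_span_singleton.2 ⟨a, ha⟩)
      have h1 := finrank_span_eq_card hli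
      have h2 : range ![Y 1, w] = {Y 1, w} := by
        simp [Matrix.range_cons, Matrix.range_empty, pair_comm]
      rw [h2, Fintype.card_fin] at h1
      rw [h1]; exact hU
  set B₀ := w - (lie P w / lie P (Y 1)) • Y 1 with hB₀
  have hB₀U : B₀ ∈ U := U.sub_mem hwU (U.smul_mem _ hY1U)
  have hPB₀ : lie P B₀ = 0 := by
    rw [hB₀, lie_sub_right, lie_smul_right, div_mul_cancel₀ _ hL.ne, sub_self]
  have hrep : ∀ x ∈ U, ∃ a b : ℝ, x = a • Y 1 + b • B₀ := by
    intro x hx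
    rw [← hspan, Submodule.mem_span_pair] at hx
    obtain ⟨a, b, rfl⟩ := hx
    exact ⟨a + b * (lie P w / lie P (Y 1)), b, by rw [hB₀]; module⟩
  have hBB : 0 < lie B₀ B₀ := by
    refine lt_of_le_of_ne (hP.lie_self_nonneg (hrad _ hB₀U) hPB₀) fun h => ?_
    obtain ⟨a, b, e⟩ := hrep _ (hYU _ hh)
    rw [hP.eq_smul (hrad _ hB₀U) hPB₀ h.symm, smul_smul] at e
    exact hno _ _ e
  set κ := Real.sqrt (-lie P (Y 1) / 2 / lie B₀ B₀) with hκ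
  have hκ0 : 0 < κ := Real.sqrt_pos.2 (div_pos (by linarith) hBB)
  have hκκ : κ * κ = -lie P (Y 1) / 2 / lie B₀ B₀ :=
    Real.mul_self_sqrt (div_pos (by linarith) hBB).le
  refine ⟨κ • B₀, U.smul_mem _ hB₀U, ⟨hrad _ hY1U, hrad _ (U.smul_mem _ hB₀U), ?_, hL, hYY, ?_⟩,
    fun u hu => ?_⟩
  · rw [lie_smul_right, hPB₀, mul_zero]
  · rw [lie_smul_left, lie_smul_right, ← mul_assoc, hκκ, div_mul_cancel₀ _ hBB.ne']
  · obtain ⟨a, b, e⟩ := hrep _ (hYU u hu)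
    exact ⟨a, b * κ⁻¹, by rw [e, smul_smul, inv_mul_cancel_right₀ hκ0.ne']⟩

/-- In the coordinates `l`, `μ` with respect to `Y 1` and `2 B`, isotropy of `P + Y u` is the
equation of `exists_reparam_of_conic` with `m = -lie B (Y 1) / lie P (Y 1)`. It remains to choose
the sign of `B` so that `μ` is positive inside the interval. -/
theorem exists_arc {P : LieVec} (hP : IsPt P) {Y : ℝ → LieVec} {U : Submodule ℝ LieVec}
    (hU : Module.finrank ℝ U ≤ 2) (hrad : ∀ w ∈ U, rad w = 0) (hc : ContinuousOn Y I)
    (hYU : ∀ u ∈ I, Y u ∈ U) (h0 : Y 0 = 0) (hpt : ∀ u ∈ I, IsPt (P + Y u))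
    (hinj : ∀ u ∈ I, ∀ u' ∈ I, u ≠ u' → lie (P + Y u) (P + Y u') < 0) :
    ∃ B ∈ U, ∃ α, IsPreArc P (Y 1) B ∧ IsReparam α ∧
      (∀ u ∈ I, 0 < weight P (Y 1) B u) ∧
      ∀ u ∈ I, weight P (Y 1) B (α u) • Y u = numer (Y 1) B (α u) := by
  obtain ⟨B₀, hB₀U, hA₀, hrep₀⟩ := exists_direction hP hU hrad hYU h0 hpt hinj
  have hL := hA₀.neg
  have hL0 := hL.ne
  -- the coordinates with respect to `Y 1` and `2 B₀`
  set l : ℝ → ℝ := fun u => lie P (Y u) / lie P (Y 1) with hl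
  set μ₀ : ℝ → ℝ := fun u => lie B₀ (Y u - l u • Y 1) / (2 * lie B₀ B₀) with hμ₀
  have hBB₀ : 0 < lie B₀ B₀ := by rw [hA₀.BB]; linarith
  have hdec₀ : ∀ u ∈ I, Y u = l u • Y 1 + (2 * μ₀ u) • B₀ := by
    intro u hu
    obtain ⟨x, y, e⟩ := hrep₀ u hu
    have hx : l u = x := by
      simp only [hl, e, lie_add_right, lie_smul_right, hA₀.PB, mul_zero, add_zero]
      rw [mul_div_cancel_right₀ _ hL0]
    have hy : μ₀ u = y / 2 := by
      have : Y u - l u • Y 1 = y • B₀ := by rw [hx, e]; module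
      simp only [hμ₀, this, lie_smul_right]; field_simp
    rw [hx, hy, e]; module
  have hlc : ContinuousOn l I := by
    have h1 : ContinuousOn (fun u => lie P (Y u)) I := continuousOn_lie continuousOn_const hc
    exact h1.div_const _
  have hμ₀c : ContinuousOn μ₀ I := by
    have h1 : ContinuousOn (fun u => lie B₀ (Y u - l u • Y 1)) I :=
      continuousOn_lie continuousOn_const (hc.sub (hlc.smul continuousOn_const))
    exact h1.div_const _
  have lpos : ∀ u ∈ I, u ≠ 0 → 0 < l u := by
    intro u hu hne
    have := hinj 0 zero_mem_I u hu hne.symm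
    rw [h0, add_zero, lie_add_right, hP.null, zero_add] at this
    exact div_pos_of_neg_of_neg this hL
  have l0 : l 0 = 0 := by simp [hl, h0]
  have l1 : l 1 = 1 := div_self hL.ne
  have μ₀0 : μ₀ 0 = 0 := by simp [hμ₀, h0, l0]
  have μ₀1 : μ₀ 1 = 0 := by simp [hμ₀, l1]
  have hinj' : ∀ u ∈ I, ∀ u' ∈ I, Y u = Y u' → u = u' := by
    intro u hu u' hu' he
    by_contra hne
    have := hinj u hu u' hu' hne
    rw [he, (hpt u' hu').null] at this
    exact lt_irrefl _ this
  have conic₀ : ∀ u ∈ I, l u ^ 2 + 2 * (-(lie B₀ (Y 1) / lie P (Y 1))) * l u * μ₀ u + μ₀ u ^ 2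
      = l u := by
    intro u hu
    have h1 := (hpt u hu).null
    rw [hdec₀ u hu] at h1
    simp only [lie_add_left, lie_add_right, lie_smul_left, lie_smul_right, hP.null, hA₀.PB,
      lie_comm (Y 1) P, lie_comm B₀ P, lie_comm (Y 1) B₀, hA₀.YY, hA₀.BB] at h1
    have hm : lie P (Y 1) * (lie B₀ (Y 1) / lie P (Y 1)) = lie B₀ (Y 1) := by field_simp
    apply mul_left_cancel₀ hL0
    linear_combination (-1 / 2) * h1 - 2 * l u * μ₀ u * hm
  -- The line `μ₀ = 0` meets the conic only where `l = 0` or `l = 1`, that is, at the two end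
  -- points.
  have μ₀ne : ∀ u ∈ Ioo (0 : ℝ) 1, μ₀ u ≠ 0 := by
    intro u hu h
    have huI : u ∈ I := ⟨hu.1.le, hu.2.le⟩
    have h1 := conic₀ u huI
    rw [h] at h1
    have h2 : l u * (l u - 1) = 0 := by linarith
    rcases mul_eq_zero.mp h2 with h3 | h3
    · exact (lpos u huI hu.1.ne').ne' h3
    · have h4 := hdec₀ u huI
      rw [h, sub_eq_zero.mp h3] at h4
      have : u = 1 := hinj' u huI 1 one_mem_I (by rw [h4]; simp)
      exact hu.2.ne this
  have hsub : Ioo (0 : ℝ) 1 ⊆ I := Ioo_subset_Icc_self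
  have hh : (1 / 2 : ℝ) ∈ Ioo (0 : ℝ) 1 := ⟨by norm_num, by norm_num⟩
  -- choose the sign of `B`
  obtain ⟨ε, hε, μpos⟩ : ∃ ε : ℝ, ε * ε = 1 ∧ ∀ u ∈ Ioo (0 : ℝ) 1, 0 < ε * μ₀ u := by
    rcases lt_or_gt_of_ne (μ₀ne _ hh) with h | h
    · refine ⟨-1, by norm_num, pos_of_ne_zero isPreconnected_Ioo
        (continuousOn_const.mul (hμ₀c.mono hsub)) (fun u hu => ?_) hh (by linarith)⟩
      simpa using μ₀ne u hu
    · refine ⟨1, by norm_num, pos_of_ne_zero isPreconnected_Ioo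
        (continuousOn_const.mul (hμ₀c.mono hsub)) (fun u hu => ?_) hh (by linarith)⟩
      simpa using μ₀ne u hu
  obtain ⟨α, hα, e1, e2, hw⟩ := exists_reparam_of_conic
    (μ := fun u => ε * μ₀ u) (m := ε * (-(lie B₀ (Y 1) / lie P (Y 1))))
    hlc (continuousOn_const.mul hμ₀c) l0 (by simp [μ₀0]) l1 (by simp [μ₀1])
    (fun u hu => by
      linear_combination conic₀ u hu + (2 * (-(lie B₀ (Y 1) / lie P (Y 1))) * l u * μ₀ u + μ₀ u ^ 2) * hε)
    lpos μpos (fun u hu u' hu' a1 a2 => by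
      apply hinj' u hu u' hu'
      have a3 : μ₀ u = μ₀ u' := by
        linear_combination ε * a2 - (μ₀ u - μ₀ u') * hε
      rw [hdec₀ u hu, hdec₀ u' hu', a1, a3])
  have hwt : ∀ u, weight P (Y 1) (ε • B₀) u =
      (1 - u) ^ 2 + u ^ 2 + 2 * u * (1 - u) * (ε * (-(lie B₀ (Y 1) / lie P (Y 1)))) := by
    intro u
    rw [weight, lie_smul_left]; ring
  refine ⟨ε • B₀, U.smul_mem _ hB₀U, α, ⟨hA₀.radY, ?_, ?_, hL, hA₀.YY, ?_⟩, hα, ?_, ?_⟩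
  · rw [rad_smul, hA₀.radB, mul_zero]
  · rw [lie_smul_right, hA₀.PB, mul_zero]
  · rw [lie_smul_left, lie_smul_right, ← mul_assoc, hε, one_mul, hA₀.BB]
  · intro u hu; rw [hwt]; exact hw u hu
  · intro u hu
    rw [hwt, numer]
    conv_lhs => rw [hdec₀ u hu]
    rw [smul_add, smul_smul, smul_smul, smul_smul, e1 u hu]
    congr 2
    linear_combination 2 * ε * e2 u hu - 2 * ((1 - α u) ^ 2 + α u ^ 2 + 2 * α u * (1 - α u) *
      (ε * (-(lie B₀ (Y 1) / lie P (Y 1))))) * μ₀ u * hε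

/-- A patch which is affinely a sum of two curves in orthogonal planes has a normal form. -/
theorem exists_data_of_affine {g : ℝ → ℝ → Space} {P : LieVec} {Y Z : ℝ → LieVec}
    {U V : Submodule ℝ LieVec} (hU : Module.finrank ℝ U ≤ 2) (hV : Module.finrank ℝ V ≤ 2)
    (hUr : ∀ w ∈ U, rad w = 0) (hVr : ∀ w ∈ V, rad w = 0)
    (hUV : ∀ w ∈ U, ∀ w' ∈ V, lie w w' = 0)
    (hYc : ContinuousOn Y I) (hZc : ContinuousOn Z I) (hYU : ∀ u ∈ I, Y u ∈ U)
    (hZV : ∀ v ∈ I, Z v ∈ V) (hY0 : Y 0 = 0) (hZ0 : Z 0 = 0)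
    (hg : ∀ u ∈ I, ∀ v ∈ I, ∃ c : ℝ, 0 < c ∧ pt (g u v) = c • (P + Y u + Z v))
    (hinj : ∀ u ∈ I, ∀ v ∈ I, ∀ u' ∈ I, ∀ v' ∈ I, g u v = g u' v' → u = u' ∧ v = v') :
    ∃ D : PatchData, D.IsGood ∧ SamePatch g D.std := by
  have hpt : ∀ u ∈ I, ∀ v ∈ I, IsPt (P + Y u + Z v) := by
    intro u hu v hv
    obtain ⟨c, hc, e⟩ := hg u hu v hv
    have : P + Y u + Z v = c⁻¹ • pt (g u v) := by
      rw [e, smul_smul, inv_mul_cancel₀ hc.ne', one_smul]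
    rw [this]; exact (isPt_pt _).smul (inv_pos.2 hc)
  have hto : ∀ u ∈ I, ∀ v ∈ I, g u v = toSpace (P + Y u + Z v) := by
    intro u hu v hv
    obtain ⟨c, hc, e⟩ := hg u hu v hv
    rw [← toSpace_pt (g u v), e, toSpace_smul hc.ne']
  have hP : IsPt P := by simpa [hY0, hZ0] using hpt 0 zero_mem_I 0 zero_mem_I
  have hptY : ∀ u ∈ I, IsPt (P + Y u) := fun u hu => by
    simpa [hZ0] using hpt u hu 0 zero_mem_I
  have hptZ : ∀ v ∈ I, IsPt (P + Z v) := fun v hv => by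
    simpa [hY0] using hpt 0 zero_mem_I v hv
  obtain ⟨B, hBU, α, hA, hα, hr, eα⟩ := exists_arc hP hU hUr hYc hYU hY0 hptY
    (fun u hu u' hu' hne => lie_neg_of_ne (hptY u hu) (hptY u' hu') fun he => hne (by
      have h1 := hto u hu 0 zero_mem_I
      have h2 := hto u' hu' 0 zero_mem_I
      rw [hZ0, add_zero] at h1 h2
      exact (hinj u hu 0 zero_mem_I u' hu' 0 zero_mem_I (by rw [h1, h2, he])).1))
  obtain ⟨C, hCV, β, hA', hβ, hq, eβ⟩ := exists_arc hP hV hVr hZc hZV hZ0 hptZ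
    (fun u hu u' hu' hne => lie_neg_of_ne (hptZ u hu) (hptZ u' hu') fun he => hne (by
      have h1 := hto 0 zero_mem_I u hu
      have h2 := hto 0 zero_mem_I u' hu'
      rw [hY0, add_zero] at h1 h2
      exact (hinj 0 zero_mem_I u hu 0 zero_mem_I u' hu' (by rw [h1, h2, he])).2))
  have hY1 := hYU 1 one_mem_I
  have hZ1 := hZV 1 one_mem_I
  refine ⟨⟨P, Y 1, B, Z 1, C⟩, ⟨⟨hP, hA, hA', hUV _ hY1 _ hZ1, hUV _ hY1 _ hCV, hUV _ hBU _ hZ1,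
    hUV _ hBU _ hCV⟩, hr, hq⟩, α, β, hα, hβ, fun u hu v hv => ?_⟩
  have hru := hr (α u) (hα.mem hu)
  have hqv := hq (β v) (hβ.mem hv)
  rw [hto u hu v hv, PatchData.std, ← toSpace_smul (mul_pos hru hqv).ne']
  congr 1
  simp only [PatchData.F, PatchData.r, PatchData.q, PatchData.y, PatchData.z]
  rw [← eα u hu, ← eβ v hv]
  module

/-! ### Normal form of Dupin patches -/

theorem radForm_ker_finrank {Pl : Submodule ℝ LieVec} (h : IsCyclidicPlane Pl) {s : LieVec}
    (hs : s ∈ Pl) (hr : rad s ≠ 0) :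
    Module.finrank ℝ (Pl ⊓ LinearMap.ker (lieForm er) : Submodule ℝ LieVec) ≤ 2 := by
  have h3 : Module.finrank ℝ Pl ≤ 3 := by
    classical
    obtain ⟨a, b, c, rfl, -⟩ := h
    have := finrank_span_finset_le_card (R := ℝ) ({a, b, c} : Finset LieVec)
    simp only [Finset.coe_insert, Finset.coe_singleton] at this
    exact this.trans Finset.card_le_three
  have hlt : Pl ⊓ LinearMap.ker (lieForm er) < Pl := by
    refine lt_of_le_of_ne inf_le_left fun he => hr ?_
    rw [← he] at hs
    have := LinearMap.mem_ker.1 hs.2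
    rw [lieForm_apply, lie_comm, lie_er] at this
    linarith
  have := Submodule.finrank_lt_finrank_of_lt hlt
  omega

theorem IsCyclidicPlane.eq_zero {Pl : Submodule ℝ LieVec} (h : IsCyclidicPlane Pl) {x : LieVec}
    (hx : x ∈ Pl) (ho : ∀ p ∈ Pl, lie p x = 0) : x = 0 := by
  obtain ⟨a, b, c, rfl, haa, hbb, hcc, hab, hac, hbc⟩ := h
  obtain ⟨i, j, k, rfl⟩ := Submodule.mem_span_triple.1 hx
  have h1 := ho a (Submodule.subset_span (by simp))
  have h2 := ho b (Submodule.subset_span (by simp))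
  have h3 := ho c (Submodule.subset_span (by simp))
  simp only [lie_add_right, lie_smul_right, haa, hbb, hcc, hab, hac, hbc, lie_comm b a,
    lie_comm c a, lie_comm c b] at h1 h2 h3
  have e1 : i = 0 := by linarith
  have e2 : j = 0 := by linarith
  have e3 : k = 0 := by linarith
  rw [e1, e2, e3]; simp

/-- Scaling all spheres to `rad = 1` makes `τ v - σ u` the only vector of the contact element with
`rad = 0`, up to a factor. It equals a fixed vector plus a curve in `P₁` plus a curve in `P₂`, and
these planes are orthogonal. -/
theorem IsDupinPatch.exists_data {g : ℝ → ℝ → Space} (h : IsDupinPatch g) :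
    ∃ D : PatchData, D.IsGood ∧ SamePatch g D.std := by
  obtain ⟨P₁, P₂, hP₁, hP₂, hort, s₁, s₂, h₁, h₂, hg⟩ := h
  have hlin : ∀ {Pl : Submodule ℝ LieVec} {s : ℝ → LieVec}, IsSphereArc Pl s →
      ∃ σ : ℝ → LieVec, ContinuousOn σ I ∧ (∀ u ∈ I, σ u ∈ Pl) ∧ (∀ u ∈ I, rad (σ u) = 1) ∧
        (∀ u ∈ I, s u = rad (s u) • σ u) ∧ ∀ u ∈ I, ∀ u' ∈ I, σ u = σ u' → u = u' := by
    intro Pl s hs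
    have e : ∀ u ∈ I, s u = rad (s u) • (rad (s u))⁻¹ • s u := fun u hu => by
      rw [smul_smul, mul_inv_cancel₀ (hs.not_point u hu), one_smul]
    refine ⟨fun u => (rad (s u))⁻¹ • s u, ?_, fun u hu => Pl.smul_mem _ (hs.mem u hu),
      fun u hu => ?_, e, fun u hu u' hu' he => ?_⟩
    · have h1 : ContinuousOn (fun u => rad (s u)) I := continuous_rad.comp_continuousOn hs.continuous
      exact (h1.inv₀ hs.not_point).smul hs.continuous
    · rw [rad_smul, inv_mul_cancel₀ (hs.not_point u hu)]
    · by_contra hne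
      have h1 := LinearIndependent.pair_iff.1 (hs.injective u hu u' hu' hne)
        (rad (s u))⁻¹ (-(rad (s u'))⁻¹) (by simp only at he; rw [he]; simp)
      exact inv_ne_zero (hs.not_point u hu) h1.1
  obtain ⟨σ, σc, σP, σr, σs, σi⟩ := hlin h₁
  obtain ⟨τ, τc, τP, τr, τs, τi⟩ := hlin h₂
  have hker : ∀ x, x ∈ LinearMap.ker (lieForm er) ↔ rad x = 0 := fun x => by
    rw [LinearMap.mem_ker, lieForm_apply, lie_comm, lie_er, neg_eq_zero]
  have hk : ∀ u ∈ I, ∀ v ∈ I, ∃ k : ℝ, pt (g u v) = k • (τ v - σ u) := by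
    intro u hu v hv
    obtain ⟨x, y, e⟩ := Submodule.mem_span_pair.1 (hg u hu v hv)
    rw [σs u hu, τs v hv, smul_smul, smul_smul] at e
    have h1 := congrArg rad e
    rw [rad_add, rad_smul, rad_smul, σr u hu, τr v hv, (isPt_pt _).rad] at h1
    refine ⟨y * rad (s₂ v), ?_⟩
    rw [← e, show x * rad (s₁ u) = -(y * rad (s₂ v)) by linarith]
    module
  have htr : ∀ u ∈ I, ∀ v ∈ I, tr (τ v - σ u) ≠ 0 := by
    intro u hu v hv h0
    obtain ⟨k, e⟩ := hk u hu v hv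
    have := congrArg tr e
    rw [tr_pt, tr_smul, h0, mul_zero] at this
    exact one_ne_zero this
  have hkk : ∀ u ∈ I, ∀ v ∈ I, pt (g u v) = (tr (τ v - σ u))⁻¹ • (τ v - σ u) := by
    intro u hu v hv
    obtain ⟨k, e⟩ := hk u hu v hv
    have h1 := congrArg tr e
    rw [tr_pt, tr_smul] at h1
    rw [e, ← eq_inv_of_mul_eq_one_left h1.symm]
  have hinj : ∀ u ∈ I, ∀ v ∈ I, ∀ u' ∈ I, ∀ v' ∈ I, g u v = g u' v' → u = u' ∧ v = v' := by
    intro u hu v hv u' hu' v' hv' he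
    have h1 := congrArg pt he
    rw [hkk u hu v hv, hkk u' hu' v' hv'] at h1
    set a := (tr (τ v - σ u))⁻¹ with ha
    set b := (tr (τ v' - σ u'))⁻¹ with hb
    have ha0 : a ≠ 0 := inv_ne_zero (htr u hu v hv)
    have h2 : a • τ v - b • τ v' = a • σ u - b • σ u' := by
      rw [smul_sub, smul_sub] at h1
      rw [← sub_eq_zero] at h1 ⊢
      rw [← h1]; abel
    have m1 : a • σ u - b • σ u' ∈ P₁ :=
      P₁.sub_mem (P₁.smul_mem _ (σP u hu)) (P₁.smul_mem _ (σP u' hu'))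
    have m2 : a • τ v - b • τ v' ∈ P₂ :=
      P₂.sub_mem (P₂.smul_mem _ (τP v hv)) (P₂.smul_mem _ (τP v' hv'))
    -- The vector lies in both polar planes, hence is orthogonal to all of `P₁`, where the form is
    -- non-degenerate.
    have h3 : a • σ u - b • σ u' = 0 :=
      hP₁.eq_zero m1 fun p hp => by rw [← h2]; exact hort p hp _ m2
    have h4 := congrArg rad h3
    rw [rad_sub, rad_smul, rad_smul, σr u hu, σr u' hu', rad_zero] at h4
    have hab : b = a := by linarith
    rw [h3] at h2
    rw [hab, ← smul_sub] at h2 h3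
    exact ⟨σi u hu u' hu' (sub_eq_zero.1 ((smul_eq_zero.1 h3).resolve_left ha0)),
      τi v hv v' hv' (sub_eq_zero.1 ((smul_eq_zero.1 h2).resolve_left ha0))⟩
  have hTc : ContinuousOn (fun p : ℝ × ℝ => tr (τ p.2 - σ p.1)) (I ×ˢ I) := by
    refine continuous_tr.comp_continuousOn (ContinuousOn.sub ?_ ?_)
    · exact τc.comp continuousOn_snd fun p hp => hp.2
    · exact σc.comp continuousOn_fst fun p hp => hp.1
  have hpre : IsPreconnected (I ×ˢ I) := isPreconnected_Icc.prod isPreconnected_Icc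
  have h00 : ((0 : ℝ), (0 : ℝ)) ∈ I ×ˢ I := ⟨zero_mem_I, zero_mem_I⟩
  -- The trace has no zero on the connected square, so one sign makes all representatives points.
  obtain ⟨ε, hε⟩ : ∃ ε : ℝ, ∀ p ∈ I ×ˢ I, 0 < ε * tr (τ p.2 - σ p.1) := by
    rcases lt_or_gt_of_ne (htr 0 zero_mem_I 0 zero_mem_I) with h | h
    · exact ⟨-1, pos_of_ne_zero hpre (continuousOn_const.mul hTc)
        (fun p hp => by simpa using htr _ hp.1 _ hp.2) h00 (by simpa using h)⟩
    · exact ⟨1, pos_of_ne_zero hpre (continuousOn_const.mul hTc)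
        (fun p hp => by simpa using htr _ hp.1 _ hp.2) h00 (by simpa using h)⟩
  have hε0 : ε ≠ 0 := by rintro rfl; simpa using hε _ h00
  refine exists_data_of_affine (P := ε • (τ 0 - σ 0)) (Y := fun u => ε • (σ 0 - σ u))
    (Z := fun v => ε • (τ v - τ 0)) (radForm_ker_finrank hP₁ (σP 0 zero_mem_I)
      (by rw [σr 0 zero_mem_I]; exact one_ne_zero)) (radForm_ker_finrank hP₂ (τP 0 zero_mem_I)
      (by rw [τr 0 zero_mem_I]; exact one_ne_zero)) (fun w hw => (hker w).1 hw.2)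
    (fun w hw => (hker w).1 hw.2) (fun w hw w' hw' => hort w hw.1 w' hw'.1) ?_ ?_ ?_ ?_
    (by simp) (by simp) ?_ hinj
  · have h1 : ContinuousOn (fun u => σ 0 - σ u) I := continuousOn_const.sub σc
    have h2 : ContinuousOn (fun u => ε • (σ 0 - σ u)) I := h1.const_smul ε
    exact h2
  · have h1 : ContinuousOn (fun v => τ v - τ 0) I := τc.sub continuousOn_const
    have h2 : ContinuousOn (fun v => ε • (τ v - τ 0)) I := h1.const_smul ε
    exact h2
  · intro u hu
    refine ⟨P₁.smul_mem _ (P₁.sub_mem (σP 0 zero_mem_I) (σP u hu)), (hker _).2 ?_⟩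
    rw [rad_smul, rad_sub, σr 0 zero_mem_I, σr u hu]; ring
  · intro u hu
    refine ⟨P₂.smul_mem _ (P₂.sub_mem (τP u hu) (τP 0 zero_mem_I)), (hker _).2 ?_⟩
    rw [rad_smul, rad_sub, τr 0 zero_mem_I, τr u hu]; ring
  · intro u hu v hv
    have h1 := hε (u, v) ⟨hu, hv⟩
    refine ⟨(ε * tr (τ v - σ u))⁻¹, inv_pos.2 h1, ?_⟩
    rw [hkk u hu v hv]
    have : ε • (τ 0 - σ 0) + ε • (σ 0 - σ u) + ε • (τ v - τ 0) = ε • (τ v - σ u) := by module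
    rw [this, smul_smul, mul_inv]
    congr 1
    field_simp

/-! ### Normal form of spherical patches -/

theorem lieForm_nondegenerate : lieForm.Nondegenerate := by
  refine ⟨fun v h => eq_zero_of_lie_eq_zero h, fun v h => eq_zero_of_lie_eq_zero fun w => ?_⟩
  rw [lie_comm]; exact h w

theorem finrank_lieVec : Module.finrank ℝ LieVec = 6 := by
  simp [Module.finrank_prod]

theorem finrank_add_finrank_orthogonal (T : Submodule ℝ LieVec) :
    Module.finrank ℝ T + Module.finrank ℝ (lieForm.orthogonal T) = 6 := by
  have h1 := LinearMap.BilinForm.finrank_orthogonal lieForm_nondegenerate T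
  have h2 := Submodule.finrank_le T
  rw [finrank_lieVec] at h1 h2
  omega

/-- The Gram matrix has zero diagonal and determinant `2 ⟨p₁, p₂⟩ ⟨p₁, p₃⟩ ⟨p₂, p₃⟩ ≠ 0`. -/
theorem linearIndependent_of_isPt {p₁ p₂ p₃ : LieVec} (h₁ : IsPt p₁) (h₂ : IsPt p₂) (h₃ : IsPt p₃)
    (h₁₂ : lie p₁ p₂ < 0) (h₁₃ : lie p₁ p₃ < 0) (h₂₃ : lie p₂ p₃ < 0) {x y z : ℝ}
    (h : x • p₁ + y • p₂ + z • p₃ = 0) : x = 0 ∧ y = 0 ∧ z = 0 := by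
  have e1 := congrArg (lie p₁) h
  have e2 := congrArg (lie p₂) h
  have e3 := congrArg (lie p₃) h
  simp only [lie_add_right, lie_smul_right, h₁.null, h₂.null, h₃.null, lie_comm p₂ p₁,
    lie_comm p₃ p₁, lie_comm p₃ p₂, lie_zero_right] at e1 e2 e3
  have hx : x * (lie p₁ p₂ * lie p₁ p₃) = 0 := by
    linear_combination (1 / 2) * (lie p₁ p₃ * e2 + lie p₁ p₂ * e3 - lie p₂ p₃ * e1)
  have hx0 : x = 0 := (mul_eq_zero.1 hx).resolve_right (mul_ne_zero h₁₂.ne h₁₃.ne)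
  rw [hx0] at e2 e3
  refine ⟨hx0, ?_, ?_⟩
  · exact (mul_eq_zero.1 (by linarith : y * lie p₂ p₃ = 0)).resolve_right h₂₃.ne
  · exact (mul_eq_zero.1 (by linarith : z * lie p₂ p₃ = 0)).resolve_right h₂₃.ne

/-- Lifted form of the conditions on a spherical patch. -/
structure SphericalData (p : ℝ → ℝ → LieVec) (s : LieVec) (c₁ c₂ : ℝ → LieVec) : Prop where
  cont : ContinuousOn (fun x : ℝ × ℝ => p x.1 x.2) (I ×ˢ I)
  pt : ∀ u v, IsPt (p u v)
  inj : ∀ u ∈ I, ∀ v ∈ I, ∀ u' ∈ I, ∀ v' ∈ I, (u ≠ u' ∨ v ≠ v') → lie (p u v) (p u' v') < 0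
  ss : lie s s = 0
  rads : rad s ≠ 0
  circ₁ : ∀ u ∈ I, IsCircleOn s (c₁ u)
  circ₂ : ∀ u ∈ I, IsCircleOn s (c₂ u)
  orth : ∀ u ∈ I, ∀ v ∈ I, lie (c₁ u) (c₂ v) = 0
  ps : ∀ u ∈ I, ∀ v ∈ I, lie (p u v) s = 0
  pc₁ : ∀ u ∈ I, ∀ v ∈ I, lie (p u v) (c₁ u) = 0
  pc₂ : ∀ u ∈ I, ∀ v ∈ I, lie (p u v) (c₂ v) = 0

/-- The span of the vectors of a family of circles. -/
def circleSpan (c : ℝ → LieVec) : Submodule ℝ LieVec := Submodule.span ℝ (c '' I)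

namespace SphericalData

variable {p : ℝ → ℝ → LieVec} {s : LieVec} {c₁ c₂ : ℝ → LieVec}

theorem swap (h : SphericalData p s c₁ c₂) : SphericalData (fun u v => p v u) s c₂ c₁ where
  cont := h.cont.comp continuous_swap.continuousOn fun x hx => ⟨hx.2, hx.1⟩
  pt := fun u v => h.pt v u
  inj := fun u hu v hv u' hu' v' hv' hne => h.inj v hv u hu v' hv' u' hu' hne.symm
  ss := h.ss
  rads := h.rads
  circ₁ := h.circ₂
  circ₂ := h.circ₁
  orth := fun u hu v hv => by rw [lie_comm]; exact h.orth v hv u hu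
  ps := fun u hu v hv => h.ps v hv u hu
  pc₁ := fun u hu v hv => h.pc₂ v hv u hu
  pc₂ := fun u hu v hv => h.pc₁ v hv u hu

theorem mem_circleSpan {c : ℝ → LieVec} {u : ℝ} (hu : u ∈ I) : c u ∈ circleSpan c :=
  Submodule.subset_span (mem_image_of_mem _ hu)

theorem circleSpan_le {c : ℝ → LieVec} {T : Submodule ℝ LieVec} (hc : ∀ u ∈ I, c u ∈ T) :
    circleSpan c ≤ T := Submodule.span_le.2 (by rintro _ ⟨u, hu, rfl⟩; exact hc u hu)

theorem rad_span (h : SphericalData p s c₁ c₂) : ∀ w ∈ circleSpan c₁, rad w = 0 := by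
  have : circleSpan c₁ ≤ LinearMap.ker (lieForm er) := circleSpan_le fun u hu => by
    rw [LinearMap.mem_ker, lieForm_apply, lie_comm, lie_er, (h.circ₁ u hu).1, neg_zero]
  intro w hw
  have := LinearMap.mem_ker.1 (this hw)
  rw [lieForm_apply, lie_comm, lie_er] at this; linarith

theorem s_span (h : SphericalData p s c₁ c₂) : ∀ w ∈ circleSpan c₁, lie s w = 0 := by
  have : circleSpan c₁ ≤ LinearMap.ker (lieForm s) := circleSpan_le fun u hu => by
    rw [LinearMap.mem_ker, lieForm_apply, lie_comm, (h.circ₁ u hu).2.1]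
  exact fun w hw => LinearMap.mem_ker.1 (this hw)

theorem span_span (h : SphericalData p s c₁ c₂) :
    ∀ w ∈ circleSpan c₁, ∀ w' ∈ circleSpan c₂, lie w w' = 0 := by
  intro w hw
  have : circleSpan c₂ ≤ LinearMap.ker (lieForm w) := circleSpan_le fun v hv => by
    have : circleSpan c₁ ≤ LinearMap.ker (lieForm (c₂ v)) := circleSpan_le fun u hu => by
      rw [LinearMap.mem_ker, lieForm_apply, lie_comm, h.orth u hu v hv]
    have := LinearMap.mem_ker.1 (this hw)
    rwa [LinearMap.mem_ker, lieForm_apply, lie_comm]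
  exact fun w hw => LinearMap.mem_ker.1 (this hw)

/-- Otherwise all circles of the first family coincide, and the whole line `v = 0` is orthogonal to
the four independent vectors `er`, `s`, `c₁ 0`, `c₂ 0`. Then it lies in a two-dimensional space,
which has no room for three distinct points. -/
theorem two_le_finrank (h : SphericalData p s c₁ c₂) :
    2 ≤ Module.finrank ℝ (circleSpan c₁) := by
  by_contra hlt
  have hc0 := h.circ₁ 0 zero_mem_I
  have hd0 := h.circ₂ 0 zero_mem_I
  have hne : c₁ 0 ≠ 0 := fun h0 => by have := hc0.2.2; rw [h0] at this; simp at this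
  have hspan : Submodule.span ℝ {c₁ 0} = circleSpan c₁ := by
    apply Submodule.eq_of_le_of_finrank_le
    · rw [Submodule.span_le]; rintro _ rfl; exact mem_circleSpan zero_mem_I
    · rw [finrank_span_singleton hne]; omega
  have hp : ∀ u ∈ I, lie (p u 0) (c₁ 0) = 0 := by
    intro u hu
    have h1 : c₁ u ∈ Submodule.span ℝ {c₁ 0} := by rw [hspan]; exact mem_circleSpan hu
    obtain ⟨k, hk⟩ := Submodule.mem_span_singleton.1 h1
    have h2 := h.pc₁ u hu 0 zero_mem_I
    rw [← hk, lie_smul_right] at h2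
    refine (mul_eq_zero.1 h2).resolve_left fun hk0 => ?_
    have := (h.circ₁ u hu).2.2
    rw [← hk, hk0] at this; simp at this
  have hli : LinearIndependent ℝ ![er, s, c₁ 0, c₂ 0] := by
    rw [Fintype.linearIndependent_iff]
    intro f hf
    simp only [Fin.sum_univ_four, Matrix.cons_val_zero, Matrix.cons_val_one,
      Matrix.cons_val] at hf
    have e1 := congrArg (lie (c₁ 0)) hf
    have e2 := congrArg (lie (c₂ 0)) hf
    have e3 := congrArg (lie s) hf
    have e4 := congrArg rad hf
    simp only [lie_add_right, lie_smul_right, lie_er, hc0.1, hc0.2.1, hd0.1, hd0.2.1, h.ss,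
      h.orth 0 zero_mem_I 0 zero_mem_I, lie_comm s (c₁ 0), lie_comm s (c₂ 0),
      lie_comm (c₂ 0) (c₁ 0), lie_zero_right, rad_add, rad_smul, rad_er, rad_zero] at e1 e2 e3 e4
    have h1 : f 2 = 0 :=
      (mul_eq_zero.1 (by linarith : f 2 * lie (c₁ 0) (c₁ 0) = 0)).resolve_right hc0.2.2.ne'
    have h2 : f 3 = 0 :=
      (mul_eq_zero.1 (by linarith : f 3 * lie (c₂ 0) (c₂ 0) = 0)).resolve_right hd0.2.2.ne'
    have h3 : f 0 = 0 := (mul_eq_zero.1 (by linarith : f 0 * rad s = 0)).resolve_right h.rads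
    have h4 : f 1 = 0 :=
      (mul_eq_zero.1 (by rw [h3] at e4; linarith : f 1 * rad s = 0)).resolve_right h.rads
    intro i; fin_cases i <;> assumption
  have hfin := finrank_span_eq_card hli
  set T := Submodule.span ℝ (range ![er, s, c₁ 0, c₂ 0]) with hT
  have hT2 := finrank_add_finrank_orthogonal T
  rw [hfin] at hT2
  have hmem : ∀ u ∈ I, p u 0 ∈ lieForm.orthogonal T := by
    intro u hu
    have : T ≤ LinearMap.ker (lieForm (p u 0)) := by
      rw [hT, Submodule.span_le]
      rintro _ ⟨i, rfl⟩
      change lie _ _ = 0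
      fin_cases i
      · change lie _ er = 0; rw [lie_er, (h.pt _ _).rad, neg_zero]
      · exact h.ps u hu 0 zero_mem_I
      · exact hp u hu
      · exact h.pc₂ u hu 0 zero_mem_I
    intro w hw
    change lie w _ = 0
    rw [lie_comm]; exact this hw
  have hh : (1 / 2 : ℝ) ∈ I := ⟨by norm_num, by norm_num⟩
  have hli2 : LinearIndependent ℝ ![p 0 0, p (1 / 2) 0, p 1 0] := by
    rw [Fintype.linearIndependent_iff]
    intro f hf
    simp only [Fin.sum_univ_three, Matrix.cons_val_zero, Matrix.cons_val_one,
      Matrix.cons_val] at hf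
    obtain ⟨h1, h2, h3⟩ := linearIndependent_of_isPt (h.pt _ _) (h.pt _ _) (h.pt _ _)
      (h.inj 0 zero_mem_I 0 zero_mem_I _ hh 0 zero_mem_I (Or.inl (by norm_num)))
      (h.inj 0 zero_mem_I 0 zero_mem_I _ one_mem_I 0 zero_mem_I (Or.inl (by norm_num)))
      (h.inj _ hh 0 zero_mem_I _ one_mem_I 0 zero_mem_I (Or.inl (by norm_num))) hf
    intro i; fin_cases i <;> assumption
  have hfin2 := finrank_span_eq_card hli2
  have hle : Submodule.span ℝ (range ![p 0 0, p (1 / 2) 0, p 1 0]) ≤ lieForm.orthogonal T := by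
    rw [Submodule.span_le]
    rintro _ ⟨i, rfl⟩
    fin_cases i
    · exact hmem 0 zero_mem_I
    · exact hmem _ hh
    · exact hmem 1 one_mem_I
  have := Submodule.finrank_mono hle
  rw [hfin2] at this
  simp only [Fintype.card_fin] at this hT2
  omega

/-- The span `E` of `er` and `s` is two-dimensional and meets the first circle span trivially; the
second circle span lies in the orthogonal complement of their sum. As both circle spans have
dimension at least two, counting in dimension six forces equality everywhere: each span is the full
complement of the other one together with `E`. -/
theorem finrank_and_mem (h : SphericalData p s c₁ c₂) :
    Module.finrank ℝ (circleSpan c₁) = 2 ∧ Module.finrank ℝ (circleSpan c₂) = 2 ∧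
      ∀ e, rad e = 0 → lie s e = 0 → (∀ w ∈ circleSpan c₁, lie w e = 0) → e ∈ circleSpan c₂ := by
  have h1 := h.two_le_finrank
  have h2 := h.swap.two_le_finrank
  have hli : LinearIndependent ℝ ![er, s] := by
    rw [LinearIndependent.pair_iff]
    intro x y hxy
    have e3 := congrArg (lie s) hxy
    have e4 := congrArg rad hxy
    simp only [lie_add_right, lie_smul_right, lie_er, h.ss, lie_zero_right, rad_add, rad_smul,
      rad_er, rad_zero] at e3 e4
    have h3 : x = 0 := (mul_eq_zero.1 (by linarith : x * rad s = 0)).resolve_right h.rads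
    exact ⟨h3, (mul_eq_zero.1 (by rw [h3] at e4; linarith : y * rad s = 0)).resolve_right h.rads⟩
  have hfin := finrank_span_eq_card hli
  set E := Submodule.span ℝ (range ![er, s]) with hE
  have hEperp : ∀ x, rad x = 0 → lie s x = 0 → ∀ w ∈ E, lie w x = 0 := by
    intro x hx hx' w hw
    have : E ≤ LinearMap.ker (lieForm x) := by
      rw [hE, Submodule.span_le]
      rintro _ ⟨i, rfl⟩
      change lie _ _ = 0
      fin_cases i
      · change lie _ er = 0; rw [lie_er, hx, neg_zero]
      · change lie _ s = 0; rw [lie_comm, hx']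
    rw [lie_comm]; exact this hw
  have hdisj : Disjoint (circleSpan c₁) E := by
    rw [Submodule.disjoint_def]
    intro x hx hxE
    have hr := h.rad_span x hx
    have hs := h.s_span x hx
    have hx2 := hxE
    rw [hE] at hx2
    simp only [Matrix.range_cons, Matrix.range_empty, union_empty, singleton_union] at hx2
    obtain ⟨a, b, rfl⟩ := Submodule.mem_span_pair.1 hx2
    simp only [lie_add_right, lie_smul_right, lie_er, h.ss, rad_add, rad_smul,
      rad_er] at hr hs
    have h3 : a = 0 := (mul_eq_zero.1 (by linarith : a * rad s = 0)).resolve_right h.rads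
    rw [h3] at hr
    have h4 : b = 0 := (mul_eq_zero.1 (by linarith : b * rad s = 0)).resolve_right h.rads
    rw [h3, h4]; simp
  have hsum := Submodule.finrank_sup_add_finrank_inf_eq (circleSpan c₁) E
  rw [hdisj.eq_bot, finrank_bot, hfin, Fintype.card_fin] at hsum
  have hort := finrank_add_finrank_orthogonal (circleSpan c₁ ⊔ E)
  have hmem : ∀ e, rad e = 0 → lie s e = 0 → (∀ w ∈ circleSpan c₁, lie w e = 0) →
      e ∈ lieForm.orthogonal (circleSpan c₁ ⊔ E) := by
    intro e he hse hw x hx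
    obtain ⟨a, ha, b, hb, rfl⟩ := Submodule.mem_sup.1 hx
    change lie _ _ = 0
    rw [lie_add_left, hw a ha, hEperp e he hse b hb, add_zero]
  have hle : circleSpan c₂ ≤ lieForm.orthogonal (circleSpan c₁ ⊔ E) := fun x hx =>
    hmem x (h.swap.rad_span x hx) (h.swap.s_span x hx) fun w hw => h.span_span w hw x hx
  have hle' := Submodule.finrank_mono hle
  refine ⟨by omega, by omega, fun e he hse hw => ?_⟩
  rw [Submodule.eq_of_le_of_finrank_le hle (by omega)]
  exact hmem e he hse hw

/-- In a two-dimensional span of circles, two independent elements generate. -/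
theorem exists_comb (h : SphericalData p s c₁ c₂) {a b : LieVec} (ha : a ∈ circleSpan c₁)
    (hb : b ∈ circleSpan c₁) (hli : LinearIndependent ℝ ![a, b]) :
    ∀ w ∈ circleSpan c₁, ∃ x y : ℝ, w = x • a + y • b := by
  intro w hw
  have h1 := finrank_span_eq_card hli
  have h2 : range ![a, b] = {a, b} := by
    simp [Matrix.range_cons, Matrix.range_empty, pair_comm]
  rw [h2, Fintype.card_fin] at h1
  have : Submodule.span ℝ {a, b} = circleSpan c₁ := by
    apply Submodule.eq_of_le_of_finrank_le
    · rw [Submodule.span_le]; rintro _ (rfl | rfl) <;> assumption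
    · rw [h1, h.finrank_and_mem.1]
  rw [← this] at hw
  obtain ⟨x, y, e⟩ := Submodule.mem_span_pair.1 hw
  exact ⟨x, y, e.symm⟩

theorem comb_of_lie (h : SphericalData p s c₁ c₂) {u : ℝ} (hu : u ∈ I) {q w₀ : LieVec}
    (hw₀ : w₀ ∈ circleSpan c₁) (hq : lie q (c₁ u) = 0) (hq' : lie q w₀ ≠ 0) :
    ∀ w ∈ circleSpan c₁, ∃ x y : ℝ, w = x • c₁ u + y • w₀ := by
  refine h.exists_comb (mem_circleSpan hu) hw₀ ?_
  have hne : c₁ u ≠ 0 := fun h0 => by have := (h.circ₁ u hu).2.2; rw [h0] at this; simp at this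
  rw [LinearIndependent.pair_iff' hne]
  rintro a rfl
  rw [lie_smul_right, hq, mul_zero] at hq'
  exact hq' rfl

theorem comb_of_null (h : SphericalData p s c₁ c₂) {u : ℝ} (hu : u ∈ I) {l : LieVec}
    (hl : l ∈ circleSpan c₁) (hpt : IsPt l) :
    ∀ w ∈ circleSpan c₁, ∃ x y : ℝ, w = x • c₁ u + y • l := by
  refine h.exists_comb (mem_circleSpan hu) hl ?_
  have hc := (h.circ₁ u hu).2.2
  have hne : c₁ u ≠ 0 := fun h0 => by rw [h0] at hc; simp at hc
  rw [LinearIndependent.pair_iff' hne]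
  rintro a rfl
  have h1 := hpt.null
  rw [lie_smul_left, lie_smul_right] at h1
  have ha : a ≠ 0 := by rintro rfl; have := hpt.pos; simp at this
  exact mul_ne_zero ha (mul_ne_zero ha hc.ne') h1

theorem I_subset_closure (u₀ : ℝ) : I ⊆ closure (I \ {u₀}) := by
  have h1 : Ioo (0 : ℝ) 1 ⊆ closure (Ioo 0 1 ∩ {u₀}ᶜ) :=
    (dense_compl_singleton u₀).open_subset_closure_inter isOpen_Ioo
  have h2 : closure (Ioo (0 : ℝ) 1) = I := closure_Ioo zero_ne_one
  rw [← h2]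
  refine (closure_minimal h1 isClosed_closure).trans (closure_mono ?_)
  rintro x ⟨hx, hx'⟩
  exact ⟨subset_closure hx, hx'⟩

/-- No point of the patch is orthogonal to all circles of one of the two families. -/
theorem not_orthogonal (h : SphericalData p s c₁ c₂) {u₀ v₀ : ℝ} (hu₀ : u₀ ∈ I) (hv₀ : v₀ ∈ I) :
    ∃ w ∈ circleSpan c₁, lie (p u₀ v₀) w ≠ 0 := by
  by_contra hcon
  push Not at hcon
  set l := p u₀ v₀ with hl
  have hlpt : IsPt l := h.pt _ _
  -- A point orthogonal to the first span lies in the second. The second is then generated by `l`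
  -- and a circle through `l`, so `l` is orthogonal to it as well and lies in both: the two pencils
  -- consist of mutually tangent circles at `l`.
  have hl2 : l ∈ circleSpan c₂ := h.finrank_and_mem.2.2 l hlpt.rad
    (by rw [lie_comm]; exact h.ps u₀ hu₀ v₀ hv₀) fun w hw => by rw [lie_comm]; exact hcon w hw
  have hcon2 : ∀ w ∈ circleSpan c₂, lie l w = 0 := by
    intro w hw
    obtain ⟨x, y, rfl⟩ := h.swap.comb_of_null hv₀ hl2 hlpt w hw
    rw [lie_add_right, lie_smul_right, lie_smul_right, hlpt.null, hl, h.pc₂ u₀ hu₀ v₀ hv₀]; ring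
  have hl1 : l ∈ circleSpan c₁ := h.swap.finrank_and_mem.2.2 l hlpt.rad
    (by rw [lie_comm]; exact h.ps u₀ hu₀ v₀ hv₀) fun w hw => by rw [lie_comm]; exact hcon2 w hw
  obtain ⟨v₁, hv₁, hne⟩ : ∃ v₁ ∈ I, v₁ ≠ v₀ := by
    by_cases h0 : v₀ = 0
    · exact ⟨1, one_mem_I, by rw [h0]; exact one_ne_zero⟩
    · exact ⟨0, zero_mem_I, fun h => h0 h.symm⟩
  obtain ⟨u₁, hu₁, hne'⟩ : ∃ u₁ ∈ I, u₁ ≠ u₀ := by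
    by_cases h0 : u₀ = 0
    · exact ⟨1, one_mem_I, by rw [h0]; exact one_ne_zero⟩
    · exact ⟨0, zero_mem_I, fun h => h0 h.symm⟩
  have hq : ∀ u ∈ I, u ≠ u₀ → ∀ v ∈ I, lie (p u v) l < 0 := fun u hu hn v hv =>
    h.inj u hu v hv u₀ hu₀ v₀ hv₀ (Or.inl hn)
  -- The scaling `lie n l = 1` sends `l` to infinity. The two families become orthogonal families of
  -- parallel lines, and `e u` is the displacement between the lines `v₀` and `v₁`.
  set n : ℝ → ℝ → LieVec := fun u v => (lie (p u v) l)⁻¹ • p u v with hn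
  have hnl : ∀ u ∈ I, u ≠ u₀ → ∀ v ∈ I, lie (n u v) l = 1 := fun u hu hne v hv => by
    simp only [hn, lie_smul_left]; exact inv_mul_cancel₀ (hq u hu hne v hv).ne
  set e : ℝ → LieVec := fun u => n u v₀ - n u v₁ with he
  have heC : ∀ u ∈ I, u ≠ u₀ → e u ∈ circleSpan c₂ := by
    intro u hu hne
    refine h.finrank_and_mem.2.2 _ ?_ ?_ fun w hw => ?_
    · simp only [he, hn, rad_sub, rad_smul, (h.pt _ _).rad]; ring
    · simp only [he, hn, lie_comm s, lie_sub_left, lie_smul_left, h.ps u hu v₀ hv₀,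
        h.ps u hu v₁ hv₁]; ring
    · rw [lie_comm]
      obtain ⟨x, y, rfl⟩ := h.comb_of_null hu hl1 hlpt w hw
      simp only [he, lie_sub_left, lie_add_right, lie_smul_right, hnl u hu hne v₀ hv₀,
        hnl u hu hne v₁ hv₁]
      simp only [hn, lie_smul_left, h.pc₁ u hu v₀ hv₀, h.pc₁ u hu v₁ hv₁]; ring
  have hdiff : ∀ u ∈ I, u ≠ u₀ → ∀ u' ∈ I, u' ≠ u₀ → ∀ v ∈ I, ∀ w ∈ circleSpan c₂,
      lie (n u v) w = lie (n u' v) w := by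
    intro u hu hne u' hu' hne' v hv w hw
    obtain ⟨x, y, rfl⟩ := h.swap.comb_of_null hv hl2 hlpt w hw
    simp only [lie_add_right, lie_smul_right, hnl u hu hne v hv, hnl u' hu' hne' v hv]
    simp only [hn, lie_smul_left, h.pc₂ u hu v hv, h.pc₂ u' hu' v hv]; ring
  -- Parallel lines have constant distance, so the square of `e u` does not depend on `u`.
  have hee : ∀ u ∈ I, u ≠ u₀ → lie (e u) (e u) = lie (e u₁) (e u₁) := by
    intro u hu hne
    have h1 : ∀ w ∈ circleSpan c₂, lie (e u) w = lie (e u₁) w := fun w hw => by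
      simp only [he, lie_sub_left, hdiff u hu hne u₁ hu₁ hne' v₀ hv₀ w hw,
        hdiff u hu hne u₁ hu₁ hne' v₁ hv₁ w hw]
    rw [h1 _ (heC u hu hne), lie_comm, h1 _ (heC u₁ hu₁ hne')]
  set k := lie (e u₁) (e u₁) with hk
  have hid : EqOn (fun u => lie (p u v₀) (p u v₁))
      (fun u => -k / 2 * (lie (p u v₀) l * lie (p u v₁) l)) (I \ {u₀}) := by
    rintro u ⟨hu, hne⟩
    have h1 := hee u hu hne
    have h2 := (hq u hu hne v₀ hv₀).ne
    have h3 := (hq u hu hne v₁ hv₁).ne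
    simp only [he, hn, lie_sub_left, lie_sub_right, lie_smul_left, lie_smul_right,
      (h.pt _ _).null, lie_comm (p u v₁) (p u v₀)] at h1
    simp only
    rw [← h1]; field_simp; ring
  have hcp : ∀ v ∈ I, ContinuousOn (fun u => p u v) I := fun v hv =>
    h.cont.comp (f := fun u => (u, v)) (by fun_prop) fun u hu => ⟨hu, hv⟩
  have hc1 : ContinuousOn (fun u => lie (p u v₀) (p u v₁)) I :=
    continuousOn_lie (hcp v₀ hv₀) (hcp v₁ hv₁)
  have hc2 : ContinuousOn (fun u => -k / 2 * (lie (p u v₀) l * lie (p u v₁) l)) I :=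
    continuousOn_const.mul ((continuousOn_lie (hcp v₀ hv₀) continuousOn_const).mul
      (continuousOn_lie (hcp v₁ hv₁) continuousOn_const))
  -- In the limit `u → u₀` the right side vanishes because `p u v₀` tends to the isotropic `l`. The
  -- left side would then give `lie l (p u₀ v₁) = 0`, so two different parameters would have the
  -- same point.
  have := hid.of_subset_closure hc1 hc2 sdiff_subset (I_subset_closure u₀) hu₀
  simp only at this
  rw [← hl, hlpt.null, zero_mul, mul_zero] at this
  exact (h.inj u₀ hu₀ v₀ hv₀ u₀ hu₀ v₁ hv₁ (Or.inr hne.symm)).ne this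

/-- All points of the line with parameter `u` are orthogonal to `c₁ u`, so on the two-dimensional
first circle span they define proportional functionals. By `not_orthogonal` the ratio never
vanishes; it is positive because it starts at `1`. -/
theorem exists_ratio (h : SphericalData p s c₁ c₂) {u : ℝ} (hu : u ∈ I) :
    ∃ κ : ℝ → ℝ, ContinuousOn κ I ∧ κ 0 = 1 ∧ ∀ v ∈ I, 0 < κ v ∧
      ∀ w ∈ circleSpan c₁, lie (p u v) w = κ v * lie (p u 0) w := by
  obtain ⟨w₀, hw₀, hne⟩ := h.not_orthogonal hu zero_mem_I
  have hcp : ContinuousOn (fun v => p u v) I :=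
    h.cont.comp (f := fun v => (u, v)) (by fun_prop) fun v hv => ⟨hu, hv⟩
  have hκ : ContinuousOn (fun v => lie (p u v) w₀ / lie (p u 0) w₀) I := by
    have : ContinuousOn (fun v => lie (p u v) w₀) I := continuousOn_lie hcp continuousOn_const
    exact this.div_const _
  have hcomb := h.comb_of_lie hu hw₀ (h.pc₁ u hu 0 zero_mem_I) hne
  have hall : ∀ v ∈ I, ∀ w ∈ circleSpan c₁,
      lie (p u v) w = lie (p u v) w₀ / lie (p u 0) w₀ * lie (p u 0) w := by
    intro v hv w hw
    obtain ⟨x, y, rfl⟩ := hcomb w hw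
    simp only [lie_add_right, lie_smul_right, h.pc₁ u hu v hv, h.pc₁ u hu 0 zero_mem_I]
    field_simp; ring
  refine ⟨_, hκ, div_self hne, fun v hv => ⟨?_, hall v hv⟩⟩
  refine pos_of_ne_zero isPreconnected_Icc hκ (fun v hv h0 => ?_) zero_mem_I
    (by rw [div_self hne]; exact one_pos) v hv
  obtain ⟨w, hw, hne'⟩ := h.not_orthogonal hu hv
  rw [hall v hv w hw, h0, zero_mul] at hne'
  exact hne' rfl

end SphericalData

/-- Rescaling the two lines through the first vertex by these ratios makes their differences from
that vertex lie in the circle spans, which are orthogonal planes. What remains is to show that the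
sum `F` of the two curves represents the given point. -/
theorem IsSphericalPatch.exists_data {g : ℝ → ℝ → Space} (hg : IsSphericalPatch g) :
    ∃ D : PatchData, D.IsGood ∧ SamePatch g D.std := by
  obtain ⟨hc, hi, s, hss, hrs, c₁, c₂, hc₁, hc₂, hcc, hp⟩ := hg
  have hinj : ∀ u ∈ I, ∀ v ∈ I, ∀ u' ∈ I, ∀ v' ∈ I, g u v = g u' v' → u = u' ∧ v = v' := by
    intro u hu v hv u' hu' v' hv' he
    have : (u, v) = (u', v') := hi ⟨hu, hv⟩ ⟨hu', hv'⟩ he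
    exact ⟨congrArg Prod.fst this, congrArg Prod.snd this⟩
  set p : ℝ → ℝ → LieVec := fun u v => pt (g u v) with hpdef
  have h : SphericalData p s c₁ c₂ :=
    { cont := continuous_pt.comp_continuousOn hc
      pt := fun u v => isPt_pt _
      inj := fun u hu v hv u' hu' v' hv' hne => by
        refine lie_neg_of_ne (isPt_pt _) (isPt_pt _) fun he => ?_
        rw [toSpace_pt, toSpace_pt] at he
        obtain ⟨h1, h2⟩ := hinj u hu v hv u' hu' v' hv' he
        exact hne.elim (fun h => h h1) fun h => h h2
      ss := hss
      rads := hrs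
      circ₁ := hc₁
      circ₂ := hc₂
      orth := hcc
      ps := fun u hu v hv => (hp u hu v hv).1
      pc₁ := fun u hu v hv => (hp u hu v hv).2.1
      pc₂ := fun u hu v hv => (hp u hu v hv).2.2 }
  obtain ⟨f1, f2, mem2⟩ := h.finrank_and_mem
  have mem1 := h.swap.finrank_and_mem.2.2
  obtain ⟨κ, κc, κ0, hκ⟩ := h.exists_ratio zero_mem_I
  obtain ⟨l, lc, l0, hl⟩ := h.swap.exists_ratio zero_mem_I
  have hcp1 : ContinuousOn (fun u => p u 0) I :=
    h.cont.comp (f := fun u => (u, (0 : ℝ))) (by fun_prop) fun u hu => ⟨hu, zero_mem_I⟩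
  have hcp2 : ContinuousOn (fun v => p 0 v) I :=
    h.cont.comp (f := fun v => ((0 : ℝ), v)) (by fun_prop) fun v hv => ⟨zero_mem_I, hv⟩
  set Y : ℝ → LieVec := fun u => (l u)⁻¹ • p u 0 - p 0 0 with hY
  set Z : ℝ → LieVec := fun v => (κ v)⁻¹ • p 0 v - p 0 0 with hZ
  have hYmem : ∀ u ∈ I, Y u ∈ circleSpan c₁ := by
    intro u hu
    refine mem1 _ ?_ ?_ fun w hw => ?_
    · simp only [hY, rad_sub, rad_smul, (h.pt _ _).rad]; ring
    · simp only [hY, lie_comm s, lie_sub_left, lie_smul_left, h.ps u hu 0 zero_mem_I,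
        h.ps 0 zero_mem_I 0 zero_mem_I]; ring
    · rw [lie_comm]
      simp only [hY, lie_sub_left, lie_smul_left, (hl u hu).2 w hw]
      rw [inv_mul_cancel_left₀ (hl u hu).1.ne', sub_self]
  have hZmem : ∀ v ∈ I, Z v ∈ circleSpan c₂ := by
    intro v hv
    refine mem2 _ ?_ ?_ fun w hw => ?_
    · simp only [hZ, rad_sub, rad_smul, (h.pt _ _).rad]; ring
    · simp only [hZ, lie_comm s, lie_sub_left, lie_smul_left, h.ps 0 zero_mem_I v hv,
        h.ps 0 zero_mem_I 0 zero_mem_I]; ring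
    · rw [lie_comm]
      simp only [hZ, lie_sub_left, lie_smul_left, (hκ v hv).2 w hw]
      rw [inv_mul_cancel_left₀ (hκ v hv).1.ne', sub_self]
  refine exists_data_of_affine (P := p 0 0) (Y := Y) (Z := Z) f1.le f2.le h.rad_span
    h.swap.rad_span h.span_span ?_ ?_ hYmem hZmem (by simp [hY, l0]) (by simp [hZ, κ0]) ?_ hinj
  · have h1 : ContinuousOn (fun u => (l u)⁻¹ • p u 0) I :=
      (lc.inv₀ fun u hu => (hl u hu).1.ne').smul hcp1
    exact h1.sub continuousOn_const
  · have h1 : ContinuousOn (fun v => (κ v)⁻¹ • p 0 v) I :=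
      (κc.inv₀ fun u hu => (hκ u hu).1.ne').smul hcp2
    exact h1.sub continuousOn_const
  · intro u hu v hv
    set F := p 0 0 + Y u + Z v with hF
    have hP := h.pt u v
    have hYZ := h.span_span _ (hYmem u hu) _ (hZmem v hv)
    have hFF : lie F F = 0 := by
      have h1 : lie (p 0 0 + Y u) (p 0 0 + Y u) = 0 := by
        simp only [hY, add_sub_cancel, lie_smul_left, lie_smul_right, (h.pt _ _).null]; ring
      have h2 : lie (p 0 0 + Z v) (p 0 0 + Z v) = 0 := by
        simp only [hZ, add_sub_cancel, lie_smul_left, lie_smul_right, (h.pt _ _).null]; ring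
      simp only [hF, lie_add_left, lie_add_right, lie_comm (Z v) (Y u), hYZ, (h.pt _ _).null]
        at h1 h2 ⊢
      linarith
    have hFs : lie s F = 0 := by
      rw [hF, lie_add_right, lie_add_right, h.s_span _ (hYmem u hu), h.swap.s_span _ (hZmem v hv),
        lie_comm, h.ps 0 zero_mem_I 0 zero_mem_I]; ring
    have hFr : rad F = 0 := by
      rw [hF, rad_add, rad_add, h.rad_span _ (hYmem u hu), h.swap.rad_span _ (hZmem v hv),
        (h.pt _ _).rad]; ring
    -- On the second circle span both `p u v` and `F` are positive multiples of `p 0 v`, so a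
    -- positive combination annihilates it and hence lies in the first span. The same holds below
    -- with the families exchanged.
    obtain ⟨a, ha, ea⟩ : ∃ a : ℝ, 0 < a ∧ p u v - a • F ∈ circleSpan c₁ := by
      obtain ⟨y, -, -, hy⟩ := h.swap.exists_ratio hv
      refine ⟨y u * κ v, mul_pos (hy u hu).1 (hκ v hv).1, mem1 _ ?_ ?_ fun w hw => ?_⟩
      · rw [rad_sub, rad_smul, hFr, hP.rad]; ring
      · rw [lie_sub_right, lie_smul_right, hFs, lie_comm, h.ps u hu v hv]; ring
      · rw [lie_comm]
        have h1 := (hy u hu).2 w hw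
        have h2 := h.span_span _ (hYmem u hu) w hw
        have h3 := (hκ v hv).1.ne'
        simp only [hF, hZ, lie_sub_left, lie_smul_left, lie_add_left, h2]
        rw [h1]; field_simp; ring
    obtain ⟨b, hb, eb⟩ : ∃ b : ℝ, 0 < b ∧ p u v - b • F ∈ circleSpan c₂ := by
      obtain ⟨y, -, -, hy⟩ := h.exists_ratio hu
      refine ⟨y v * l u, mul_pos (hy v hv).1 (hl u hu).1, mem2 _ ?_ ?_ fun w hw => ?_⟩
      · rw [rad_sub, rad_smul, hFr, hP.rad]; ring
      · rw [lie_sub_right, lie_smul_right, hFs, lie_comm, h.ps u hu v hv]; ring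
      · rw [lie_comm]
        have h1 := (hy v hv).2 w hw
        have h2 := h.swap.span_span _ (hZmem v hv) w hw
        have h3 := (hl u hu).1.ne'
        simp only [hF, hY, lie_sub_left, lie_smul_left, lie_add_left, h2]
        rw [h1]; field_simp; ring
    have not1 : p u v ∉ circleSpan c₁ := fun hmem => by
      obtain ⟨w, hw, hne⟩ := h.swap.not_orthogonal hv hu
      exact hne (h.span_span _ hmem w hw)
    have not2 : p u v ∉ circleSpan c₂ := fun hmem => by
      obtain ⟨w, hw, hne⟩ := h.not_orthogonal hu hv
      exact hne (h.swap.span_span _ hmem w hw)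
    obtain ⟨e, he⟩ : ∃ e, e = p u v - a • F := ⟨_, rfl⟩
    obtain ⟨e', he'⟩ : ∃ e', e' = p u v - b • F := ⟨_, rfl⟩
    rw [← he] at ea
    rw [← he'] at eb
    have hee' := h.span_span _ ea _ eb
    have hpF : lie e e = -2 * a * lie (p u v) F := by
      rw [he]
      simp only [lie_sub_left, lie_sub_right, lie_smul_left, lie_smul_right, hFF, hP.null,
        lie_comm F]; ring
    have hpF' : lie e' e' = -2 * b * lie (p u v) F := by
      rw [he']
      simp only [lie_sub_left, lie_sub_right, lie_smul_left, lie_smul_right, hFF, hP.null,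
        lie_comm F]; ring
    have hpFee : lie e e' = -(a + b) * lie (p u v) F := by
      rw [he, he']
      simp only [lie_sub_left, lie_sub_right, lie_smul_left, lie_smul_right, hFF, hP.null,
        lie_comm F]; ring
    -- The differences `p - a F` and `p - b F` lie in orthogonal spans, while their product is `-(a
    -- + b) * lie p F` with `a + b > 0`. So the isotropic vectors `p` and `F` are proportional.
    have h0 : lie (p u v) F = 0 := by
      rw [hee'] at hpFee
      have : a + b ≠ 0 := (add_pos ha hb).ne'
      rcases mul_eq_zero.1 hpFee.symm with h1 | h1
      · exact absurd (neg_eq_zero.1 h1) this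
      · exact h1
    have h1 : F = (tr F / tr (p u v)) • p u v := hP.eq_smul hFr h0 hFF
    set c := tr F / tr (p u v) with hc
    refine ⟨a, ha, ?_⟩
    change p u v = a • F
    have h2 : e = (1 - a * c) • p u v := by rw [he, h1]; module
    -- If `a` were not the factor of proportionality, `p u v` itself would lie in the first circle
    -- span and be orthogonal to the second.
    by_contra hne
    have h3 : (1 - a * c) ≠ 0 := fun h3 => hne (by
      rw [h3, zero_smul] at h2; rw [← sub_eq_zero, ← he, h2])
    apply not1
    have := (circleSpan c₁).smul_mem (1 - a * c)⁻¹ ea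
    rwa [h2, smul_smul, inv_mul_cancel₀ h3, one_smul] at this

theorem IsPatch.exists_data {g : ℝ → ℝ → Space} (hg : IsPatch g) :
    ∃ D : PatchData, D.IsGood ∧ SamePatch g D.std :=
  hg.elim IsDupinPatch.exists_data IsSphericalPatch.exists_data

/-! ### Circular arcs -/

/-- Two points together with a unit vector representing a direction at the first one. -/
structure ArcData (P Q b : LieVec) : Prop where
  ptP : IsPt P
  ptQ : IsPt Q
  neg : lie P Q < 0
  rad : rad b = 0
  Pb : lie P b = 0
  unit : lie b b = 1

/-- The vector of the direction `b` which is orthogonal to both end points. -/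
noncomputable def arcDir (P Q b : LieVec) : LieVec := b - (lie b Q / lie P Q) • P

/-- The circular arc from `P` to `Q` with initial direction `b`. -/
noncomputable def circArc (P Q b : LieVec) (u : ℝ) : LieVec :=
  (1 - u) ^ 2 • P + u ^ 2 • Q + (2 * u * (1 - u) * √(-lie P Q / 2)) • arcDir P Q b

theorem circArc_zero (P Q b : LieVec) : circArc P Q b 0 = P := by simp [circArc]
theorem circArc_one (P Q b : LieVec) : circArc P Q b 1 = Q := by simp [circArc]

namespace ArcData

variable {P Q b : LieVec}

theorem lie_P_arcDir (h : ArcData P Q b) : lie P (arcDir P Q b) = 0 := by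
  simp only [arcDir, lie_sub_right, lie_smul_right, h.ptP.null, h.Pb]; ring

theorem lie_Q_arcDir (h : ArcData P Q b) : lie Q (arcDir P Q b) = 0 := by
  have := h.neg.ne
  rw [lie_comm]
  simp only [arcDir, lie_sub_left, lie_smul_left]
  rw [div_mul_cancel₀ _ this, sub_self]

theorem lie_arcDir (h : ArcData P Q b) : lie (arcDir P Q b) (arcDir P Q b) = 1 := by
  simp only [arcDir, lie_sub_left, lie_sub_right, lie_smul_left, lie_smul_right, h.ptP.null, h.Pb,
    h.unit, lie_comm b P]; ring

theorem rad_arcDir (h : ArcData P Q b) : Cyclidic.rad (arcDir P Q b) = 0 := by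
  rw [arcDir, rad_sub, rad_smul, h.rad, h.ptP.rad]; ring

theorem sq_sqrt (h : ArcData P Q b) : √(-lie P Q / 2) ^ 2 = -lie P Q / 2 :=
  Real.sq_sqrt (by linarith [h.neg])

theorem sqrt_pos (h : ArcData P Q b) : 0 < √(-lie P Q / 2) :=
  Real.sqrt_pos.2 (by linarith [h.neg])

/-- The vector `arcDir P Q b` is a unit vector orthogonal to both ends, and the square root in
`circArc` is the factor that completes the square. -/
theorem lie_circArc (h : ArcData P Q b) (u u' : ℝ) :
    lie (circArc P Q b u) (circArc P Q b u') = lie P Q * (u - u') ^ 2 := by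
  have h1 := h.lie_P_arcDir
  have h2 := h.lie_Q_arcDir
  simp only [circArc, lie_add_left, lie_add_right, lie_smul_left, lie_smul_right, h.ptP.null,
    h.ptQ.null, lie_comm Q P, lie_comm (arcDir P Q b) P, lie_comm (arcDir P Q b) Q, h1, h2,
    h.lie_arcDir]
  linear_combination 4 * u * (1 - u) * u' * (1 - u') * h.sq_sqrt

theorem isPt_circArc (h : ArcData P Q b) (u : ℝ) : IsPt (circArc P Q b u) := by
  by_cases hu : u = 0
  · rw [hu, circArc_zero]; exact h.ptP
  · refine isPt_of_lie_neg h.ptP ?_ (by rw [h.lie_circArc]; ring) ?_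
    · rw [circArc, rad_add, rad_add, rad_smul, rad_smul, rad_smul, h.ptP.rad, h.ptQ.rad,
        h.rad_arcDir]; ring
    · have := h.lie_circArc 0 u
      rw [circArc_zero] at this
      rw [this]
      have : 0 < (0 - u) ^ 2 := by rw [zero_sub, neg_sq]; positivity
      exact mul_neg_of_neg_of_pos h.neg this

theorem eq_of_toSpace (h : ArcData P Q b) {u u' : ℝ}
    (he : toSpace (circArc P Q b u) = toSpace (circArc P Q b u')) : u = u' := by
  have := (toSpace_eq_iff (h.isPt_circArc u) (h.isPt_circArc u')).1 he
  rw [h.lie_circArc] at this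
  have := (mul_eq_zero.1 this).resolve_left h.neg.ne
  exact sub_eq_zero.1 (by simpa using this)

theorem reflect (h : ArcData P Q b) {n : LieVec} (hr : Cyclidic.rad n = 0) (hn : 0 < lie n n) :
    ArcData (reflect n P) (reflect n Q) (reflect n b) where
  ptP := isPt_reflect h.ptP hr hn
  ptQ := isPt_reflect h.ptQ hr hn
  neg := by rw [lie_reflect hn.ne']; exact h.neg
  rad := by rw [rad_reflect hr, h.rad]
  Pb := by rw [lie_reflect hn.ne', h.Pb]
  unit := by rw [lie_reflect hn.ne', h.unit]

end ArcData

theorem reflect_circArc {n : LieVec} (hn : lie n n ≠ 0) (P Q b : LieVec) (u : ℝ) :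
    reflect n (circArc P Q b u) = circArc (reflect n P) (reflect n Q) (reflect n b) u := by
  simp only [circArc, arcDir, map_add, map_sub, map_smul, lie_reflect hn]

/-- The Möbius transformations of the unit interval. -/
theorem isReparam_moebius {a b : ℝ} (ha : 0 < a) (hb : 0 < b) :
    IsReparam fun u => b * u / (a * (1 - u) + b * u) := by
  have hpos : ∀ u ∈ I, 0 < a * (1 - u) + b * u := fun u hu => by
    have h1 := hu.1
    have h2 := hu.2
    rcases eq_or_lt_of_le h1 with h | h
    · rw [← h]; simpa using ha
    · have : 0 ≤ a * (1 - u) := mul_nonneg ha.le (by linarith)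
      have : 0 < b * u := mul_pos hb h
      linarith
  refine isReparam_of_injOn ?_ (fun u hu u' hu' he => ?_) (by simp) ?_
  · refine ContinuousOn.div (by fun_prop) (by fun_prop) fun u hu => (hpos u hu).ne'
  · have h1 := (hpos u hu).ne'
    have h2 := (hpos u' hu').ne'
    rw [div_eq_div_iff h1 h2] at he
    have : b * a * (u - u') = 0 := by linear_combination he
    exact sub_eq_zero.1 ((mul_eq_zero.1 this).resolve_left (mul_pos hb ha).ne')
  · simp [hb.ne']

/-- A circular arc depends only on its end points and its direction, up to reparametrization. -/
theorem exists_reparam_circArc {P Q b : LieVec} (h : ArcData P Q b) {c d : ℝ} (hc : 0 < c)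
    (hd : 0 < d) (x : ℝ) : ∃ φ, IsReparam φ ∧ ∀ u ∈ I, ∃ s : ℝ, 0 < s ∧
      circArc (c • P) (d • Q) (b + x • P) u = s • circArc P Q b (φ u) := by
  have hc' := Real.sqrt_pos.2 hc
  have hd' := Real.sqrt_pos.2 hd
  have hcc := Real.sq_sqrt hc.le
  have hdd := Real.sq_sqrt hd.le
  -- The factors `c`, `d` and `√c * √d` of the three terms are absorbed by replacing `1 - u` and `u`
  -- with `√c * (1 - u)` and `√d * u` and dividing by the sum.
  refine ⟨_, isReparam_moebius hc' hd', fun u hu => ?_⟩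
  have hpos : 0 < √c * (1 - u) + √d * u := by
    rcases eq_or_lt_of_le hu.1 with h | h
    · rw [← h]; simpa using hc'
    · have h2 := hu.2
      have : 0 ≤ √c * (1 - u) := mul_nonneg hc'.le (by linarith)
      have : 0 < √d * u := mul_pos hd' h
      linarith
  refine ⟨(√c * (1 - u) + √d * u) ^ 2, by positivity, ?_⟩
  have e1 : arcDir (c • P) (d • Q) (b + x • P) = arcDir P Q b := by
    have := h.neg.ne
    simp only [arcDir, lie_smul_left, lie_smul_right, lie_add_left, smul_smul]
    have : d * (lie b Q + x * lie P Q) / (d * (c * lie P Q)) * c = lie b Q / lie P Q + x := by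
      field_simp
    rw [this]; module
  have e2 : √(-lie (c • P) (d • Q) / 2) = √c * √d * √(-lie P Q / 2) := by
    rw [← Real.sqrt_mul hc.le, ← Real.sqrt_mul (by positivity)]
    congr 1
    rw [lie_smul_left, lie_smul_right]; ring
  rw [circArc, e1, e2, circArc]
  have e3 : 1 - √d * u / (√c * (1 - u) + √d * u) = √c * (1 - u) / (√c * (1 - u) + √d * u) := by
    field_simp; ring
  rw [e3]
  generalize √c * (1 - u) + √d * u = S at hpos
  have hS := hpos.ne'
  generalize √(-lie P Q / 2) = k
  simp only [smul_add, smul_smul]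
  congr 1
  · congr 1
    · congr 1
      rw [div_pow, mul_div_cancel₀ _ (pow_ne_zero 2 hpos.ne'), mul_pow, hcc, mul_comm]
    · congr 1
      rw [div_pow, mul_div_cancel₀ _ (pow_ne_zero 2 hpos.ne'), mul_pow, hdd, mul_comm]
  · congr 1
    field_simp

theorem ArcData.toSpace_reparam {P Q b P' Q' b' : LieVec} (h : ArcData P Q b) {c d x : ℝ}
    (hc : 0 < c) (hd : 0 < d) (hP : P' = c • P) (hQ : Q' = d • Q) (hb : b' = b + x • P) :
    ∃ φ, IsReparam φ ∧ ∀ u ∈ I,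
      toSpace (circArc P' Q' b' u) = toSpace (circArc P Q b (φ u)) := by
  obtain ⟨φ, hφ, e⟩ := exists_reparam_circArc h hc hd x
  refine ⟨φ, hφ, fun u hu => ?_⟩
  obtain ⟨s, hs, e⟩ := e u hu
  rw [hP, hQ, hb, e, toSpace_smul hs.ne']

/-- The points of a circular arc determine its direction. -/
theorem ArcData.eq_of_image {P Q b P' Q' b' : LieVec} (h : ArcData P Q b) (h' : ArcData P' Q' b')
    {c d : ℝ} (hc : 0 < c) (hP : P' = c • P) (hQ : Q' = d • Q)
    (him : (fun u => toSpace (circArc P' Q' b' u)) '' I ⊆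
      (fun u => toSpace (circArc P Q b u)) '' I) : ∃ x : ℝ, b' = b + x • P := by
  -- One interior point of the second arc suffices: its midpoint is compared with the point of the
  -- first arc representing it, component by component along `P`, `Q` and the common complement.
  have hh : (1 / 2 : ℝ) ∈ I := ⟨by norm_num, by norm_num⟩
  obtain ⟨u, hu, e⟩ := him (mem_image_of_mem _ hh)
  obtain ⟨l, hl, e⟩ := exists_smul_of_toSpace_eq (h.isPt_circArc u) (h'.isPt_circArc _) e
  obtain ⟨w, hw⟩ : ∃ w, w = arcDir P Q b := ⟨_, rfl⟩
  obtain ⟨w', hw'⟩ : ∃ w', w' = arcDir P' Q' b' := ⟨_, rfl⟩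
  have a1 := h.lie_P_arcDir
  have a2 := h.lie_Q_arcDir
  have a3 := h.lie_arcDir
  have b1 := h'.lie_P_arcDir
  have b2 := h'.lie_Q_arcDir
  have b3 := h'.lie_arcDir
  have hL := h.neg
  have hk := h.sqrt_pos
  have hk' := h'.sqrt_pos
  have hd : d ≠ 0 := by
    rintro rfl
    rw [zero_smul] at hQ
    exact h'.ptQ.ne_zero hQ
  rw [circArc, circArc, ← hw, ← hw'] at e
  rw [← hw] at a1 a2 a3
  rw [← hw'] at b1 b2 b3
  generalize √(-lie P Q / 2) = k at e hk
  generalize √(-lie P' Q' / 2) = k' at e hk'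
  rw [hP, hQ] at e
  rw [hP, lie_smul_left] at b1
  rw [hQ, lie_smul_left] at b2
  replace b1 := (mul_eq_zero.1 b1).resolve_left hc.ne'
  replace b2 := (mul_eq_zero.1 b2).resolve_left hd
  have e1 := congrArg (lie P) e
  have e2 := congrArg (lie Q) e
  simp only [lie_add_right, lie_smul_right, h.ptP.null, h.ptQ.null, a1, a2, b1, b2,
    lie_comm Q P] at e1 e2
  have f1 : d / 4 = l * u ^ 2 := mul_right_cancel₀ hL.ne (by linarith)
  have f2 : c / 4 = l * (1 - u) ^ 2 := mul_right_cancel₀ hL.ne (by linarith)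
  have e3 : (k' / 2) • w' = (l * (2 * u * (1 - u) * k)) • w := by
    have : (k' / 2) • w' = l • ((1 - u) ^ 2 • P + u ^ 2 • Q + (2 * u * (1 - u) * k) • w) -
        (c / 4) • P - (d / 4) • Q := by rw [← e]; module
    rw [this, f1, f2]; module
  have hpos : 0 ≤ l * (2 * u * (1 - u) * k) / (k' / 2) := by
    have := hu.1
    have : 0 ≤ 1 - u := by linarith [hu.2]
    positivity
  have e4 : w' = (l * (2 * u * (1 - u) * k) / (k' / 2)) • w := by
    rw [div_eq_inv_mul, mul_smul, ← e3, smul_smul, inv_mul_cancel₀ (by positivity), one_smul]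
  -- Both vectors are units, and the factor is non-negative because the parameter of the point lies
  -- in `[0,1]`; this excludes the complementary arc.
  have e5 : l * (2 * u * (1 - u) * k) / (k' / 2) = 1 := by
    rw [e4, lie_smul_left, lie_smul_right, a3, mul_one] at b3
    nlinarith
  rw [e5, one_smul, hw, hw', arcDir, arcDir] at e4
  refine ⟨(lie b' Q' / lie P' Q') * c - lie b Q / lie P Q, ?_⟩
  rw [sub_smul, mul_smul, ← hP]
  rw [sub_eq_iff_eq_add] at e4
  exact e4.trans (by module)

/-! ### Circular arcs on patches -/

theorem IsPreArc.isPt_end {P Y B : LieVec} (h : IsPreArc P Y B) (hP : IsPt P) : IsPt (P + Y) := by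
  refine isPt_of_lie_neg hP (by rw [rad_add, hP.rad, h.radY, add_zero]) ?_ ?_
  · simp only [lie_add_left, lie_add_right, hP.null, lie_comm Y P, h.YY]; ring
  · rw [lie_add_right, hP.null, zero_add]; exact h.neg

/-- The unit vector of the initial direction of a conic arc. -/
noncomputable def unitDir (P Y B : LieVec) : LieVec := (√(-lie P Y / 2))⁻¹ • B

theorem IsPreArc.sqrt_pos {P Y B : LieVec} (h : IsPreArc P Y B) : 0 < √(-lie P Y / 2) :=
  Real.sqrt_pos.2 (by linarith [h.neg])

theorem IsPreArc.smul_unitDir {P Y B : LieVec} (h : IsPreArc P Y B) :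
    √(-lie P Y / 2) • unitDir P Y B = B := by
  rw [unitDir, smul_smul, mul_inv_cancel₀ h.sqrt_pos.ne', one_smul]

theorem IsPreArc.arcData {P Y B : LieVec} (h : IsPreArc P Y B) (hP : IsPt P) :
    ArcData P (P + Y) (unitDir P Y B) where
  ptP := hP
  ptQ := h.isPt_end hP
  neg := by rw [lie_add_right, hP.null, zero_add]; exact h.neg
  rad := by rw [unitDir, rad_smul, h.radB, mul_zero]
  Pb := by rw [unitDir, lie_smul_right, h.PB, mul_zero]
  unit := by
    have h1 := h.sqrt_pos
    have h2 := Real.sq_sqrt (show 0 ≤ -lie P Y / 2 by linarith [h.neg])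
    rw [unitDir, lie_smul_left, lie_smul_right, h.BB, ← h2, Real.sqrt_sq h1.le]
    generalize √(-lie P Y / 2) = k at h1
    field_simp

/-- Making `B` orthogonal to `P + Y` subtracts `(lie B Y / lie P Y) • P`, which is exactly the
middle term of `weight`. -/
theorem IsPreArc.eq_circArc {P Y B : LieVec} (h : IsPreArc P Y B) (hP : IsPt P) (u : ℝ) :
    weight P Y B u • P + numer Y B u = circArc P (P + Y) (unitDir P Y B) u := by
  have h0 := h.neg.ne
  have e1 : lie P (P + Y) = lie P Y := by rw [lie_add_right, hP.null, zero_add]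
  have e3 : √(-lie P Y / 2) • arcDir P (P + Y) (unitDir P Y B) =
      B - (lie B Y / lie P Y) • P := by
    have : lie (unitDir P Y B) (P + Y) = (√(-lie P Y / 2))⁻¹ * lie B Y := by
      rw [unitDir, lie_smul_left, lie_add_right, lie_comm B P, h.PB, zero_add]
    rw [arcDir, this, e1, smul_sub, h.smul_unitDir, smul_smul]
    congr 2
    have := h.sqrt_pos
    generalize √(-lie P Y / 2) = k at this
    field_simp
  rw [circArc, e1, mul_smul, e3, weight, numer]
  module

namespace PatchData

variable {D : PatchData}

theorem F_u_zero (u : ℝ) : D.F u 0 = D.r u • D.P + D.y u := by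
  simp [F, q, z, weight_zero, numer_zero]

theorem F_u_one (u : ℝ) : D.F u 1 = D.r u • D.P + D.y u + D.r u • D.Z := by
  simp [F, q, z, weight_one, numer_one]

theorem IsPre.F_u_zero_eq (h : D.IsPre) (u : ℝ) :
    D.F u 0 = circArc D.P (D.P + D.Y) (unitDir D.P D.Y D.B) u := by
  rw [F_u_zero]; exact h.arc₁.eq_circArc h.pt u

theorem IsPre.lie_Z_F (h : D.IsPre) (u : ℝ) : lie D.Z (D.F u 0) = D.r u * lie D.P D.Z := by
  rw [lie_comm]
  simp only [F_u_zero, y, numer, lie_add_left, lie_smul_left, h.YZ, h.BZ]; ring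

/-- Since `lie Z Z = -2 * lie P Z` and `lie Z (F u 0) = r * lie P Z`, the reflection adds `r • Z`.
Opposite sides of a patch thus correspond under one inversion, parameter by parameter. -/
theorem IsPre.reflect_F (h : D.IsPre) (u : ℝ) : reflect D.Z (D.F u 0) = D.F u 1 := by
  have h0 := h.arc₂.neg.ne
  rw [reflect_apply, h.lie_Z_F, h.arc₂.YY, F_u_one, F_u_zero]
  have : 2 * (D.r u * lie D.P D.Z) / (-2 * lie D.P D.Z) = -D.r u := by field_simp
  rw [this]; module

theorem IsPre.lie_C_F (h : D.IsPre) (u : ℝ) : lie (D.F u 0) D.C = 0 := by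
  simp only [F_u_zero, y, numer, lie_add_left, lie_smul_left, h.YC, h.BC, h.arc₂.PB]; ring

/-- The coordinate lines of a patch are circular arcs. -/
theorem IsGood.exists_line (h : D.IsGood) {u : ℝ} (hu : u ∈ I) {A : LieVec} {s : ℝ} (hs : 0 < s)
    (hA : D.F u 0 = s • A) : ∃ φ, IsReparam φ ∧ ∀ v ∈ I,
      D.std u v = toSpace (circArc A (reflect D.Z A) (unitDir D.P D.Z D.C) (φ v)) := by
  have hr := h.r_pos u hu
  have h0 := h.arc₂.neg
  -- With this scaling `A₀` has the same products with `Z` and `C` as `P`, so the line through it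
  -- has the same `Z`, `C` and weight as the line `u = 0`.
  set A₀ := (D.r u)⁻¹ • D.F u 0 with hA₀
  have hpt : IsPt A₀ := (h.isPt_F hu zero_mem_I).smul (inv_pos.2 hr)
  have hAZ : lie A₀ D.Z = lie D.P D.Z := by
    rw [hA₀, lie_smul_left, lie_comm, h.lie_Z_F, inv_mul_cancel_left₀ hr.ne']
  have hpre : IsPreArc A₀ D.Z D.C :=
    ⟨h.arc₂.radY, h.arc₂.radB, by rw [hA₀, lie_smul_left, h.lie_C_F, mul_zero], by rwa [hAZ],
      by rw [hAZ]; exact h.arc₂.YY, by rw [hAZ]; exact h.arc₂.BB⟩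
  have hw : ∀ v, weight A₀ D.Z D.C v = D.q v := fun v => by rw [weight, hAZ]; rfl
  have hd : unitDir A₀ D.Z D.C = unitDir D.P D.Z D.C := by rw [unitDir, unitDir, hAZ]
  have hF : ∀ v, (D.r u)⁻¹ • D.F u v =
      circArc A₀ (A₀ + D.Z) (unitDir D.P D.Z D.C) v := fun v => by
    rw [← hd, ← hpre.eq_circArc hpt, hw, hA₀, F_u_zero, F]
    change _ = _ + D.z v
    have : D.z v = ((D.r u)⁻¹ * D.r u) • D.z v := by rw [inv_mul_cancel₀ hr.ne', one_smul]
    conv_rhs => rw [this]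
    module
  have hk : 0 < (D.r u)⁻¹ * s := mul_pos (inv_pos.2 hr) hs
  have hA1 : A₀ = ((D.r u)⁻¹ * s) • A := by rw [hA₀, hA, smul_smul]
  have hA2 : A₀ + D.Z = ((D.r u)⁻¹ * s) • reflect D.Z A := by
    rw [← map_smul, ← hA1, reflect_apply, lie_comm, hAZ, h.arc₂.YY]
    have : 2 * lie D.P D.Z / (-2 * lie D.P D.Z) = -1 := by
      rw [neg_mul, div_neg, div_self (mul_ne_zero two_ne_zero h0.ne)]
    rw [this]; module
  have hdata := hpre.arcData hpt
  rw [hd] at hdata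
  have hA3 : A = ((D.r u)⁻¹ * s)⁻¹ • A₀ := by
    rw [hA1, smul_smul, inv_mul_cancel₀ hk.ne', one_smul]
  have hA4 : reflect D.Z A = ((D.r u)⁻¹ * s)⁻¹ • (A₀ + D.Z) := by
    rw [hA2, smul_smul, inv_mul_cancel₀ hk.ne', one_smul]
  obtain ⟨φ, hφ, e⟩ := hdata.toSpace_reparam (x := 0) (inv_pos.2 hk) (inv_pos.2 hk) hA3 hA4
    (by rw [zero_smul, add_zero])
  obtain ⟨φ', hφ', e', -⟩ := hφ.exists_inv
  refine ⟨φ', hφ', fun v hv => ?_⟩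
  rw [e _ (hφ'.mem hv), e' v hv, ← hF, toSpace_smul (inv_pos.2 hr).ne', std]

/-- Patch data are determined, up to a factor, by the vertices and the directions at the first
vertex. -/
theorem IsPre.unique {D' : PatchData} (h : D.IsPre) (h' : D'.IsPre) {c x y z k k' ξ ξ' : ℝ}
    (hc : 0 < c) (hk : 0 < k) (hk' : 0 < k')
    (eP : D'.P = c • D.P) (eY : D'.P + D'.Y = x • (D.P + D.Y)) (eZ : D'.P + D'.Z = y • (D.P + D.Z))
    (e3 : D'.P + D'.Y + D'.Z = z • (D.P + D.Y + D.Z))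
    (eB : D'.B = k • D.B + ξ • D.P) (eC : D'.C = k' • D.C + ξ' • D.P) :
    (∀ u, D'.r u = D.r u) ∧ (∀ v, D'.q v = D.q v) ∧ ∀ u v, D'.F u v = c • D.F u v := by
  have hY := h.arc₁.neg
  have hZ := h.arc₂.neg
  have hYZ : lie (D.P + D.Y) (D.P + D.Z) < 0 := by
    simp only [lie_add_left, lie_add_right, h.pt.null, h.YZ, lie_comm D.Y D.P]; linarith
  -- Three vertices are independent, so the relation among the four is unique up to a factor; hence
  -- all four vertices are scaled by the same `c`.
  obtain ⟨l1, l2, l3⟩ := linearIndependent_of_isPt (x := z - c) (y := x - z) (z := y - z) h.pt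
    (h.arc₁.isPt_end h.pt) (h.arc₂.isPt_end h.pt) (by rw [lie_add_right, h.pt.null]; linarith)
    (by rw [lie_add_right, h.pt.null]; linarith) hYZ (by
      have : D'.P + D'.Y + D'.Z = x • (D.P + D.Y) + y • (D.P + D.Z) - c • D.P := by
        rw [← eY, ← eZ, ← eP]; module
      rw [e3] at this
      rw [← sub_eq_zero] at this
      rw [← neg_zero, ← this]; module)
  have hz : z = c := by linarith
  have hx : x = c := by linarith
  have hy : y = c := by linarith
  have fY : D'.Y = c • D.Y := by
    have : D'.Y = x • (D.P + D.Y) - D'.P := by rw [← eY]; abel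
    rw [this, eP, hx]; module
  have fZ : D'.Z = c • D.Z := by
    have : D'.Z = y • (D.P + D.Z) - D'.P := by rw [← eZ]; abel
    rw [this, eP, hy]; module
  -- A component along `P` would destroy the orthogonality of `B` and `Z`.
  have hξ : ξ = 0 := by
    have h1 := h'.BZ
    rw [eB, fZ] at h1
    simp only [lie_add_left, lie_smul_left, lie_smul_right, h.BZ, mul_zero, zero_add] at h1
    have h2 : ξ * (c * lie D.P D.Z) = 0 := by linarith
    exact (mul_eq_zero.1 h2).resolve_right (mul_ne_zero hc.ne' hZ.ne)
  have hξ' : ξ' = 0 := by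
    have h1 := h'.YC
    rw [eC, fY, lie_comm] at h1
    simp only [lie_add_left, lie_smul_left, lie_smul_right, lie_comm D.C D.Y, h.YC, mul_zero,
      zero_add] at h1
    have h2 : ξ' * (c * lie D.P D.Y) = 0 := by linarith
    exact (mul_eq_zero.1 h2).resolve_right (mul_ne_zero hc.ne' hY.ne)
  -- The prescribed lengths of `B` and `C` fix the positive factors `k` and `k'`.
  have hsq : ∀ {a L : ℝ}, 0 < a → L < 0 → a * (a * (-L / 2)) = -(c * (c * L)) / 2 → a = c := by
    intro a L ha hL h1
    have h2 : (a - c) * ((a + c) * (L / 2)) = 0 := by linear_combination -h1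
    have h3 : (a + c) * (L / 2) ≠ 0 := mul_ne_zero (add_pos ha hc).ne' (by linarith)
    linarith [(mul_eq_zero.1 h2).resolve_right h3]
  rw [hξ, zero_smul, add_zero] at eB
  rw [hξ', zero_smul, add_zero] at eC
  have hkc : k = c := by
    have h1 := h'.arc₁.BB
    rw [eB, eP, fY] at h1
    simp only [lie_smul_left, lie_smul_right, h.arc₁.BB] at h1
    exact hsq hk hY h1
  have hkc' : k' = c := by
    have h1 := h'.arc₂.BB
    rw [eC, eP, fZ] at h1
    simp only [lie_smul_left, lie_smul_right, h.arc₂.BB] at h1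
    exact hsq hk' hZ h1
  rw [hkc] at eB
  rw [hkc'] at eC
  have hr : ∀ u, D'.r u = D.r u := fun u => by
    simp only [r, weight, eP, fY, eB, lie_smul_left, lie_smul_right]
    have := hY.ne
    field_simp
  have hq : ∀ u, D'.q u = D.q u := fun u => by
    simp only [q, weight, eP, fZ, eC, lie_smul_left, lie_smul_right]
    have := hZ.ne
    field_simp
  refine ⟨hr, hq, fun u v => ?_⟩
  simp only [F, hr, hq, eP, PatchData.y, PatchData.z, numer, fY, fZ, eB, eC]
  module

end PatchData

/-! ### Directions -/

/-- The Euclidean direction at the finite point `P` of a vector orthogonal to `P`. -/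
noncomputable def dir (P b : LieVec) : E3 := b.1 - (b.2.1 / P.2.1) • P.1

theorem IsPt.coord_nonneg {P : LieVec} (h : IsPt P) : 0 ≤ P.2.1 := by
  have h1 := h.null
  have h2 := h.rad
  have h3 := h.pos
  simp only [lie, Cyclidic.rad, tr, real_inner_self_eq_norm_sq] at h1 h2 h3
  rw [h2] at h1
  have h4 := sq_nonneg ‖P.1‖
  by_contra hc
  push Not at hc
  nlinarith

theorem dir_smul {c : ℝ} (hc : c ≠ 0) (P b : LieVec) : dir (c • P) b = dir P b := by
  simp only [dir, Prod.smul_fst, Prod.smul_snd, smul_eq_mul, smul_smul]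
  congr 2
  by_cases h : P.2.1 = 0
  · simp [h]
  · field_simp

/-- Products of vectors orthogonal to `P` do not change under adding multiples of `P`, so the
`e₀`-coordinates may be assumed to vanish; then only the Euclidean part is left. -/
theorem lie_eq_inner_dir {P b b' : LieVec} (hP : IsPt P) (hP0 : P.2.1 ≠ 0) (hb : rad b = 0)
    (h : lie P b = 0) (h' : lie P b' = 0) : lie b b' = inner ℝ (dir P b) (dir P b') := by
  have e : lie (b - (b.2.1 / P.2.1) • P) (b' - (b'.2.1 / P.2.1) • P) = lie b b' := by
    simp only [lie_sub_left, lie_sub_right, lie_smul_left, lie_smul_right, hP.null, h, h',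
      lie_comm b P]; ring
  rw [← e]
  have e1 : (b - (b.2.1 / P.2.1) • P).2.1 = 0 := by
    simp only [Prod.snd_sub, Prod.fst_sub, Prod.smul_snd, Prod.smul_fst, smul_eq_mul]
    field_simp; ring
  have e1' : (b' - (b'.2.1 / P.2.1) • P).2.1 = 0 := by
    simp only [Prod.snd_sub, Prod.fst_sub, Prod.smul_snd, Prod.smul_fst, smul_eq_mul]
    field_simp; ring
  have e2 : rad (b - (b.2.1 / P.2.1) • P) = 0 := by rw [rad_sub, rad_smul, hb, hP.rad]; ring
  rw [rad] at e2
  rw [lie, e1, e1', e2]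
  simp [dir]

/-- Modulo `P`, the vectors orthogonal to `P` with `rad = 0` are the Euclidean tangent vectors.
After matching the `e₀`-coordinates, the orthogonality to `P` determines the `e_∞`-coordinate. -/
theorem eq_add_smul_of_dir {P b b' : LieVec} (hP : IsPt P) (hP0 : P.2.1 ≠ 0) (hb : rad b = 0)
    (hb' : rad b' = 0) (h : lie P b = 0) (h' : lie P b' = 0) (he : dir P b = dir P b') :
    ∃ x : ℝ, b' = b + x • P := by
  set x := (b'.2.1 - b.2.1) / P.2.1 with hx
  refine ⟨x, ?_⟩
  obtain ⟨w, hw⟩ : ∃ w, w = b' - (b + x • P) := ⟨_, rfl⟩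
  have w1 : w.2.1 = 0 := by
    rw [hw]
    simp only [Prod.snd_sub, Prod.fst_sub, Prod.snd_add, Prod.fst_add, Prod.smul_snd,
      Prod.smul_fst, smul_eq_mul, hx]
    field_simp; ring
  have w2 : w.1 = 0 := by
    have h1 : w.1 = dir P b' - dir P b := by
      rw [hw, dir, dir]
      simp only [Prod.fst_sub, Prod.fst_add, Prod.smul_fst, hx, sub_div]
      module
    rw [h1, he, sub_self]
  have w3 : w.2.2.2 = 0 := by
    have : rad w = 0 := by rw [hw, rad_sub, rad_add, rad_smul, hb, hb', hP.rad]; ring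
    exact this
  have w4 : w.2.2.1 = 0 := by
    have h1 : lie P w = 0 := by
      rw [hw, lie_sub_right, lie_add_right, lie_smul_right, h, h', hP.null]; ring
    rw [lie, w1, w2, w3] at h1
    simp only [inner_zero_right, mul_zero, add_zero, zero_sub, sub_zero, neg_eq_zero] at h1
    have h2 : P.2.1 * w.2.2.1 = 0 := by linarith
    exact (mul_eq_zero.1 h2).resolve_left hP0
  have w0 : w = 0 := by
    ext1
    · exact w2
    · ext1
      · exact w1
      · ext1
        · exact w4
        · exact w3
  rw [hw, sub_eq_zero] at w0
  exact w0

theorem IsReparam.tendsto_zero {α : ℝ → ℝ} (h : IsReparam α) : Tendsto α (𝓝[>] 0) (𝓝[>] 0) := by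
  rw [tendsto_nhdsWithin_iff]
  have hmem : ∀ᶠ u in 𝓝[>] (0 : ℝ), u ∈ Ioo (0 : ℝ) 1 := Ioo_mem_nhdsGT one_pos
  have hpos : ∀ᶠ u in 𝓝[>] (0 : ℝ), 0 < α u := hmem.mono fun u hu => by
    have := h.1 zero_mem_I ⟨hu.1.le, hu.2.le⟩ hu.1
    rwa [h.map_zero] at this
  refine ⟨?_, hpos⟩
  rw [Metric.tendsto_nhds]
  intro ε hε
  obtain ⟨w, hw, e⟩ := h.surj (u := min (ε / 2) 1) ⟨by positivity, min_le_right _ _⟩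
  have hw0 : 0 < w := by
    rcases eq_or_lt_of_le hw.1 with h1 | h1
    · rw [← h1, h.map_zero] at e
      have : 0 < min (ε / 2) 1 := by positivity
      linarith
    · exact h1
  filter_upwards [hpos, Ioo_mem_nhdsGT hw0] with u hu hu'
  have hm : u ∈ I := ⟨hu'.1.le, hu'.2.le.trans hw.2⟩
  have h1 := h.1 hm hw hu'.2
  rw [Real.dist_eq, sub_zero, abs_of_pos hu]
  have := min_le_left (ε / 2) 1
  linarith

theorem toE3_toSpace {v : LieVec} (h : v.2.1 ≠ 0) : toE3 (toSpace v) = (v.2.1)⁻¹ • v.1 := by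
  rw [toSpace, if_neg h]; rfl

/-- The linear map `π` kills `P` and sends the arc to `a • V a`, where `V` is continuous and `V 0`
is a positive multiple of the unit vector `dir P b`. Secants from the first point are positive
multiples of `V`, so normalising them gives this direction in the limit. -/
theorem HasDirection.eq_dir {P Q b : LieVec} (h : ArcData P Q b) (hP0 : P.2.1 ≠ 0) {α : ℝ → ℝ}
    (hα : IsReparam α) {γ : ℝ → Space} (hγ : ∀ u ∈ I, γ u = toSpace (circArc P Q b (α u)))
    {t : E3} (ht : HasDirection γ t) : dir P b = t := by
  set π : LieVec → E3 := fun v => v.1 - v.2.1 • ((P.2.1)⁻¹ • P.1) with hπ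
  have πb : π b = dir P b := by simp only [hπ, dir, div_eq_mul_inv, mul_smul]
  have πP : π P = 0 := by simp only [hπ, smul_smul, mul_inv_cancel₀ hP0, one_smul, sub_self]
  have πadd : ∀ v w, π (v + w) = π v + π w := fun v w => by
    simp only [hπ, Prod.fst_add, Prod.snd_add]; module
  have πsmul : ∀ (c : ℝ) v, π (c • v) = c • π v := fun c v => by
    simp only [hπ, Prod.smul_fst, Prod.smul_snd, smul_eq_mul]; module
  set k := √(-lie P Q / 2) with hk
  have hk0 : 0 < k := h.sqrt_pos
  have πE : ∀ a : ℝ, π (circArc P Q b a) = a • (a • π Q + (2 * (1 - a) * k) • dir P b) := by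
    intro a
    have : circArc P Q b a = (1 - a) ^ 2 • P + a ^ 2 • Q + (2 * a * (1 - a) * k) • b +
        (-(2 * a * (1 - a) * k * (lie b Q / lie P Q))) • P := by
      rw [circArc, arcDir, ← hk]; module
    rw [this]
    simp only [πadd, πsmul, πP, πb]; module
  have hunit : ‖dir P b‖ = 1 := by
    have h1 := lie_eq_inner_dir h.ptP hP0 h.rad h.Pb h.Pb
    rw [h.unit, real_inner_self_eq_norm_sq] at h1
    have := norm_nonneg (dir P b)
    nlinarith
  have hcE : Continuous (circArc P Q b) := by unfold circArc; fun_prop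
  have hPpos : 0 < P.2.1 := lt_of_le_of_ne h.ptP.coord_nonneg hP0.symm
  have hα0 := hα.tendsto_zero
  have hev : ∀ᶠ a in 𝓝[>] (0 : ℝ), 0 < (circArc P Q b a).2.1 := by
    have h1 : Continuous fun a => (circArc P Q b a).2.1 := by fun_prop
    have h2 : ∀ᶠ a in 𝓝 (0 : ℝ), 0 < (circArc P Q b a).2.1 := by
      refine h1.continuousAt.eventually (lt_mem_nhds ?_)
      change 0 < (circArc P Q b 0).2.1
      rw [circArc_zero]; exact hPpos
    exact nhdsWithin_le_nhds h2
  have hγ0 : toE3 (γ 0) = (P.2.1)⁻¹ • P.1 := by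
    rw [hγ 0 zero_mem_I, hα.map_zero, circArc_zero, toE3_toSpace hP0]
  set V : ℝ → E3 := fun a => a • π Q + (2 * (1 - a) * k) • dir P b with hV
  have heq : ∀ᶠ u in 𝓝[>] (0 : ℝ), ‖V (α u)‖⁻¹ • V (α u) =
      ‖toE3 (γ u) - toE3 (γ 0)‖⁻¹ • (toE3 (γ u) - toE3 (γ 0)) := by
    filter_upwards [hα0.eventually hev, hα0.eventually eventually_mem_nhdsWithin,
      Ioo_mem_nhdsGT one_pos] with u h1 h2 h3
    have h2' : 0 < α u := h2
    rw [hγ u ⟨h3.1.le, h3.2.le⟩, toE3_toSpace h1.ne', hγ0]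
    have e : ((circArc P Q b (α u)).2.1)⁻¹ • (circArc P Q b (α u)).1 - (P.2.1)⁻¹ • P.1 =
        (((circArc P Q b (α u)).2.1)⁻¹ * α u) • V (α u) := by
      rw [mul_smul, hV, ← πE, hπ]
      simp only [smul_sub, smul_smul, inv_mul_cancel_left₀ h1.ne']
    rw [e, norm_smul, Real.norm_of_nonneg (by positivity), smul_smul]
    congr 1
    have : 0 < ((circArc P Q b (α u)).2.1)⁻¹ * α u := by positivity
    by_cases hn : ‖V (α u)‖ = 0
    · rw [hn]; simp
    · field_simp
  have hVc : Tendsto V (𝓝 0) (𝓝 ((2 * k) • dir P b)) := by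
    have : Continuous V := by fun_prop
    have h1 := this.tendsto 0
    simpa [hV] using h1
  have hnorm : ‖(2 * k) • dir P b‖ = 2 * k := by
    rw [norm_smul, hunit, Real.norm_of_nonneg (by positivity), mul_one]
  have hlim : Tendsto (fun a => ‖V a‖⁻¹ • V a) (𝓝 0) (𝓝 (dir P b)) := by
    have h1 := (hVc.norm.inv₀ (by rw [hnorm]; positivity)).smul hVc
    rwa [hnorm, smul_smul, inv_mul_cancel₀ (by positivity), one_smul] at h1
  have hlim2 : Tendsto (fun u => ‖V (α u)‖⁻¹ • V (α u)) (𝓝[>] 0) (𝓝 (dir P b)) :=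
    hlim.comp (hα0.mono_right nhdsWithin_le_nhds)
  exact tendsto_nhds_unique (hlim2.congr' heq) ht

/-! ### Patches along a circular arc -/

/-- A patch which contains the circular arc from `P` to `Q` with direction `b` as a side: its
second boundary arc is obtained by a reflection, and its remaining coordinate lines are circular
arcs of a constant direction. -/
theorem IsPatch.exists_reflection {g : ℝ → ℝ → Space} (hg : IsPatch g) {P Q b : LieVec}
    (hA : ArcData P Q b) (hP : P.2.1 ≠ 0) (g00 : g 0 0 = toSpace P) (g10 : g 1 0 = toSpace Q)
    {t₁ t₂ : E3} (ht₁ : HasDirection (fun u => g u 0) t₁) (hb : dir P b = t₁)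
    (ht₂ : HasDirection (fun v => g 0 v) t₂) :
    ∃ (n c : LieVec) (φ : ℝ → ℝ), rad n = 0 ∧ 0 < lie n n ∧ rad c = 0 ∧ lie c c = 1 ∧
      dir P c = t₂ ∧ IsReparam φ ∧ (∀ t ∈ I, lie (circArc P Q b t) c = 0) ∧
      (∀ t ∈ I, lie n (circArc P Q b t) ≠ 0) ∧
      ∀ t ∈ I, ∃ ψ, IsReparam ψ ∧ ∀ u ∈ I, g (φ t) u =
        toSpace (circArc (circArc P Q b t) (reflect n (circArc P Q b t)) c (ψ u)) := by
  obtain ⟨D, hD, α, β, hα, hβ, e⟩ := hg.exists_data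
  have hPt := hD.pt
  have h1 := hD.arc₁.arcData hPt
  have h2 := hD.arc₂.arcData hPt
  have eu : ∀ u, D.std u 0 = toSpace (circArc D.P (D.P + D.Y) (unitDir D.P D.Y D.B) u) :=
    fun u => by rw [PatchData.std, hD.F_u_zero_eq]
  have ev : ∀ v, D.std 0 v = toSpace (circArc D.P (D.P + D.Z) (unitDir D.P D.Z D.C) v) :=
    fun v => by rw [← PatchData.std_swap, PatchData.std, hD.swap.F_u_zero_eq]; rfl
  have k0 : toSpace P = toSpace D.P := by
    rw [← g00, e 0 zero_mem_I 0 zero_mem_I, hα.map_zero, hβ.map_zero, eu, circArc_zero]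
  have l0 : toSpace Q = toSpace (D.P + D.Y) := by
    rw [← g10, e 1 one_mem_I 0 zero_mem_I, hα.map_one, hβ.map_zero, eu, circArc_one]
  obtain ⟨k, hk, ek⟩ := exists_smul_of_toSpace_eq hA.ptP hPt k0
  obtain ⟨l, hl, el⟩ := exists_smul_of_toSpace_eq hA.ptQ h1.ptQ l0
  have hDP : D.P.2.1 ≠ 0 := by
    rw [ek]; exact mul_ne_zero hk.ne' hP
  have d1 : dir P (unitDir D.P D.Y D.B) = t₁ := by
    rw [← HasDirection.eq_dir h1 hDP hα (fun u hu => by rw [e u hu 0 zero_mem_I, hβ.map_zero, eu]) ht₁, ek,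
      dir_smul hk.ne']
  have d2 : dir P (unitDir D.P D.Z D.C) = t₂ := by
    rw [← HasDirection.eq_dir h2 hDP hβ (fun v hv => by rw [e 0 zero_mem_I v hv, hα.map_zero, ev]) ht₂, ek,
      dir_smul hk.ne']
  have orth : lie P (unitDir D.P D.Y D.B) = 0 := by
    have := h1.Pb
    nth_rw 1 [ek] at this
    rw [lie_smul_left] at this
    exact (mul_eq_zero.1 this).resolve_left hk.ne'
  -- The given arc and the side of the normal form start in the same Euclidean direction, so they
  -- differ by scalings of the ends and a multiple of `P`, that is, by a reparametrization.
  obtain ⟨x, hx⟩ := eq_add_smul_of_dir hA.ptP hP hA.rad h1.rad hA.Pb orth (hb.trans d1.symm)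
  obtain ⟨φ₀, hφ₀, e₀⟩ := exists_reparam_circArc hA hk hl x
  obtain ⟨φ₁, hφ₁, f₁, -⟩ := hφ₀.exists_inv
  obtain ⟨α', hα', fα, -⟩ := hα.exists_inv
  have key : ∀ t ∈ I, ∃ s : ℝ, 0 < s ∧ D.F (φ₁ t) 0 = s • circArc P Q b t := fun t ht => by
    obtain ⟨s, hs, es⟩ := e₀ _ (hφ₁.mem ht)
    refine ⟨s, hs, ?_⟩
    rw [f₁ t ht, ← ek, ← el, ← hx] at es
    rw [hD.F_u_zero_eq, es]
  refine ⟨D.Z, unitDir D.P D.Z D.C, α' ∘ φ₁, hD.arc₂.radY, ?_, h2.rad, h2.unit, d2, hα'.comp hφ₁,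
    fun t ht => ?_, fun t ht => ?_, fun t ht => ?_⟩
  · rw [hD.arc₂.YY]; linarith [hD.arc₂.neg]
  · obtain ⟨s, hs, es⟩ := key t ht
    have := hD.lie_C_F (φ₁ t)
    rw [es, lie_smul_left] at this
    rw [unitDir, lie_smul_right, (mul_eq_zero.1 this).resolve_left hs.ne', mul_zero]
  · obtain ⟨s, hs, es⟩ := key t ht
    intro h0
    have := hD.lie_Z_F (φ₁ t)
    rw [es, lie_smul_right, h0, mul_zero] at this
    exact mul_ne_zero (hD.r_pos _ (hφ₁.mem ht)).ne' hD.arc₂.neg.ne this.symm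
  · obtain ⟨s, hs, es⟩ := key t ht
    obtain ⟨φ, hφ, eφ⟩ := hD.exists_line (hφ₁.mem ht) hs es
    refine ⟨φ ∘ β, hφ.comp hβ, fun u hu => ?_⟩
    rw [Function.comp, e _ (hα'.mem (hφ₁.mem ht)) _ hu, fα _ (hφ₁.mem ht), eφ _ (hβ.mem hu)]; rfl

theorem IsPatch.swap {g : ℝ → ℝ → Space} (hg : IsPatch g) : IsPatch fun u v => g v u := by
  rcases hg with ⟨P₁, P₂, h₁, h₂, h₁₂, s₁, s₂, hs₁, hs₂, h⟩ |
    ⟨hc, hi, s, hs, hs', c₁, c₂, h₁, h₂, h₁₂, h⟩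
  · refine Or.inl ⟨P₂, P₁, h₂, h₁, fun p hp q hq => by rw [lie_comm]; exact h₁₂ q hq p hp,
      s₂, s₁, hs₂, hs₁, fun u hu v hv => ?_⟩
    rw [Set.pair_comm]; exact h v hv u hu
  · refine Or.inr ⟨?_, ?_, s, hs, hs', c₂, c₁, h₂, h₁,
      fun u hu v hv => by rw [lie_comm]; exact h₁₂ v hv u hu,
      fun u hu v hv => ⟨(h v hv u hu).1, (h v hv u hu).2.2, (h v hv u hu).2.1⟩⟩
    · exact hc.comp (f := Prod.swap) continuous_swap.continuousOn fun p hp => ⟨hp.2, hp.1⟩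
    · intro p hp p' hp' he
      exact Prod.swap_injective (hi (x₁ := p.swap) (x₂ := p'.swap) ⟨hp.2, hp.1⟩ ⟨hp'.2, hp'.1⟩ he)

theorem IsPatch.injOn {g : ℝ → ℝ → Space} (hg : IsPatch g) {u v u' v' : ℝ} (hu : u ∈ I)
    (hv : v ∈ I) (hu' : u' ∈ I) (hv' : v' ∈ I) (h : g u v = g u' v') : u = u' ∧ v = v' := by
  obtain ⟨D, hD, α, β, hα, hβ, e⟩ := hg.exists_data
  rw [e u hu v hv, e u' hu' v' hv'] at h
  have := hD.injOn (hα.mem hu) (hβ.mem hv) (hα.mem hu') (hβ.mem hv') h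
  exact ⟨hα.injOn hu hu' this.1, hβ.injOn hv hv' this.2⟩

/-! ### Directions and reflections -/

theorem lie_lift (x y : E3) : lie (lift x) (lift y) = -‖x - y‖ ^ 2 / 2 := by
  rw [lie, lift, lift]
  simp only [@norm_sub_sq_real]; ring

/-- The vector representing the direction `t` at the point `x`. -/
noncomputable def liftDir (x t : E3) : LieVec := (t, 0, 2 * inner ℝ x t, 0)

theorem rad_liftDir (x t : E3) : rad (liftDir x t) = 0 := rfl

theorem lie_lift_liftDir (x y t : E3) : lie (lift y) (liftDir x t) = inner ℝ (y - x) t := by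
  rw [lie, lift, liftDir]; simp only [inner_sub_left]; ring

theorem lie_liftDir (x t : E3) : lie (liftDir x t) (liftDir x t) = ‖t‖ ^ 2 := by
  rw [lie, liftDir]; simp only [real_inner_self_eq_norm_sq]; ring

theorem dir_lift (x : E3) (b : LieVec) : dir (lift x) b = b.1 - b.2.1 • x := by
  simp [dir, lift]

theorem dir_liftDir (x t : E3) : dir (lift x) (liftDir x t) = t := by simp [dir_lift, liftDir]

/-- The vector `n` must be a multiple of `lift x - c • lift y`. An inversion exchanging `x` and `y`
acts on directions as the reflection in the bisecting plane, which is the rule for the frames of a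
cube. -/
theorem dir_reflect {x y : E3} (hxy : x ≠ y) {n b : LieVec} {c : ℝ} (hc : c ≠ 0)
    (h : reflect n (lift x) = c • lift y) (hb : rad b = 0) (hxb : lie (lift x) b = 0) :
    dir (lift y) (reflect n b) = refl x y (dir (lift x) b) := by
  have hd : ‖x - y‖ ^ 2 ≠ 0 := pow_ne_zero 2 (norm_ne_zero_iff.2 (sub_ne_zero.2 hxy))
  have hx1 : (lift x).2.1 ≠ 0 := one_ne_zero
  obtain ⟨t, ht⟩ : ∃ t, t = dir (lift x) b := ⟨_, rfl⟩
  obtain ⟨μ, hμ⟩ := eq_add_smul_of_dir (isPt_lift x) hx1 (rad_liftDir x t) hb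
    (by rw [lie_lift_liftDir, sub_self, inner_zero_left]) hxb (by rw [dir_liftDir, ht])
  rw [← ht]
  obtain ⟨k, hk⟩ : ∃ k : ℝ, k = 2 * lie n (lift x) / lie n n := ⟨_, rfl⟩
  rw [reflect_apply, ← hk] at h
  have hkn : k • n = lift x - c • lift y := by rw [← h]; abel
  have hk0 : k ≠ 0 := by
    rintro rfl
    rw [zero_smul] at hkn
    have h1 := sub_eq_zero.1 hkn.symm
    have h2 : lie (lift x) (lift y) = 0 := by
      rw [h1, lie_smul_left, (isPt_lift y).null, mul_zero]
    rw [lie_lift] at h2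
    apply hd; linarith
  have hn : n = k⁻¹ • (lift x - c • lift y) := by
    rw [← hkn, smul_smul, inv_mul_cancel₀ hk0, one_smul]
  have l1 : lie (lift x - c • lift y) (lift x - c • lift y) = c * ‖x - y‖ ^ 2 := by
    simp only [lie_sub_left, lie_sub_right, lie_smul_left, lie_smul_right, (isPt_lift _).null,
      lie_comm (lift y) (lift x), lie_lift]; ring
  have l2 : lie (lift x - c • lift y) b = c * (μ * ‖x - y‖ ^ 2 / 2 - inner ℝ (y - x) t) := by
    rw [hμ]
    simp only [lie_sub_left, lie_smul_left, lie_add_right, lie_smul_right, (isPt_lift _).null,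
      lie_lift_liftDir, lie_comm (lift y) (lift x), lie_lift, sub_self, inner_zero_left]; ring
  have e1 : reflect n b = b - (μ - 2 * inner ℝ (y - x) t / ‖x - y‖ ^ 2) •
      (lift x - c • lift y) := by
    rw [reflect_apply, hn]
    simp only [lie_smul_left, lie_smul_right, l1, l2, smul_smul]
    congr 2
    field_simp
    rw [sub_div, mul_div_cancel_right₀ _ hd]
  rw [e1, dir_lift, refl, hμ]
  have e2 : inner ℝ (y - x) (y - x) = ‖x - y‖ ^ 2 := by
    rw [real_inner_self_eq_norm_sq, norm_sub_rev]
  rw [e2]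
  have e3 : 2 * (inner ℝ (y - x) t / ‖x - y‖ ^ 2) = 2 * inner ℝ (y - x) t / ‖x - y‖ ^ 2 := by ring
  rw [e3]
  generalize 2 * inner ℝ (y - x) t / ‖x - y‖ ^ 2 = s
  simp only [liftDir, lift, Prod.fst_sub, Prod.snd_sub, Prod.fst_add, Prod.snd_add, Prod.smul_fst,
    Prod.smul_snd, smul_eq_mul]
  module

/-! ### Compositions of reflections -/

theorem linearMap_eq_zero_or {f g : LieVec →ₗ[ℝ] ℝ} (h : ∀ v, f v * g v = 0) :
    (∀ v, f v = 0) ∨ ∀ v, g v = 0 := by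
  by_contra! hc
  obtain ⟨⟨v, hv⟩, w, hw⟩ := hc
  have h1 := h (v + w)
  rw [map_add, map_add, (mul_eq_zero.1 (h v)).resolve_left hv,
    (mul_eq_zero.1 (h w)).resolve_right hw, add_zero, zero_add] at h1
  exact mul_ne_zero hv hw h1

/-- Two products of two reflections in a plane agree if they agree, up to a factor, at an
isotropic vector outside of the plane. -/
theorem reflect_comp_eq {a n₁ n₂ n₃ n₄ : LieVec} (ha : IsPt a) (r₁ : rad n₁ = 0) (r₄ : rad n₄ = 0)
    (p₁ : 0 < lie n₁ n₁) (p₂ : 0 < lie n₂ n₂) (p₃ : 0 < lie n₃ n₃) (p₄ : 0 < lie n₄ n₄)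
    (h₁ : lie n₁ a ≠ 0) {α β γ δ μ : ℝ} (e₂ : n₂ = α • n₁ + β • n₄)
    (e₃ : n₃ = γ • n₁ + δ • n₄)
    (hind : ∀ x y z : ℝ, x • n₁ + y • n₄ + z • a = 0 → x = 0 ∧ y = 0 ∧ z = 0)
    (hμ : reflect n₂ (reflect n₁ a) = μ • reflect n₃ (reflect n₄ a)) (v : LieVec) :
    reflect n₂ (reflect n₁ v) = reflect n₃ (reflect n₄ v) := by
  have hstep : ∀ n ∈ ({n₁, n₂, n₃, n₄} : Set LieVec), ∀ v w : LieVec,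
      (∃ x y : ℝ, w = v + x • n₁ + y • n₄) → ∃ x y : ℝ, reflect n w = v + x • n₁ + y • n₄ := by
    rintro n hn v w ⟨x, y, hw⟩
    obtain ⟨s, t, hst⟩ : ∃ s t : ℝ, n = s • n₁ + t • n₄ := by
      simp only [mem_insert_iff, mem_singleton_iff] at hn
      rcases hn with rfl | rfl | rfl | rfl
      · exact ⟨1, 0, by module⟩
      · exact ⟨_, _, e₂⟩
      · exact ⟨_, _, e₃⟩
      · exact ⟨0, 1, by module⟩
    obtain ⟨k, hk⟩ : ∃ k : ℝ, k = 2 * lie n w / lie n n := ⟨_, rfl⟩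
    refine ⟨x - k * s, y - k * t, ?_⟩
    rw [reflect_apply, ← hk, hst, hw]; module
  have hid : ∀ v : LieVec, ∃ x y : ℝ, v = v + x • n₁ + y • n₄ := fun v => ⟨0, 0, by module⟩
  -- All reflections change a vector only by elements of the plane, so both images have coefficient
  -- `1` at `a`.
  have hμ1 : μ = 1 := by
    obtain ⟨x, y, e⟩ := hstep n₂ (by simp) a _ (hstep n₁ (by simp) a _ (hid a))
    obtain ⟨x', y', e'⟩ := hstep n₃ (by simp) a _ (hstep n₄ (by simp) a _ (hid a))
    rw [e, e'] at hμ
    have := (hind (x - μ * x') (y - μ * y') (1 - μ) (by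
      rw [← sub_eq_zero] at hμ; rw [← hμ]; module)).2.2
    linarith
  rw [hμ1, one_smul] at hμ
  obtain ⟨M, hM⟩ : ∃ M : LieVec →ₗ[ℝ] LieVec,
    M = reflect n₄ ∘ₗ reflect n₃ ∘ₗ reflect n₂ ∘ₗ reflect n₁ := ⟨_, rfl⟩
  have hMv : ∀ v, M v = reflect n₄ (reflect n₃ (reflect n₂ (reflect n₁ v))) := fun v => by
    rw [hM]; rfl
  have hMa : M a = a := by
    rw [hMv, hμ, reflect_reflect p₃.ne', reflect_reflect p₄.ne']
  have hiso : ∀ v w, lie (M v) (M w) = lie v w := fun v w => by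
    rw [hMv, hMv, lie_reflect p₄.ne', lie_reflect p₃.ne', lie_reflect p₂.ne', lie_reflect p₁.ne']
  have hdet : LinearMap.det M = 1 := by
    rw [hM]
    simp only [LinearMap.det_comp, det_reflect p₁.ne', det_reflect p₂.ne', det_reflect p₃.ne',
      det_reflect p₄.ne']
    norm_num
  -- The product `M` of all four reflections is an isometry fixing `a`, so `M v - v` is orthogonal
  -- to `a` and lies in the plane: it is a multiple of `h`.
  obtain ⟨h, hh⟩ : ∃ h, h = lie n₄ a • n₁ - lie n₁ a • n₄ := ⟨_, rfl⟩
  have ha0 : lie a h = 0 := by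
    rw [lie_comm, hh]; simp only [lie_sub_left, lie_smul_left]; ring
  have hpos : 0 < lie h h := by
    have hr : rad h = 0 := by rw [hh, rad_sub, rad_smul, rad_smul, r₁, r₄]; ring
    refine lt_of_le_of_ne (ha.lie_self_nonneg hr ha0) fun h0 => ?_
    obtain ⟨s, hs⟩ : ∃ s : ℝ, h = s • a := ⟨_, ha.eq_smul hr ha0 h0.symm⟩
    have := (hind (lie n₄ a) (-lie n₁ a) (-s) (by
      rw [← sub_eq_zero] at hs; rw [← hs, hh]; module)).2.1
    exact h₁ (neg_eq_zero.1 this)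
  have hline : ∀ v, ∃ s : ℝ, M v = v + s • h := fun v => by
    obtain ⟨x, y, e⟩ := hstep n₄ (by simp) v _ (hstep n₃ (by simp) v _
      (hstep n₂ (by simp) v _ (hstep n₁ (by simp) v _ (hid v))))
    rw [← hMv] at e
    have h2 := hiso v a
    rw [hMa, e] at h2
    simp only [lie_add_left, lie_smul_left] at h2
    have h3 : x * lie n₁ a + y * lie n₄ a = 0 := by linarith
    refine ⟨-(y / lie n₁ a), ?_⟩
    have h4 : x = -(y / lie n₁ a) * lie n₄ a := by field_simp; linarith
    have h5 : y = -(y / lie n₁ a) * -lie n₁ a := by field_simp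
    rw [e, hh]
    nth_rw 1 [h4]
    nth_rw 2 [h5]
    module
  obtain ⟨f, hf⟩ : ∃ f : LieVec →ₗ[ℝ] ℝ, ∀ v, M v = v + f v • h := by
    refine ⟨(lie h h)⁻¹ • (lieForm h ∘ₗ (M - LinearMap.id)), fun v => ?_⟩
    obtain ⟨s, hs⟩ := hline v
    have : lieForm h (M v - v) = s * lie h h := by
      rw [hs, add_sub_cancel_left]; exact lie_smul_right _ _ _
    rw [LinearMap.smul_apply, LinearMap.comp_apply, LinearMap.sub_apply, LinearMap.id_apply, this,
      smul_eq_mul, mul_comm s, inv_mul_cancel_left₀ hpos.ne', hs]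
  -- Preservation of squares by `v + f v • h` leaves two linear alternatives, the identity and the
  -- reflection in `h`; the determinant excludes the latter.
  have hfg : ∀ v, f v * (f + (2 / lie h h) • lieForm h) v = 0 := fun v => by
    have h1 := hiso v v
    rw [hf] at h1
    simp only [lie_add_left, lie_add_right, lie_smul_left, lie_smul_right, lie_comm v h] at h1
    have h2 : lieForm h v = lie h v := rfl
    have h3 : f v * (f v * lie h h + 2 * lie h v) = 0 := by linear_combination h1
    rw [LinearMap.add_apply, LinearMap.smul_apply, h2, smul_eq_mul]
    have h4 : f v + 2 / lie h h * lie h v = (f v * lie h h + 2 * lie h v) / lie h h := by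
      field_simp
    rw [h4, mul_div_assoc', h3, zero_div]
  have hM1 : ∀ v, M v = v := by
    rcases linearMap_eq_zero_or hfg with h0 | h0
    · intro v; rw [hf, h0, zero_smul, add_zero]
    · exfalso
      have : M = reflect h := by
        refine LinearMap.ext fun v => ?_
        have h1 := h0 v
        rw [LinearMap.add_apply, LinearMap.smul_apply, smul_eq_mul] at h1
        have h2 : lieForm h v = lie h v := rfl
        rw [h2] at h1
        have h3 : f v = -(2 * lie h v / lie h h) := by linear_combination h1
        rw [hf, reflect_apply, h3]; module
      rw [this, det_reflect hpos.ne'] at hdet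
      norm_num at hdet
  have := hM1 v
  rw [hMv] at this
  rw [← reflect_reflect p₃.ne' (reflect n₂ (reflect n₁ v)),
    ← reflect_reflect p₄.ne' (reflect n₃ (reflect n₂ (reflect n₁ v))), this]

theorem IsPt.lie_reflect_neg {A n : LieVec} (hA : IsPt A) (hn : 0 < lie n n) (h : lie n A ≠ 0) :
    lie A (reflect n A) < 0 := by
  have : lie A (reflect n A) = -(2 * (lie n A) ^ 2 / lie n n) := by
    rw [reflect_apply, lie_sub_right, lie_smul_right, hA.null, lie_comm A n]; ring
  rw [this]
  have := sq_pos_of_ne_zero h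
  have : 0 < 2 * (lie n A) ^ 2 / lie n n := by positivity
  linarith

/-- The direction orthogonal to both ends of a transversal arc is reflected to the direction at
the other end. -/
theorem arcDir_reflect {A b n : LieVec} (hn : 0 < lie n n) (h : lie n A ≠ 0) (hA : IsPt A)
    (hb : lie A b = 0) :
    ∃ s : ℝ, arcDir A (reflect n A) b = reflect n b + s • reflect n A := by
  have h0 := (hA.lie_reflect_neg hn h).ne
  have hk : lie b (reflect n A) / lie A (reflect n A) = lie n b / lie n A := by
    rw [div_eq_div_iff h0 h, lie_comm b, lie_comm A (reflect n A), reflect_apply]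
    simp only [lie_sub_left, lie_smul_left, hA.null, hb]; ring
  refine ⟨-(lie n b / lie n A), ?_⟩
  rw [arcDir, hk]
  obtain ⟨l, hl⟩ : ∃ l, l = lie n b / lie n A := ⟨_, rfl⟩
  have e1 : 2 * lie n b / lie n n = l * (2 * lie n A / lie n n) := by rw [hl]; field_simp
  rw [reflect_apply, reflect_apply, e1, ← hl]
  module

/-! ### Patches from four points and two directions -/

/-- The patch with vertices `A₁`, `x • A₂`, `y • A₄` and directions `b`, `c` at the first one. -/
noncomputable def quadData (A₁ A₂ A₄ b c : LieVec) (x y : ℝ) : PatchData where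
  P := A₁
  Y := x • A₂ - A₁
  B := √(-(x * lie A₁ A₂) / 2) • arcDir A₁ A₄ b
  Z := y • A₄ - A₁
  C := √(-(y * lie A₁ A₄) / 2) • arcDir A₁ A₂ c

section

variable {A₁ A₂ A₃ A₄ b c : LieVec} {x y z : ℝ}

theorem isPreArc_quad (h₂ : ArcData A₁ A₂ c) (h₄ : ArcData A₁ A₄ b) (hx : 0 < x) :
    IsPreArc A₁ (x • A₂ - A₁) (√(-(x * lie A₁ A₂) / 2) • arcDir A₁ A₄ b) := by
  have e : lie A₁ (x • A₂ - A₁) = x * lie A₁ A₂ := by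
    rw [lie_sub_right, lie_smul_right, h₂.ptP.null, sub_zero]
  have hneg : x * lie A₁ A₂ < 0 := mul_neg_of_pos_of_neg hx h₂.neg
  refine ⟨?_, ?_, ?_, by rwa [e], ?_, ?_⟩
  · rw [rad_sub, rad_smul, h₂.ptP.rad, h₂.ptQ.rad]; ring
  · rw [rad_smul, h₄.rad_arcDir, mul_zero]
  · rw [lie_smul_right, h₄.lie_P_arcDir, mul_zero]
  · rw [e]
    simp only [lie_sub_left, lie_sub_right, lie_smul_left, lie_smul_right, h₂.ptP.null,
      h₂.ptQ.null, lie_comm A₂ A₁]; ring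
  · rw [lie_smul_left, lie_smul_right, h₄.lie_arcDir, mul_one, e, Real.mul_self_sqrt (by linarith)]

/-- Isotropy of `A₃` is equivalent to `lie Y Z = 0`. The choice of directions in `quadData` is
crosswise: `B` is made orthogonal to `A₄` and `C` to `A₂`, which gives the orthogonality to `Z` and
`Y`. -/
theorem isPre_quadData (hb₂ : ArcData A₁ A₂ b) (hc₂ : ArcData A₁ A₂ c) (hb₄ : ArcData A₁ A₄ b)
    (hbc : lie b c = 0) (hx : 0 < x) (hy : 0 < y) (h₃ : lie A₃ A₃ = 0)
    (hrel : x • A₂ + y • A₄ - A₁ = z • A₃) : (quadData A₁ A₂ A₄ b c x y).IsPre where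
  pt := hb₂.ptP
  arc₁ := isPreArc_quad hc₂ hb₄ hx
  arc₂ := isPreArc_quad hb₄ hc₂ hy
  YZ := by
    have h1 : lie (x • A₂ + y • A₄ - A₁) (x • A₂ + y • A₄ - A₁) = 0 := by
      rw [hrel, lie_smul_left, lie_smul_right, h₃]; ring
    simp only [quadData]
    simp only [lie_add_left, lie_add_right, lie_sub_left, lie_sub_right, lie_smul_left,
      lie_smul_right, hb₂.ptP.null, hb₂.ptQ.null, hb₄.ptQ.null, lie_comm A₂ A₁, lie_comm A₄ A₁,
      lie_comm A₄ A₂] at h1 ⊢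
    linarith
  YC := by
    simp only [quadData, lie_sub_left, lie_smul_left, lie_smul_right, hc₂.lie_P_arcDir,
      hc₂.lie_Q_arcDir]; ring
  BZ := by
    rw [lie_comm]
    simp only [quadData, lie_sub_left, lie_smul_left, lie_smul_right, hb₄.lie_P_arcDir,
      hb₄.lie_Q_arcDir]; ring
  BC := by
    simp only [quadData, arcDir, lie_sub_left, lie_sub_right, lie_smul_left, lie_smul_right, hbc,
      hb₂.ptP.null, hc₂.Pb, lie_comm b A₁, hb₂.Pb]; ring

theorem unitDir_quad (h₂ : ArcData A₁ A₂ b) (hx : 0 < x) :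
    unitDir A₁ (x • A₂ - A₁) (√(-(x * lie A₁ A₂) / 2) • arcDir A₁ A₄ b) = arcDir A₁ A₄ b := by
  have e : lie A₁ (x • A₂ - A₁) = x * lie A₁ A₂ := by
    rw [lie_sub_right, lie_smul_right, h₂.ptP.null, sub_zero]
  have hneg : x * lie A₁ A₂ < 0 := mul_neg_of_pos_of_neg hx h₂.neg
  rw [unitDir, e, smul_smul, inv_mul_cancel₀ (Real.sqrt_pos.2 (by linarith)).ne', one_smul]

end

namespace PatchData

variable {D : PatchData}

theorem F_zero_one : D.F 0 1 = D.P + D.Z := by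
  simp [F, r, q, y, z, weight_zero, weight_one, numer_zero, numer_one]

theorem F_one_zero : D.F 1 0 = D.P + D.Y := by
  simp [F, r, q, y, z, weight_zero, weight_one, numer_zero, numer_one]

theorem F_one_one : D.F 1 1 = D.P + D.Y + D.Z := by
  simp [F, r, q, y, z, weight_one, numer_one]

theorem IsPre.F_u_one_eq (h : D.IsPre) (u : ℝ) :
    D.F u 1 = circArc (D.P + D.Z) (D.P + D.Y + D.Z) (unitDir D.P D.Y D.B) u := by
  have hn : lie D.Z D.Z ≠ 0 := by
    rw [h.arc₂.YY]; exact mul_ne_zero (by norm_num) h.arc₂.neg.ne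
  have h0 := h.reflect_F 0
  have h1 := h.reflect_F 1
  rw [F_zero_zero, F_zero_one] at h0
  rw [F_one_zero, F_one_one] at h1
  have h2 : Cyclidic.reflect D.Z (unitDir D.P D.Y D.B) = unitDir D.P D.Y D.B :=
    reflect_of_lie_eq_zero (by rw [unitDir, lie_smul_right, lie_comm D.Z, h.BZ, mul_zero])
  rw [← h.reflect_F, h.F_u_zero_eq, reflect_circArc hn, h0, h1, h2]

/-- A patch is non-singular if its opposite sides are disjoint. -/
theorem r_pos_of_ne (hne : ∀ u ∈ I, toSpace (D.F u 0) ≠ toSpace (D.F u 1)) :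
    ∀ u ∈ I, 0 < D.r u := by
  refine pos_of_ne_zero isPreconnected_Icc (continuous_weight _ _ _).continuousOn
    (fun u hu h0 => hne u hu ?_) zero_mem_I (by rw [r, weight_zero]; exact one_pos)
  have : D.r u = 0 := h0
  rw [F_u_one, F_u_zero, this, zero_smul, zero_smul, add_zero]

/-- Uniqueness of patches with given vertices and directions at the first vertex. -/
theorem IsPre.std_eq {D' : PatchData} (h : D.IsPre) (h' : D'.IsPre) {c x y z ξ ξ' : ℝ}
    (hc : 0 < c)
    (eP : D'.P = c • D.P) (eY : D'.P + D'.Y = x • (D.P + D.Y)) (eZ : D'.P + D'.Z = y • (D.P + D.Z))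
    (e3 : D'.P + D'.Y + D'.Z = z • (D.P + D.Y + D.Z))
    (eB : unitDir D'.P D'.Y D'.B = unitDir D.P D.Y D.B + ξ • D.P)
    (eC : unitDir D'.P D'.Z D'.C = unitDir D.P D.Z D.C + ξ' • D.P) (u v : ℝ) :
    D'.std u v = D.std u v := by
  have aux : ∀ {Y B Y' B' : LieVec} {ξ : ℝ}, IsPreArc D.P Y B → IsPreArc D'.P Y' B' →
      unitDir D'.P Y' B' = unitDir D.P Y B + ξ • D.P →
      ∃ k ξ' : ℝ, 0 < k ∧ B' = k • B + ξ' • D.P := by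
    intro Y B Y' B' ξ h1 h2 e
    refine ⟨√(-lie D'.P Y' / 2) * (√(-lie D.P Y / 2))⁻¹, √(-lie D'.P Y' / 2) * ξ,
      mul_pos h2.sqrt_pos (inv_pos.2 h1.sqrt_pos), ?_⟩
    rw [← h2.smul_unitDir, e, unitDir, smul_add, smul_smul, smul_smul]
  obtain ⟨k, s, hk, eB'⟩ := aux h.arc₁ h'.arc₁ eB
  obtain ⟨k', s', hk', eC'⟩ := aux h.arc₂ h'.arc₂ eC
  rw [std, std, (h.unique h' hc hk hk' eP eY eZ e3 eB' eC').2.2 u v, toSpace_smul hc.ne']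

end PatchData

/-! ### Families of patches transversal to a circular arc -/

/-- A circular arc from `P` to `Q` with direction `e`, reflections by which the remaining three
edges of a tube along this arc are obtained, the directions `b` and `c` of the transversal circular
arcs, and the coefficients of the linear relation between the four edges. -/
structure Tube where
  P : LieVec
  Q : LieVec
  e : LieVec
  m : LieVec
  n : LieVec
  m' : LieVec
  n' : LieVec
  b : LieVec
  c : LieVec
  ξ : ℝ → ℝ
  η : ℝ → ℝ
  ζ : ℝ → ℝ

namespace Tube

/-- The first edge. -/
noncomputable def A₁ (T : Tube) (t : ℝ) : LieVec := circArc T.P T.Q T.e t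
/-- The second edge. -/
noncomputable def A₂ (T : Tube) (t : ℝ) : LieVec := reflect T.m (T.A₁ t)
/-- The fourth edge. -/
noncomputable def A₄ (T : Tube) (t : ℝ) : LieVec := reflect T.n (T.A₁ t)
/-- The third edge. -/
noncomputable def A₃ (T : Tube) (t : ℝ) : LieVec := reflect T.n' (T.A₂ t)

/-- Interchanging the two transversal directions. -/
def swap (T : Tube) : Tube := ⟨T.P, T.Q, T.e, T.n, T.m, T.n', T.m', T.c, T.b, T.η, T.ξ, T.ζ⟩

/-- The patches transversal to the edges. -/
noncomputable def data (T : Tube) (t : ℝ) : PatchData :=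
  quadData (T.A₁ t) (T.A₂ t) (T.A₄ t) T.b T.c (T.ξ t / T.ζ t) (T.η t / T.ζ t)

/-- The relations for tubes. -/
structure IsTube (T : Tube) : Prop where
  arc : ArcData T.P T.Q T.e
  rad_m : rad T.m = 0
  rad_n : rad T.n = 0
  rad_m' : rad T.m' = 0
  rad_n' : rad T.n' = 0
  pos_m : 0 < lie T.m T.m
  pos_n : 0 < lie T.n T.n
  pos_m' : 0 < lie T.m' T.m'
  pos_n' : 0 < lie T.n' T.n'
  ne_m : ∀ t ∈ I, lie T.m (T.A₁ t) ≠ 0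
  ne_n : ∀ t ∈ I, lie T.n (T.A₁ t) ≠ 0
  ne_m' : ∀ t ∈ I, lie T.m' (T.A₄ t) ≠ 0
  ne_n' : ∀ t ∈ I, lie T.n' (T.A₂ t) ≠ 0
  comm : ∀ v, reflect T.n' (reflect T.m v) = reflect T.m' (reflect T.n v)
  rel : ∀ t ∈ I, T.A₃ t = T.ξ t • T.A₂ t + T.η t • T.A₄ t - T.ζ t • T.A₁ t
  contDiff_ξ : ContDiffOn ℝ ∞ T.ξ I
  contDiff_η : ContDiffOn ℝ ∞ T.η I
  contDiff_ζ : ContDiffOn ℝ ∞ T.ζ I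
  ζ_pos : ∀ t ∈ I, 0 < T.ζ t
  rad_b : rad T.b = 0
  rad_c : rad T.c = 0
  unit_b : lie T.b T.b = 1
  unit_c : lie T.c T.c = 1
  bc : lie T.b T.c = 0
  orth_b : ∀ t ∈ I, lie (T.A₁ t) T.b = 0
  orth_c : ∀ t ∈ I, lie (T.A₁ t) T.c = 0
  disj_b : ∀ t ∈ I, ∀ u ∈ I, ∀ u' ∈ I, toSpace (circArc (T.A₁ t) (T.A₂ t) T.b u) ≠
    toSpace (circArc (T.A₄ t) (T.A₃ t) (reflect T.n T.b) u')
  disj_c : ∀ t ∈ I, ∀ v ∈ I, ∀ v' ∈ I, toSpace (circArc (T.A₁ t) (T.A₄ t) T.c v) ≠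
    toSpace (circArc (T.A₂ t) (T.A₃ t) (reflect T.m T.c) v')

variable {T : Tube}

theorem data_swap (t : ℝ) : T.swap.data t = (T.data t).swap := rfl

namespace IsTube

theorem A₃_swap (h : T.IsTube) (t : ℝ) : T.swap.A₃ t = T.A₃ t := (h.comm _).symm

theorem swap (h : T.IsTube) : T.swap.IsTube where
  arc := h.arc
  rad_m := h.rad_n
  rad_n := h.rad_m
  rad_m' := h.rad_n'
  rad_n' := h.rad_m'
  pos_m := h.pos_n
  pos_n := h.pos_m
  pos_m' := h.pos_n'
  pos_n' := h.pos_m'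
  ne_m := h.ne_n
  ne_n := h.ne_m
  ne_m' := h.ne_n'
  ne_n' := h.ne_m'
  comm v := (h.comm v).symm
  rel t ht := by
    rw [h.A₃_swap, h.rel t ht, add_comm (T.ξ t • T.A₂ t)]; rfl
  contDiff_ξ := h.contDiff_η
  contDiff_η := h.contDiff_ξ
  contDiff_ζ := h.contDiff_ζ
  ζ_pos := h.ζ_pos
  rad_b := h.rad_c
  rad_c := h.rad_b
  unit_b := h.unit_c
  unit_c := h.unit_b
  bc := by rw [lie_comm]; exact h.bc
  orth_b := h.orth_c
  orth_c := h.orth_b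
  disj_b t ht u hu u' hu' := by rw [h.A₃_swap]; exact h.disj_c t ht u hu u' hu'
  disj_c t ht u hu u' hu' := by rw [h.A₃_swap]; exact h.disj_b t ht u hu u' hu'

theorem isPt₁ (h : T.IsTube) (t : ℝ) : IsPt (T.A₁ t) := h.arc.isPt_circArc t
theorem isPt₂ (h : T.IsTube) (t : ℝ) : IsPt (T.A₂ t) := isPt_reflect (h.isPt₁ t) h.rad_m h.pos_m
theorem isPt₄ (h : T.IsTube) (t : ℝ) : IsPt (T.A₄ t) := isPt_reflect (h.isPt₁ t) h.rad_n h.pos_n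
theorem isPt₃ (h : T.IsTube) (t : ℝ) : IsPt (T.A₃ t) := isPt_reflect (h.isPt₂ t) h.rad_n' h.pos_n'

theorem neg₁₂ (h : T.IsTube) {t : ℝ} (ht : t ∈ I) : lie (T.A₁ t) (T.A₂ t) < 0 :=
  (h.isPt₁ t).lie_reflect_neg h.pos_m (h.ne_m t ht)

theorem neg₁₄ (h : T.IsTube) {t : ℝ} (ht : t ∈ I) : lie (T.A₁ t) (T.A₄ t) < 0 :=
  (h.isPt₁ t).lie_reflect_neg h.pos_n (h.ne_n t ht)

theorem neg₂₃ (h : T.IsTube) {t : ℝ} (ht : t ∈ I) : lie (T.A₂ t) (T.A₃ t) < 0 :=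
  (h.isPt₂ t).lie_reflect_neg h.pos_n' (h.ne_n' t ht)

theorem neg₄₃ (h : T.IsTube) {t : ℝ} (ht : t ∈ I) : lie (T.A₄ t) (T.A₃ t) < 0 := by
  rw [← h.A₃_swap]; exact h.swap.neg₂₃ ht

/-- With `x, y, z` for `ξ, η, ζ` and `p, q, s` for the products of the pairs 12, 14, 24, isotropy of
`A₃` reads `x (y s - z p) = z y q`, and `y s - z p = ⟨A₂, A₃⟩ < 0`. If `x ≤ 0`, the first relation
forces `y ≤ 0`, and then `y s - z p > 0`. -/
theorem ξ_pos (h : T.IsTube) {t : ℝ} (ht : t ∈ I) : 0 < T.ξ t := by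
  have h1 := h.neg₁₂ ht
  have h2 := h.neg₁₄ ht
  have h3 := h.neg₂₃ ht
  have h4 := (h.isPt₂ t).lie_nonpos (h.isPt₄ t)
  have h5 := (h.isPt₃ t).null
  have hz := h.ζ_pos t ht
  rw [h.rel t ht] at h3 h5
  simp only [lie_add_left, lie_add_right, lie_sub_left, lie_sub_right, lie_smul_left,
    lie_smul_right, (h.isPt₁ t).null, (h.isPt₂ t).null, (h.isPt₄ t).null,
    lie_comm (T.A₂ t) (T.A₁ t), lie_comm (T.A₄ t) (T.A₁ t), lie_comm (T.A₄ t) (T.A₂ t)] at h3 h5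
  generalize lie (T.A₁ t) (T.A₂ t) = p at *
  generalize lie (T.A₁ t) (T.A₄ t) = q at *
  generalize lie (T.A₂ t) (T.A₄ t) = s at *
  generalize T.ξ t = x at *
  generalize T.η t = y at *
  generalize T.ζ t = z at *
  by_contra hx
  push Not at hx
  have e1 : x * (y * s - z * p) = z * y * q := by linarith
  have e2 : y * s - z * p < 0 := by linarith
  have e3 : y ≤ 0 := by
    by_contra hy
    push Not at hy
    have : z * y * q < 0 := mul_neg_of_pos_of_neg (mul_pos hz hy) h2
    have : 0 ≤ x * (y * s - z * p) := mul_nonneg_of_nonpos_of_nonpos hx e2.le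
    linarith
  have e4 : 0 ≤ y * s := mul_nonneg_of_nonpos_of_nonpos e3 h4
  have e5 : z * p < 0 := mul_neg_of_pos_of_neg hz h1
  linarith

theorem η_pos (h : T.IsTube) {t : ℝ} (ht : t ∈ I) : 0 < T.η t := h.swap.ξ_pos ht

theorem arc₁₂b (h : T.IsTube) {t : ℝ} (ht : t ∈ I) : ArcData (T.A₁ t) (T.A₂ t) T.b :=
  ⟨h.isPt₁ t, h.isPt₂ t, h.neg₁₂ ht, h.rad_b, h.orth_b t ht, h.unit_b⟩

theorem arc₁₂c (h : T.IsTube) {t : ℝ} (ht : t ∈ I) : ArcData (T.A₁ t) (T.A₂ t) T.c :=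
  ⟨h.isPt₁ t, h.isPt₂ t, h.neg₁₂ ht, h.rad_c, h.orth_c t ht, h.unit_c⟩

theorem arc₁₄b (h : T.IsTube) {t : ℝ} (ht : t ∈ I) : ArcData (T.A₁ t) (T.A₄ t) T.b :=
  h.swap.arc₁₂c ht

theorem arc₁₄c (h : T.IsTube) {t : ℝ} (ht : t ∈ I) : ArcData (T.A₁ t) (T.A₄ t) T.c :=
  h.swap.arc₁₂b ht

theorem arc₄₃b (h : T.IsTube) {t : ℝ} (ht : t ∈ I) :
    ArcData (T.A₄ t) (T.A₃ t) (reflect T.n T.b) := by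
  refine ⟨h.isPt₄ t, h.isPt₃ t, h.neg₄₃ ht, by rw [rad_reflect h.rad_n, h.rad_b], ?_, ?_⟩
  · rw [A₄, lie_reflect h.pos_n.ne', h.orth_b t ht]
  · rw [lie_reflect h.pos_n.ne', h.unit_b]

theorem vertex₂ (t : ℝ) : (T.data t).P + (T.data t).Y = (T.ξ t / T.ζ t) • T.A₂ t :=
  add_sub_cancel _ _

theorem vertex₄ (t : ℝ) : (T.data t).P + (T.data t).Z = (T.η t / T.ζ t) • T.A₄ t :=
  add_sub_cancel _ _

theorem combination (h : T.IsTube) {t : ℝ} (ht : t ∈ I) :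
    (T.ξ t / T.ζ t) • T.A₂ t + (T.η t / T.ζ t) • T.A₄ t - T.A₁ t = (T.ζ t)⁻¹ • T.A₃ t := by
  have hz := (h.ζ_pos t ht).ne'
  rw [h.rel t ht, smul_sub, smul_add, smul_smul, smul_smul, smul_smul, inv_mul_cancel₀ hz,
    one_smul, div_eq_inv_mul, div_eq_inv_mul]

theorem vertex₃ (h : T.IsTube) {t : ℝ} (ht : t ∈ I) :
    (T.data t).P + (T.data t).Y + (T.data t).Z = (T.ζ t)⁻¹ • T.A₃ t := by
  rw [vertex₂, ← h.combination ht]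
  change _ + ((T.η t / T.ζ t) • T.A₄ t - T.A₁ t) = _
  abel

theorem isPre (h : T.IsTube) {t : ℝ} (ht : t ∈ I) : (T.data t).IsPre :=
  isPre_quadData (h.arc₁₂b ht) (h.arc₁₂c ht) (h.arc₁₄b ht) h.bc
    (div_pos (h.ξ_pos ht) (h.ζ_pos t ht)) (div_pos (h.η_pos ht) (h.ζ_pos t ht)) (h.isPt₃ t).null
    (h.combination ht)

theorem unitDir_eq (h : T.IsTube) {t : ℝ} (ht : t ∈ I) :
    unitDir (T.data t).P (T.data t).Y (T.data t).B = arcDir (T.A₁ t) (T.A₄ t) T.b :=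
  unitDir_quad (h.arc₁₂b ht) (div_pos (h.ξ_pos ht) (h.ζ_pos t ht))

theorem side_zero (h : T.IsTube) {t : ℝ} (ht : t ∈ I) : ∃ φ, IsReparam φ ∧ ∀ u ∈ I,
    (T.data t).std u 0 = toSpace (circArc (T.A₁ t) (T.A₂ t) T.b (φ u)) := by
  obtain ⟨φ, hφ, e⟩ := (h.arc₁₂b ht).toSpace_reparam one_pos
    (div_pos (h.ξ_pos ht) (h.ζ_pos t ht)) (one_smul ℝ (T.A₁ t)).symm rfl
    (show arcDir (T.A₁ t) (T.A₄ t) T.b = T.b +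
      (-(lie T.b (T.A₄ t) / lie (T.A₁ t) (T.A₄ t))) • T.A₁ t by rw [arcDir]; module)
  refine ⟨φ, hφ, fun u hu => ?_⟩
  rw [← e u hu, PatchData.std, (h.isPre ht).F_u_zero_eq, h.unitDir_eq ht, vertex₂]; rfl

theorem side_one (h : T.IsTube) {t : ℝ} (ht : t ∈ I) : ∃ φ, IsReparam φ ∧ ∀ u ∈ I,
    (T.data t).std u 1 = toSpace (circArc (T.A₄ t) (T.A₃ t) (reflect T.n T.b) (φ u)) := by
  obtain ⟨s, hs⟩ := arcDir_reflect h.pos_n (h.ne_n t ht) (h.isPt₁ t) (h.orth_b t ht)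
  obtain ⟨φ, hφ, e⟩ := (h.arc₄₃b ht).toSpace_reparam (div_pos (h.η_pos ht) (h.ζ_pos t ht))
    (inv_pos.2 (h.ζ_pos t ht)) rfl rfl hs
  refine ⟨φ, hφ, fun u hu => ?_⟩
  rw [← e u hu, PatchData.std, (h.isPre ht).F_u_one_eq, h.unitDir_eq ht, vertex₄, h.vertex₃ ht]; rfl

/-- At a zero of the weight the sides `v = 0` and `v = 1` would meet, but they lie on the disjoint
arcs of `disj_b`. -/
theorem r_pos (h : T.IsTube) {t : ℝ} (ht : t ∈ I) : ∀ u ∈ I, 0 < (T.data t).r u := by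
  obtain ⟨φ, hφ, e⟩ := h.side_zero ht
  obtain ⟨ψ, hψ, f⟩ := h.side_one ht
  refine PatchData.r_pos_of_ne fun u hu he => h.disj_b t ht _ (hφ.mem hu) _ (hψ.mem hu) ?_
  rw [← e u hu, ← f u hu]; exact he

theorem isGood (h : T.IsTube) {t : ℝ} (ht : t ∈ I) : (T.data t).IsGood :=
  ⟨h.isPre ht, h.r_pos ht, h.swap.r_pos ht⟩

theorem side_zero' (h : T.IsTube) {t : ℝ} (ht : t ∈ I) : ∃ φ, IsReparam φ ∧ ∀ v ∈ I,
    (T.data t).std 0 v = toSpace (circArc (T.A₁ t) (T.A₄ t) T.c (φ v)) := by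
  obtain ⟨φ, hφ, e⟩ := h.swap.side_zero ht
  exact ⟨φ, hφ, fun v hv => by rw [← PatchData.std_swap, ← data_swap, e v hv]; rfl⟩

theorem side_one' (h : T.IsTube) {t : ℝ} (ht : t ∈ I) : ∃ φ, IsReparam φ ∧ ∀ v ∈ I,
    (T.data t).std 1 v = toSpace (circArc (T.A₂ t) (T.A₃ t) (reflect T.m T.c) (φ v)) := by
  obtain ⟨φ, hφ, e⟩ := h.swap.side_one ht
  exact ⟨φ, hφ, fun v hv => by rw [← PatchData.std_swap, ← data_swap, e v hv, h.A₃_swap]; rfl⟩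

theorem std_eq (h : T.IsTube) {t : ℝ} (ht : t ∈ I) {D : PatchData} (hD : D.IsPre)
    {c₁ c₂ c₃ c₄ x y : ℝ} (hc : 0 < c₁) (e₁ : D.P = c₁ • T.A₁ t) (e₂ : D.P + D.Y = c₂ • T.A₂ t)
    (e₄ : D.P + D.Z = c₄ • T.A₄ t) (e₃ : D.P + D.Y + D.Z = c₃ • T.A₃ t)
    (eb : unitDir D.P D.Y D.B = T.b + x • T.A₁ t) (ec : unitDir D.P D.Z D.C = T.c + y • T.A₁ t)
    (u v : ℝ) : D.std u v = (T.data t).std u v := by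
  have aux : ∀ {a c : ℝ} (A : LieVec), 0 < a → c • A = (c / a) • a • A := fun {a c} A ha => by
    rw [smul_smul, div_mul_cancel₀ _ ha.ne']
  refine (h.isPre ht).std_eq hD hc e₁ (x := c₂ / (T.ξ t / T.ζ t))
    (y := c₄ / (T.η t / T.ζ t)) (z := c₃ / (T.ζ t)⁻¹) ?_ ?_ ?_
    (ξ := x + lie T.b (T.A₄ t) / lie (T.A₁ t) (T.A₄ t))
    (ξ' := y + lie T.c (T.A₂ t) / lie (T.A₁ t) (T.A₂ t)) ?_ ?_ u v
  · rw [e₂, vertex₂, ← aux _ (div_pos (h.ξ_pos ht) (h.ζ_pos t ht))]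
  · rw [e₄, vertex₄, ← aux _ (div_pos (h.η_pos ht) (h.ζ_pos t ht))]
  · rw [e₃, h.vertex₃ ht, ← aux _ (inv_pos.2 (h.ζ_pos t ht))]
  · rw [eb, h.unitDir_eq ht, arcDir]
    change _ = _ + _ • T.A₁ t
    module
  · have : unitDir (T.data t).P (T.data t).Z (T.data t).C = arcDir (T.A₁ t) (T.A₂ t) T.c :=
      h.swap.unitDir_eq ht
    rw [ec, this, arcDir]
    change _ = _ + _ • T.A₁ t
    module

end IsTube

end Tube

/-! ### Velocities of curves of points -/

/-- The square of `f x - f s` is `-2 * lie (f s) (f x)`, so dividing by `(x - s) ^ 2` and passing to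
the limit yields the square of the velocity. -/
theorem lie_deriv_self {f : ℝ → LieVec} {v : LieVec} {s : ℝ} (hf : HasDerivAt f v s) {g : ℝ → ℝ}
    (hg : ContinuousAt g s) (null : ∀ x, lie (f x) (f x) = 0)
    (hfg : ∀ x, lie (f s) (f x) = g x * (x - s) ^ 2) : lie v v = -2 * g s := by
  have h1 := hasDerivAt_iff_tendsto_slope.1 hf
  have h0 : Continuous fun w : LieVec => lie w w :=
    continuous_lie.comp (continuous_id.prodMk continuous_id)
  have h2 : Tendsto (fun x => lie (slope f s x) (slope f s x)) (𝓝[≠] s) (𝓝 (lie v v)) :=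
    (h0.tendsto v).comp h1
  have h3 : Tendsto (fun x => -2 * g x) (𝓝[≠] s) (𝓝 (-2 * g s)) :=
    (hg.tendsto.const_mul (-2)).mono_left nhdsWithin_le_nhds
  refine tendsto_nhds_unique h2 (h3.congr' ?_)
  filter_upwards [eventually_mem_nhdsWithin] with x hx
  have hx' : x - s ≠ 0 := sub_ne_zero.2 hx
  rw [slope, vsub_eq_sub]
  simp only [lie_smul_left, lie_smul_right, lie_sub_left, lie_sub_right, null, lie_comm (f x) (f s),
    hfg]
  field_simp; ring

theorem ArcData.contDiff_circArc (P Q b : LieVec) : ContDiff ℝ ∞ (circArc P Q b) := by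
  unfold circArc; fun_prop

theorem contDiff_normalize {E : Type*} [NormedAddCommGroup E] [NormedSpace ℝ E] {f : E → LieVec}
    {s : Set E} (hf : ContDiffOn ℝ ∞ f s) (h : ∀ x ∈ s, IsPt (f x)) :
    ContDiffOn ℝ ∞ (fun x => pt (toSpace (f x))) s := by
  refine ContDiffOn.congr (f := fun x => (tr (f x))⁻¹ • f x)
    (((contDiff_tr.comp_contDiffOn hf).inv fun x hx => (h x hx).pos.ne').smul hf)
    fun x hx => pt_toSpace (h x hx)

theorem ArcData.hasDerivAt {P Q b : LieVec} (h : ArcData P Q b) (t : ℝ) :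
    ∃ v, HasDerivAt (fun t => pt (toSpace (circArc P Q b t))) v t ∧ v ≠ 0 := by
  have h1 : ContDiff ℝ ∞ (fun t => pt (toSpace (circArc P Q b t))) :=
    contDiffOn_univ.1 (contDiff_normalize (contDiff_circArc P Q b).contDiffOn
      fun t _ => h.isPt_circArc t)
  have h2 := (h1.differentiable (by simp) t).hasDerivAt
  refine ⟨_, h2, fun h0 => ?_⟩
  have h3 := lie_deriv_self h2
    (g := fun x => (tr (circArc P Q b t))⁻¹ * (tr (circArc P Q b x))⁻¹ * lie P Q) ?_ ?_ ?_
  · rw [h0, lie_zero_left] at h3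
    have := (h.isPt_circArc t).pos
    have h4 : (tr (circArc P Q b t))⁻¹ * (tr (circArc P Q b t))⁻¹ * lie P Q < 0 :=
      mul_neg_of_pos_of_neg (by positivity) h.neg
    linarith
  · have : ContinuousAt (fun x => tr (circArc P Q b x)) t :=
      (continuous_tr.comp (contDiff_circArc P Q b).continuous).continuousAt
    exact (continuousAt_const.mul (this.inv₀ (h.isPt_circArc t).pos.ne')).mul continuousAt_const
  · exact fun x => (isPt_pt _).null
  · intro x
    rw [pt_toSpace (h.isPt_circArc _), pt_toSpace (h.isPt_circArc _), lie_smul_left, lie_smul_right,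
      h.lie_circArc]
    ring

/-- The parameter of a point of a circular arc, for any regular parametrization. -/
theorem ArcData.isReparam_of_curve {P Q b : LieVec} (h : ArcData P Q b) {X : ℝ → LieVec}
    (hX : DifferentiableOn ℝ X I) (hX' : ∀ t ∈ I, derivWithin X I t ≠ 0) {θ : ℝ → ℝ}
    (e : ∀ t ∈ I, X t = pt (toSpace (circArc P Q b (θ t)))) (θ0 : θ 0 = 0) (θ1 : θ 1 = 1) :
    IsReparam θ := by
  have hPQ := h.neg.ne
  have hκ := h.sqrt_pos.ne'
  set W := arcDir P Q b with hW
  set κ := √(-lie P Q / 2) with hκd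
  have l1 : ∀ u, lie P (circArc P Q b u) = u ^ 2 * lie P Q := fun u => by
    have := h.lie_circArc 0 u
    rw [circArc_zero] at this
    rw [this]; ring
  have l2 : ∀ u, lie Q (circArc P Q b u) = (1 - u) ^ 2 * lie P Q := fun u => by
    have := h.lie_circArc 1 u
    rw [circArc_one] at this
    rw [this]; ring
  have w1 : lie P W = 0 := h.lie_P_arcDir
  have w2 : lie Q W = 0 := h.lie_Q_arcDir
  have w3 : lie W W = 1 := h.lie_arcDir
  have l3 : ∀ u, lie W (circArc P Q b u) = 2 * u * (1 - u) * κ := fun u => by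
    rw [lie_comm, circArc]
    simp only [lie_add_left, lie_smul_left, ← hW, ← hκd, w1, w2, w3]
    ring
  -- The linear functionals `N` and `M` take the values `u` and `1` on the arc at `u`; their
  -- quotient is independent of the scaling and recovers the parameter differentiably.
  obtain ⟨N, hN⟩ : ∃ N : LieVec → ℝ, N = fun x => lie P x / lie P Q + lie W x / (2 * κ) := ⟨_, rfl⟩
  obtain ⟨M, hM⟩ : ∃ M : LieVec → ℝ,
    M = fun x => lie P x / lie P Q + lie W x / κ + lie Q x / lie P Q := ⟨_, rfl⟩
  have hlie : ∀ v : LieVec, Differentiable ℝ fun x => lie v x := fun v =>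
    (contDiff_lie.comp (contDiff_const.prodMk contDiff_id)).differentiable (by simp)
  have hdiv : ∀ (v : LieVec) (c : ℝ), Differentiable ℝ fun x => lie v x / c := fun v c =>
    by simpa only [div_eq_mul_inv] using (hlie v).mul_const c⁻¹
  have dN : Differentiable ℝ N := by
    rw [hN]; exact (hdiv P _).add (hdiv W _)
  have dM : Differentiable ℝ M := by
    rw [hM]; exact ((hdiv P _).add (hdiv W _)).add (hdiv Q _)
  have eN : ∀ (k u : ℝ), N (k • circArc P Q b u) = k * u := fun k u => by
    rw [hN]; simp only [lie_smul_right, l1, l3]; field_simp; ring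
  have eM : ∀ (k u : ℝ), M (k • circArc P Q b u) = k := fun k u => by
    rw [hM]; simp only [lie_smul_right, l1, l2, l3]; field_simp; ring
  have hXe : ∀ t ∈ I, X t = (tr (circArc P Q b (θ t)))⁻¹ • circArc P Q b (θ t) := fun t ht => by
    rw [e t ht, pt_toSpace (h.isPt_circArc _)]
  have hk : ∀ t, (tr (circArc P Q b (θ t)))⁻¹ ≠ 0 := fun t => inv_ne_zero (h.isPt_circArc _).pos.ne'
  have hθ : DifferentiableOn ℝ θ I := by
    refine DifferentiableOn.congr (f := fun t => N (X t) / M (X t)) ?_ fun t ht => ?_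
    · refine (dN.comp_differentiableOn hX).div (dM.comp_differentiableOn hX) fun t ht => ?_
      simp only [hXe t ht, eM]; exact hk t
    · rw [hXe t ht, eN, eM, mul_div_cancel_left₀ _ (hk t)]
  have hinj : ∀ t₁ ∈ I, ∀ t₂ ∈ I, t₁ < t₂ → θ t₁ ≠ θ t₂ := by
    intro t₁ h₁ t₂ h₂ hlt he
    have hsub : Icc t₁ t₂ ⊆ I := Icc_subset_Icc h₁.1 h₂.2
    -- If `θ` took a value twice, Rolle's theorem would give a zero of its derivative and hence of
    -- the velocity of `X`.
    obtain ⟨c, hc, hc0⟩ := exists_deriv_eq_zero hlt (hθ.continuousOn.mono hsub) he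
    have hcI : c ∈ I := hsub ⟨hc.1.le, hc.2.le⟩
    have hnhds : I ∈ 𝓝 c := Icc_mem_nhds (h₁.1.trans_lt hc.1) (hc.2.trans_le h₂.2)
    have hd := (hθ.differentiableAt hnhds).hasDerivAt
    rw [hc0] at hd
    obtain ⟨v, hv, -⟩ := h.hasDerivAt (θ c)
    have h3 := hv.scomp c hd
    rw [zero_smul] at h3
    have h4 : HasDerivAt X 0 c := h3.congr_of_eventuallyEq (by
      filter_upwards [hnhds] with t ht using e t ht)
    exact hX' c hcI (h4.hasDerivWithinAt.derivWithin (uniqueDiffOn_Icc zero_lt_one c hcI))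
  refine isReparam_of_injOn hθ.continuousOn (fun t₁ h₁ t₂ h₂ he => ?_) θ0 θ1
  rcases lt_trichotomy t₁ t₂ with hlt | rfl | hlt
  · exact absurd he (hinj _ h₁ _ h₂ hlt)
  · rfl
  · exact absurd he.symm (hinj _ h₂ _ h₁ hlt)

/-! ### Patches are immersed -/

theorem uniqueDiffOn_square : UniqueDiffOn ℝ (I ×ˢ I) :=
  (uniqueDiffOn_Icc zero_lt_one).prod (uniqueDiffOn_Icc zero_lt_one)

theorem PatchData.contDiff_F (D : PatchData) : ContDiff ℝ ∞ fun p : ℝ × ℝ => D.F p.1 p.2 := by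
  unfold F r q y z weight numer; fun_prop

/-- Along the line `p + s • d`, `lie_F` gives products of the form `g(s) s²`, where `g(0)` is
negative definite in `d`. By `lie_deriv_self` the square of the derivative in direction `d` is `-2
g(0)`, so it vanishes only for `d = 0`. -/
theorem PatchData.IsGood.injective_fderivWithin {D : PatchData} (h : D.IsGood) {p : ℝ × ℝ}
    (hp : p ∈ I ×ˢ I) :
    Function.Injective (fderivWithin ℝ (fun q : ℝ × ℝ => pt (D.std q.1 q.2)) (I ×ˢ I) p) := by
  set G : ℝ × ℝ → LieVec := fun q => (tr (D.F q.1 q.2))⁻¹ • D.F q.1 q.2 with hG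
  have hFp := h.isPt_F hp.1 hp.2
  have hGd : DifferentiableAt ℝ G p := by
    have h1 : ContDiffAt ℝ ∞ (fun q : ℝ × ℝ => D.F q.1 q.2) p := D.contDiff_F.contDiffAt
    have h2 : ContDiffAt ℝ ∞ (fun q : ℝ × ℝ => tr (D.F q.1 q.2)) p :=
      (contDiff_tr.comp D.contDiff_F).contDiffAt
    exact ((h2.inv hFp.pos.ne').smul h1).differentiableAt (by simp)
  have hcongr : fderivWithin ℝ (fun q : ℝ × ℝ => pt (D.std q.1 q.2)) (I ×ˢ I) p = fderiv ℝ G p := by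
    rw [← hGd.fderivWithin (uniqueDiffOn_square p hp)]
    refine fderivWithin_congr (fun q hq => ?_) ?_
    · rw [std, pt_toSpace (h.isPt_F hq.1 hq.2)]
    · rw [std, pt_toSpace hFp]
  rw [hcongr, injective_iff_map_eq_zero]
  intro d hd
  have hline : HasDerivAt (fun s : ℝ => p + s • d) d 0 := by
    simpa using ((hasDerivAt_id (0 : ℝ)).smul_const d).const_add p
  have hf : HasDerivAt (fun s : ℝ => G (p + s • d)) (fderiv ℝ G p d) 0 := by
    have h1 : HasFDerivAt G (fderiv ℝ G p) (p + (0 : ℝ) • d) := by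
      rw [zero_smul, add_zero]; exact hGd.hasFDerivAt
    exact h1.comp_hasDerivAt 0 hline
  have hlie := lie_deriv_self hf
    (g := fun s => (tr (D.F p.1 p.2))⁻¹ * (tr (D.F (p + s • d).1 (p + s • d).2))⁻¹ *
      (D.q p.2 * D.q (p + s • d).2 * lie D.P D.Y * d.1 ^ 2 +
        D.r p.1 * D.r (p + s • d).1 * lie D.P D.Z * d.2 ^ 2)) ?_ ?_ ?_
  · rw [hd, lie_zero_left] at hlie
    simp only [zero_smul, add_zero] at hlie
    have h1 := h.r_pos _ hp.1
    have h2 := h.q_pos _ hp.2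
    have h3 := h.arc₁.neg
    have h4 := h.arc₂.neg
    have h5 := hFp.pos
    have h6 : D.q p.2 * D.q p.2 * -lie D.P D.Y * d.1 ^ 2 +
        D.r p.1 * D.r p.1 * -lie D.P D.Z * d.2 ^ 2 = 0 := by
      have h7 : (tr (D.F p.1 p.2))⁻¹ * (tr (D.F p.1 p.2))⁻¹ ≠ 0 := by positivity
      have h8 := (mul_eq_zero.1 ((mul_eq_zero.1 hlie.symm).resolve_left (by norm_num))).resolve_left
        h7
      linarith
    have h9 : 0 < D.q p.2 * D.q p.2 * -lie D.P D.Y := mul_pos (mul_pos h2 h2) (by linarith)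
    have h10 : 0 < D.r p.1 * D.r p.1 * -lie D.P D.Z := mul_pos (mul_pos h1 h1) (by linarith)
    have h11 := mul_nonneg h9.le (sq_nonneg d.1)
    have h12 := mul_nonneg h10.le (sq_nonneg d.2)
    ext
    · have : d.1 ^ 2 = 0 := (mul_eq_zero.1 (by linarith)).resolve_left h9.ne'
      simpa using this
    · have : d.2 ^ 2 = 0 := (mul_eq_zero.1 (by linarith)).resolve_left h10.ne'
      simpa using this
  · have h1 : ContinuousAt (fun s : ℝ => tr (D.F (p + s • d).1 (p + s • d).2)) 0 := by
      have h2 : Continuous fun s : ℝ => p + s • d := by fun_prop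
      exact (continuous_tr.comp (D.contDiff_F.continuous.comp h2)).continuousAt
    have h3 : ContinuousAt (fun s : ℝ => (tr (D.F (p + s • d).1 (p + s • d).2))⁻¹) 0 :=
      h1.inv₀ (by simpa using hFp.pos.ne')
    have h4 : Continuous D.r := continuous_weight _ _ _
    have h5 : Continuous D.q := continuous_weight _ _ _
    have h6 : Continuous fun s : ℝ => D.q p.2 * D.q (p + s • d).2 * lie D.P D.Y * d.1 ^ 2 +
        D.r p.1 * D.r (p + s • d).1 * lie D.P D.Z * d.2 ^ 2 := by fun_prop
    exact (continuousAt_const.mul h3).mul h6.continuousAt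
  · intro s
    simp only [hG, lie_smul_left, lie_smul_right, h.lie_F]; ring
  · intro s
    simp only [hG, zero_smul, add_zero, lie_smul_left, lie_smul_right, h.lie_F, Prod.fst_add,
      Prod.snd_add, Prod.smul_fst, Prod.smul_snd, smul_eq_mul]
    ring

/-! ### Smoothness of the family -/

section

variable {E : Type*} [NormedAddCommGroup E] [NormedSpace ℝ E] {s : Set E} {f g k : E → LieVec}
  {u : E → ℝ}

theorem contDiffOn_lie (hf : ContDiffOn ℝ ∞ f s) (hg : ContDiffOn ℝ ∞ g s) :
    ContDiffOn ℝ ∞ (fun x => lie (f x) (g x)) s :=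
  contDiff_lie.comp_contDiffOn (hf.prodMk hg)

theorem contDiffOn_reflect (n : LieVec) (hf : ContDiffOn ℝ ∞ f s) :
    ContDiffOn ℝ ∞ (fun x => reflect n (f x)) s :=
  (reflect n).toContinuousLinearMap.contDiff.comp_contDiffOn hf

theorem contDiffOn_arcDir (hf : ContDiffOn ℝ ∞ f s) (hg : ContDiffOn ℝ ∞ g s) (b : LieVec)
    (h : ∀ x ∈ s, lie (f x) (g x) ≠ 0) : ContDiffOn ℝ ∞ (fun x => arcDir (f x) (g x) b) s :=
  contDiffOn_const.sub
    (((contDiffOn_lie contDiffOn_const hg).div (contDiffOn_lie hf hg) h).smul hf)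

theorem contDiffOn_weight (hf : ContDiffOn ℝ ∞ f s) (hg : ContDiffOn ℝ ∞ g s)
    (hk : ContDiffOn ℝ ∞ k s) (hu : ContDiffOn ℝ ∞ u s) (h : ∀ x ∈ s, lie (f x) (g x) ≠ 0) :
    ContDiffOn ℝ ∞ (fun x => weight (f x) (g x) (k x) (u x)) s := by
  have h1 : ContDiffOn ℝ ∞ (fun x => lie (k x) (g x) / lie (f x) (g x)) s :=
    (contDiffOn_lie hk hg).div (contDiffOn_lie hf hg) h
  have h2 : ContDiffOn ℝ ∞ (fun x => 1 - u x) s := contDiffOn_const.sub hu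
  exact ((h2.pow 2).add (hu.pow 2)).sub (((contDiffOn_const.mul hu).mul h2).mul h1)

theorem contDiffOn_numer (hg : ContDiffOn ℝ ∞ g s) (hk : ContDiffOn ℝ ∞ k s)
    (hu : ContDiffOn ℝ ∞ u s) : ContDiffOn ℝ ∞ (fun x => numer (g x) (k x) (u x)) s := by
  have h2 : ContDiffOn ℝ ∞ (fun x => 1 - u x) s := contDiffOn_const.sub hu
  exact ((hu.pow 2).smul hg).add (((contDiffOn_const.mul hu).mul h2).smul hk)

end

namespace Tube.IsTube

variable {T : Tube}

theorem contDiffOn_A₁ (_ : T.IsTube) : ContDiffOn ℝ ∞ T.A₁ I :=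
  (ArcData.contDiff_circArc _ _ _).contDiffOn

theorem contDiffOn_A₂ (h : T.IsTube) : ContDiffOn ℝ ∞ T.A₂ I := contDiffOn_reflect _ h.contDiffOn_A₁

theorem contDiffOn_A₄ (h : T.IsTube) : ContDiffOn ℝ ∞ T.A₄ I := contDiffOn_reflect _ h.contDiffOn_A₁

theorem contDiffOn_ratio (h : T.IsTube) : ContDiffOn ℝ ∞ (fun t => T.ξ t / T.ζ t) I :=
  h.contDiff_ξ.div h.contDiff_ζ fun t ht => (h.ζ_pos t ht).ne'

theorem contDiffOn_Y (h : T.IsTube) : ContDiffOn ℝ ∞ (fun t => (T.data t).Y) I :=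
  (h.contDiffOn_ratio.smul h.contDiffOn_A₂).sub h.contDiffOn_A₁

theorem contDiffOn_B (h : T.IsTube) : ContDiffOn ℝ ∞ (fun t => (T.data t).B) I := by
  refine ContDiffOn.smul (ContDiffOn.sqrt (((h.contDiffOn_ratio.mul
    (contDiffOn_lie h.contDiffOn_A₁ h.contDiffOn_A₂)).neg).div_const 2) fun t ht => ?_)
    (contDiffOn_arcDir h.contDiffOn_A₁ h.contDiffOn_A₄ _ fun t ht => (h.neg₁₄ ht).ne)
  have := mul_neg_of_pos_of_neg (div_pos (h.ξ_pos ht) (h.ζ_pos t ht)) (h.neg₁₂ ht)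
  exact div_ne_zero (neg_ne_zero.2 this.ne) two_ne_zero

theorem contDiffOn_std (h : T.IsTube) : ContDiffOn ℝ ∞
    (fun p : ℝ × ℝ × ℝ => pt ((T.data p.1).std p.2.1 p.2.2)) (I ×ˢ I ×ˢ I) := by
  have lift : ∀ {f : ℝ → LieVec}, ContDiffOn ℝ ∞ f I →
      ContDiffOn ℝ ∞ (fun p : ℝ × ℝ × ℝ => f p.1) (I ×ˢ I ×ˢ I) := fun hf =>
    hf.comp contDiff_fst.contDiffOn fun p hp => hp.1
  have hu : ContDiffOn ℝ ∞ (fun p : ℝ × ℝ × ℝ => p.2.1) (I ×ˢ I ×ˢ I) := by fun_prop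
  have hv : ContDiffOn ℝ ∞ (fun p : ℝ × ℝ × ℝ => p.2.2) (I ×ˢ I ×ˢ I) := by fun_prop
  have hP := lift h.contDiffOn_A₁
  have hY := lift h.contDiffOn_Y
  have hB := lift h.contDiffOn_B
  have hZ := lift h.swap.contDiffOn_Y
  have hC := lift h.swap.contDiffOn_B
  have hr := contDiffOn_weight hP hY hB hu fun p hp => (h.isPre hp.1).arc₁.neg.ne
  have hq := contDiffOn_weight hP hZ hC hv fun p hp => (h.isPre hp.1).arc₂.neg.ne
  have hy := contDiffOn_numer hY hB hu
  have hz := contDiffOn_numer hZ hC hv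
  exact contDiff_normalize
    (((hr.mul hq).smul hP).add (hq.smul hy) |>.add (hr.smul hz)) fun p hp =>
      (h.isGood hp.1).isPt_F hp.2.1 hp.2.2

end Tube.IsTube

/-! ### Vertices of patches -/

theorem arcData_lift {x y t : E3} (hxy : x ≠ y) (ht : ‖t‖ = 1) :
    ArcData (lift x) (lift y) (liftDir x t) where
  ptP := isPt_lift x
  ptQ := isPt_lift y
  neg := by
    have : 0 < ‖x - y‖ := norm_pos_iff.2 (sub_ne_zero.2 hxy)
    rw [lie_lift]
    have : 0 < ‖x - y‖ ^ 2 := by positivity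
    linarith
  rad := rfl
  Pb := by rw [lie_lift_liftDir, sub_self, inner_zero_left]
  unit := by rw [lie_liftDir, ht]; norm_num

/-- The side of a patch opposite to a circular arc from which it is obtained by a reflection. -/
theorem IsPatch.exists_reflection_of_reflect {g : ℝ → ℝ → Space} (hg : IsPatch g)
    {x₀ x₁ y₀ : E3} (hxy : x₀ ≠ y₀) {e n b : LieVec}
    (hA : ArcData (lift x₀) (lift x₁) e) (hr : rad n = 0) (hn : 0 < lie n n)
    (h₀ : toSpace (reflect n (lift x₀)) = y₀) (g00 : g 0 0 = y₀)
    (g10 : g 1 0 = toSpace (reflect n (lift x₁))) {t₁ t₂ : E3}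
    (ht₁ : HasDirection (fun u => g u 0) t₁) (he : refl x₀ y₀ (dir (lift x₀) e) = t₁)
    (ht₂ : HasDirection (fun v => g 0 v) t₂) (hb : refl x₀ y₀ (dir (lift x₀) b) = t₂)
    (rb : rad b = 0) (ob : ∀ t ∈ I, lie (circArc (lift x₀) (lift x₁) e t) b = 0) :
    ∃ (m : LieVec) (φ : ℝ → ℝ), rad m = 0 ∧ 0 < lie m m ∧ IsReparam φ ∧
      (∀ t ∈ I, lie m (reflect n (circArc (lift x₀) (lift x₁) e t)) ≠ 0) ∧
      ∀ t ∈ I, ∃ ψ, IsReparam ψ ∧ ∀ u ∈ I, g (φ t) u =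
        toSpace (circArc (reflect n (circArc (lift x₀) (lift x₁) e t))
          (reflect m (reflect n (circArc (lift x₀) (lift x₁) e t))) (reflect n b) (ψ u)) := by
  have hA' := hA.reflect hr hn
  obtain ⟨c, hc, hc'⟩ := exists_smul_of_toSpace_eq (isPt_lift y₀) hA'.ptP
    (by rw [h₀, toSpace_lift])
  have hP0 : (reflect n (lift x₀)).2.1 ≠ 0 := by
    rw [hc']; exact mul_ne_zero hc.ne' one_ne_zero
  have hdir : ∀ {w : LieVec}, rad w = 0 → lie (lift x₀) w = 0 →
      dir (reflect n (lift x₀)) (reflect n w) = refl x₀ y₀ (dir (lift x₀) w) := fun hw hw' => by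
    rw [← dir_reflect hxy hc.ne' hc' hw hw']
    nth_rw 1 [hc']
    exact dir_smul hc.ne' _ _
  have o₀ := ob 0 zero_mem_I
  have o₁ := ob 1 one_mem_I
  rw [circArc_zero] at o₀
  rw [circArc_one] at o₁
  obtain ⟨m, b', φ, hm, hm', rb', -, db', hφ, ob', hne, hside⟩ := hg.exists_reflection hA' hP0
    (by rw [h₀, g00]) g10 ht₁ (by rw [hdir hA.rad hA.Pb, he]) ht₂
  have o₀' := ob' 0 zero_mem_I
  have o₁' := ob' 1 one_mem_I
  rw [circArc_zero] at o₀'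
  rw [circArc_one] at o₁'
  obtain ⟨x, hx⟩ := eq_add_smul_of_dir hA'.ptP hP0 (b := reflect n b) (b' := b')
    (by rw [rad_reflect hr, rb]) rb' (by rw [lie_reflect hn.ne', o₀]) o₀'
    (by rw [hdir rb o₀, hb, db'])
  -- Both direction vectors are orthogonal to the second end point as well, which removes the
  -- ambiguity by multiples of the first.
  have hx0 : x = 0 := by
    rw [hx, lie_add_right, lie_smul_right, lie_reflect hn.ne', o₁, zero_add, lie_comm] at o₁'
    exact (mul_eq_zero.1 o₁').resolve_right hA'.neg.ne
  rw [hx0, zero_smul, add_zero] at hx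
  rw [hx] at hside
  simp only [← reflect_circArc hn.ne'] at hne hside
  exact ⟨m, φ, hm, hm', hφ, hne, hside⟩

/-! ### Points on circles -/

/-- Reading off the coordinates, the points are affine combinations of `p₁, p₂, p₃` for which `‖x‖²`
is the same combination of the `‖pᵢ‖²`. So they lie in the affine hull and, if this is a plane, at
the same distance from the circumcenter. -/
theorem onCircle_of_mem_span {S : Set E3} {p₁ p₂ p₃ : E3}
    (h : ∀ x ∈ S, lift x ∈ Submodule.span ℝ {lift p₁, lift p₂, lift p₃}) : OnCircle S := by
  have hcomb : ∀ x ∈ S, ∃ α β γ : ℝ, α + β + γ = 1 ∧ x = α • p₁ + β • p₂ + γ • p₃ ∧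
      ‖x‖ ^ 2 = α * ‖p₁‖ ^ 2 + β * ‖p₂‖ ^ 2 + γ * ‖p₃‖ ^ 2 := by
    intro x hx
    obtain ⟨α, β, γ, e⟩ := Submodule.mem_span_triple.1 (h x hx)
    refine ⟨α, β, γ, ?_, ?_, ?_⟩
    · have := congrArg (fun v : LieVec => v.2.1) e
      simpa [lift] using this
    · have := congrArg (fun v : LieVec => v.1) e
      simpa [lift] using this.symm
    · have := congrArg (fun v : LieVec => v.2.2.1) e
      simpa [lift] using this.symm
  have haff : S ⊆ ((affineSpan ℝ ({p₁, p₂, p₃} : Set E3) : AffineSubspace ℝ E3) : Set E3) := by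
    intro x hx
    obtain ⟨α, β, γ, e1, e2, -⟩ := hcomb x hx
    have h1 : p₁ ∈ affineSpan ℝ ({p₁, p₂, p₃} : Set E3) := mem_affineSpan ℝ (by simp)
    have h2 : p₂ ∈ affineSpan ℝ ({p₁, p₂, p₃} : Set E3) := mem_affineSpan ℝ (by simp)
    have h3 : p₃ ∈ affineSpan ℝ ({p₁, p₂, p₃} : Set E3) := mem_affineSpan ℝ (by simp)
    have h4 : β • (p₂ -ᵥ p₁) + γ • (p₃ -ᵥ p₁) ∈
        (affineSpan ℝ ({p₁, p₂, p₃} : Set E3)).direction :=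
      add_mem (Submodule.smul_mem _ _ (AffineSubspace.vsub_mem_direction h2 h1))
        (Submodule.smul_mem _ _ (AffineSubspace.vsub_mem_direction h3 h1))
    have h5 := AffineSubspace.vadd_mem_of_mem_direction h4 h1
    have h6 : x = (β • (p₂ -ᵥ p₁) + γ • (p₃ -ᵥ p₁)) +ᵥ p₁ := by
      have : α = 1 - β - γ := by linarith
      rw [e2, this]
      simp only [vsub_eq_sub, vadd_eq_add]; module
    rw [h6]; exact h5
  have hspan : vectorSpan ℝ S ≤ vectorSpan ℝ ({p₁, p₂, p₃} : Set E3) := by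
    have h1 := vectorSpan_mono ℝ haff
    rwa [← AffineSubspace.direction_eq_vectorSpan, direction_affineSpan] at h1
  by_cases hcol : Collinear ℝ ({p₁, p₂, p₃} : Set E3)
  · exact Or.inl ((Submodule.rank_mono hspan).trans hcol)
  · refine Or.inr ⟨?_, (Submodule.rank_mono hspan).trans (coplanar_triple ℝ p₁ p₂ p₃)⟩
    have hind : AffineIndependent ℝ ![p₁, p₂, p₃] :=
      affineIndependent_iff_not_collinear_set.2 hcol
    let s : Affine.Simplex ℝ E3 2 := ⟨_, hind⟩
    obtain ⟨o, ho⟩ : ∃ o, o = s.circumcenter := ⟨_, rfl⟩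
    have d : ∀ i, ‖s.points i - o‖ = s.circumradius := fun i => by
      rw [← dist_eq_norm, ho]; exact s.dist_circumcenter_eq_circumradius i
    have d1 : ‖p₁ - o‖ = s.circumradius := d 0
    have d2 : ‖p₂ - o‖ = s.circumradius := d 1
    have d3 : ‖p₃ - o‖ = s.circumradius := d 2
    refine ⟨o, s.circumradius, fun x hx => ?_⟩
    obtain ⟨α, β, γ, e1, e2, e3⟩ := hcomb x hx
    have f : ∀ p : E3, ‖p - o‖ ^ 2 = ‖p‖ ^ 2 - 2 * inner ℝ p o + ‖o‖ ^ 2 := fun p =>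
      norm_sub_sq_real p o
    have g : ‖x - o‖ ^ 2 = s.circumradius ^ 2 := by
      have f1 := f p₁
      have f2 := f p₂
      have f3 := f p₃
      rw [d1] at f1
      rw [d2] at f2
      rw [d3] at f3
      have hi : inner ℝ x o = α * inner ℝ p₁ o + β * inner ℝ p₂ o + γ * inner ℝ p₃ o := by
        rw [e2]; simp only [inner_add_left, real_inner_smul_left]
      rw [f, e3, hi]
      linear_combination -α * f1 - β * f2 - γ * f3 + (s.circumradius ^ 2 - ‖o‖ ^ 2) * e1
    rw [dist_eq_norm]
    exact (pow_left_inj₀ (norm_nonneg _) s.circumradius_nonneg two_ne_zero).1 g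

/-- Two different planes intersect at most in a line, projectively. -/
theorem exists_comb_of_ne {C C' : Submodule ℝ LieVec} (hC : Module.finrank ℝ C ≤ 3)
    (hC' : Module.finrank ℝ C' ≤ 3) (hne : C ≠ C') {p q n : LieVec} (hp : p ∈ C) (hp' : p ∈ C')
    (hq : q ∈ C) (hq' : q ∈ C') (hn : n ∈ C) (hn' : n ∈ C') (hpq : LinearIndependent ℝ ![p, q]) :
    ∃ α β : ℝ, n = α • p + β • q := by
  have h1 : Submodule.span ℝ {p, q} ≤ C ⊓ C' := by
    rw [Submodule.span_le]
    rintro x (rfl | rfl)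
    exacts [⟨hp, hp'⟩, ⟨hq, hq'⟩]
  have h2 : Module.finrank ℝ (Submodule.span ℝ {p, q}) = 2 := by
    have := finrank_span_eq_card hpq
    have hr : range ![p, q] = {p, q} := by
      ext; simp [eq_comm, or_comm]
    rwa [hr, Fintype.card_fin] at this
  have h3 : Module.finrank ℝ ↥(C ⊓ C') ≤ 2 := by
    by_contra hlt
    push Not at hlt
    have e1 : C ⊓ C' = C := Submodule.eq_of_le_of_finrank_le inf_le_left (by omega)
    have e2 : C ⊓ C' = C' := Submodule.eq_of_le_of_finrank_le inf_le_right (by omega)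
    exact hne (e1.symm.trans e2)
  have h4 : Submodule.span ℝ {p, q} = C ⊓ C' := Submodule.eq_of_le_of_finrank_le h1 (by omega)
  have h5 : n ∈ Submodule.span ℝ {p, q} := by rw [h4]; exact ⟨hn, hn'⟩
  obtain ⟨α, β, e⟩ := Submodule.mem_span_pair.1 h5
  exact ⟨α, β, e.symm⟩

theorem finrank_span_triple_le (p q r : LieVec) :
    Module.finrank ℝ (Submodule.span ℝ {p, q, r}) ≤ 3 := by
  have h := finrank_span_finset_le_card (R := ℝ) ({p, q, r} : Finset LieVec)
  simp only [Finset.coe_insert, Finset.coe_singleton] at h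
  exact h.trans Finset.card_le_three

/-! ### Relations along a tube -/

theorem mem_of_reflect_mem {C : Submodule ℝ LieVec} {n A : LieVec} (hn : 0 < lie n n)
    (h : lie n A ≠ 0) (hA : A ∈ C) (hA' : reflect n A ∈ C) : n ∈ C := by
  have hk : 2 * lie n A / lie n n ≠ 0 := div_ne_zero (mul_ne_zero two_ne_zero h) hn.ne'
  have e : n = (2 * lie n A / lie n n)⁻¹ • (A - reflect n A) := by
    rw [reflect_apply, sub_sub_cancel, smul_smul, inv_mul_cancel₀ hk, one_smul]
  rw [e]
  exact C.smul_mem _ (C.sub_mem hA hA')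

theorem eq_zero_of_comb_reflect {P m n : LieVec} (hP : IsPt P) (rm : rad m = 0) (rn : rad n = 0)
    (pm : 0 < lie m m) (pn : 0 < lie n n) (hm : lie m P ≠ 0) (hn : lie n P ≠ 0)
    (h : lie (reflect m P) (reflect n P) < 0) (x y z : ℝ) (e : x • m + y • n + z • P = 0) :
    x = 0 ∧ y = 0 ∧ z = 0 := by
  obtain ⟨k, hk⟩ : ∃ k, k = 2 * lie m P / lie m m := ⟨_, rfl⟩
  obtain ⟨l, hl⟩ : ∃ l, l = 2 * lie n P / lie n n := ⟨_, rfl⟩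
  have hk0 : k ≠ 0 := by rw [hk]; exact div_ne_zero (mul_ne_zero two_ne_zero hm) pm.ne'
  have hl0 : l ≠ 0 := by rw [hl]; exact div_ne_zero (mul_ne_zero two_ne_zero hn) pn.ne'
  have em : m = k⁻¹ • (P - reflect m P) := by
    rw [reflect_apply, ← hk, sub_sub_cancel, smul_smul, inv_mul_cancel₀ hk0, one_smul]
  have en : n = l⁻¹ • (P - reflect n P) := by
    rw [reflect_apply, ← hl, sub_sub_cancel, smul_smul, inv_mul_cancel₀ hl0, one_smul]
  have e' : x • k⁻¹ • (P - reflect m P) + y • l⁻¹ • (P - reflect n P) + z • P = 0 := by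
    rw [← em, ← en, e]
  obtain ⟨h1, h2, h3⟩ := linearIndependent_of_isPt hP (isPt_reflect hP rm pm)
    (isPt_reflect hP rn pn) (hP.lie_reflect_neg pm hm) (hP.lie_reflect_neg pn hn) h
    (x := x * k⁻¹ + y * l⁻¹ + z) (y := -(x * k⁻¹)) (z := -(y * l⁻¹)) (by
      rw [← e']; module)
  have h4 : x = 0 := (mul_eq_zero.1 (neg_eq_zero.1 h2)).resolve_right (inv_ne_zero hk0)
  have h5 : y = 0 := (mul_eq_zero.1 (neg_eq_zero.1 h3)).resolve_right (inv_ne_zero hl0)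
  refine ⟨h4, h5, ?_⟩
  rw [h4, h5] at h1
  linarith

/-- If the vertices at the ends of a tube are not concircular, the reflections commute
appropriately, and the four edges satisfy a linear relation. -/
theorem exists_tube_relation {P Q e m n m' n' : LieVec} (arc : ArcData P Q e) (rm : rad m = 0)
    (rn : rad n = 0) (rn' : rad n' = 0) (pm : 0 < lie m m) (pn : 0 < lie n n)
    (pm' : 0 < lie m' m') (pn' : 0 < lie n' n') (hm : ∀ t ∈ I, lie m (circArc P Q e t) ≠ 0)
    (hn : ∀ t ∈ I, lie n (circArc P Q e t) ≠ 0)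
    (hm' : ∀ t ∈ I, lie m' (reflect n (circArc P Q e t)) ≠ 0)
    (hn' : ∀ t ∈ I, lie n' (reflect m (circArc P Q e t)) ≠ 0)
    (neg : lie (reflect m P) (reflect n P) < 0) {x y z x' y' z' μ μ' : ℝ} (hz : 0 < z)
    (relP : reflect n' (reflect m P) = x • reflect m P + y • reflect n P - z • P)
    (relQ : reflect n' (reflect m Q) = x' • reflect m Q + y' • reflect n Q - z' • Q)
    (hP : reflect m' (reflect n P) = μ • reflect n' (reflect m P))
    (hQ : reflect m' (reflect n Q) = μ' • reflect n' (reflect m Q)) (hμ : 0 < μ)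
    (hne : Submodule.span ℝ {P, reflect m P, reflect n P} ≠
      Submodule.span ℝ {Q, reflect m Q, reflect n Q}) :
    (∀ v, reflect n' (reflect m v) = reflect m' (reflect n v)) ∧ ∃ ξ η ζ : ℝ → ℝ,
      (∀ t ∈ I, reflect n' (reflect m (circArc P Q e t)) = ξ t • reflect m (circArc P Q e t) +
        η t • reflect n (circArc P Q e t) - ζ t • circArc P Q e t) ∧
      ContDiffOn ℝ ∞ ξ I ∧ ContDiffOn ℝ ∞ η I ∧ ContDiffOn ℝ ∞ ζ I ∧ ∀ t ∈ I, 0 < ζ t := by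
  have hmP := hm 0 zero_mem_I
  have hnP := hn 0 zero_mem_I
  have hmP' := hm' 0 zero_mem_I
  have hnP' := hn' 0 zero_mem_I
  have hmQ := hm 1 one_mem_I
  have hnQ := hn 1 one_mem_I
  have hmQ' := hm' 1 one_mem_I
  have hnQ' := hn' 1 one_mem_I
  rw [circArc_zero] at hmP hnP hmP' hnP'
  rw [circArc_one] at hmQ hnQ hmQ' hnQ'
  have hind := eq_zero_of_comb_reflect arc.ptP rm rn pm pn hmP hnP neg
  -- Each reflection vector is a multiple of the difference of two vertices of the quadrilateral,
  -- hence lies in the three-dimensional space of its circle.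
  have mem : ∀ {R : LieVec} {x y z μ : ℝ}, lie m R ≠ 0 → lie n R ≠ 0 →
      lie m' (reflect n R) ≠ 0 → lie n' (reflect m R) ≠ 0 →
      reflect n' (reflect m R) = x • reflect m R + y • reflect n R - z • R →
      reflect m' (reflect n R) = μ • reflect n' (reflect m R) →
      m ∈ Submodule.span ℝ {R, reflect m R, reflect n R} ∧
      n ∈ Submodule.span ℝ {R, reflect m R, reflect n R} ∧
      m' ∈ Submodule.span ℝ {R, reflect m R, reflect n R} ∧
      n' ∈ Submodule.span ℝ {R, reflect m R, reflect n R} := by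
    intro R x y z μ h1 h2 h3 h4 h5 h6
    set S := Submodule.span ℝ {R, reflect m R, reflect n R}
    have s1 : R ∈ S := Submodule.subset_span (by simp)
    have s2 : reflect m R ∈ S := Submodule.subset_span (by simp)
    have s4 : reflect n R ∈ S := Submodule.subset_span (by simp)
    have s3 : reflect n' (reflect m R) ∈ S := by
      rw [h5]
      exact S.sub_mem (S.add_mem (S.smul_mem _ s2) (S.smul_mem _ s4)) (S.smul_mem _ s1)
    have s3' : reflect m' (reflect n R) ∈ S := by rw [h6]; exact S.smul_mem _ s3
    exact ⟨mem_of_reflect_mem pm h1 s1 s2, mem_of_reflect_mem pn h2 s1 s4,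
      mem_of_reflect_mem pm' h3 s4 s3', mem_of_reflect_mem pn' h4 s2 s3⟩
  obtain ⟨b1, b2, b3, b4⟩ := mem hmP hnP hmP' hnP' relP hP
  obtain ⟨c1, c2, c3, c4⟩ := mem hmQ hnQ hmQ' hnQ' relQ hQ
  have hli : LinearIndependent ℝ ![m, n] := LinearIndependent.pair_iff.2 fun s t hst => by
    have := hind s t 0 (by rw [hst, zero_smul, add_zero])
    exact ⟨this.1, this.2.1⟩
  -- The spaces of the two circles are different, so their intersection is the plane spanned by `m`
  -- and `n`; it contains `n'` and `m'`.
  obtain ⟨α, β, en'⟩ := exists_comb_of_ne (finrank_span_triple_le _ _ _)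
    (finrank_span_triple_le _ _ _) hne b1 c1 b2 c2 b4 c4 hli
  obtain ⟨γ, δ, em'⟩ := exists_comb_of_ne (finrank_span_triple_le _ _ _)
    (finrank_span_triple_le _ _ _) hne b1 c1 b2 c2 b3 c3 hli
  have comm : ∀ v, reflect n' (reflect m v) = reflect m' (reflect n v) :=
    reflect_comp_eq arc.ptP rm rn pm pn' pm' pn hmP en' em' hind (μ := μ⁻¹) (by
      rw [hP, smul_smul, inv_mul_cancel₀ hμ.ne', one_smul])
  refine ⟨comm, ?_⟩
  set A := circArc P Q e with hA
  have hAc : ContDiffOn ℝ ∞ A I := (ArcData.contDiff_circArc P Q e).contDiffOn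
  obtain ⟨k₁, hk₁⟩ : ∃ k : ℝ → ℝ, k = fun t => 2 * lie m (A t) / lie m m := ⟨_, rfl⟩
  obtain ⟨k₄, hk₄⟩ : ∃ k : ℝ → ℝ, k = fun t => 2 * lie n (A t) / lie n n := ⟨_, rfl⟩
  obtain ⟨k₂, hk₂⟩ : ∃ k : ℝ → ℝ, k = fun t => 2 * lie n' (reflect m (A t)) / lie n' n' := ⟨_, rfl⟩
  have d₁ : ContDiffOn ℝ ∞ k₁ I := by
    rw [hk₁]; exact (contDiffOn_const.mul (contDiffOn_lie contDiffOn_const hAc)).div_const _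
  have d₄ : ContDiffOn ℝ ∞ k₄ I := by
    rw [hk₄]; exact (contDiffOn_const.mul (contDiffOn_lie contDiffOn_const hAc)).div_const _
  have d₂ : ContDiffOn ℝ ∞ k₂ I := by
    rw [hk₂]
    exact (contDiffOn_const.mul
      (contDiffOn_lie contDiffOn_const (contDiffOn_reflect m hAc))).div_const _
  have n₁ : ∀ t ∈ I, k₁ t ≠ 0 := fun t ht => by
    rw [hk₁]; exact div_ne_zero (mul_ne_zero two_ne_zero (hm t ht)) pm.ne'
  have n₄ : ∀ t ∈ I, k₄ t ≠ 0 := fun t ht => by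
    rw [hk₄]; exact div_ne_zero (mul_ne_zero two_ne_zero (hn t ht)) pn.ne'
  -- The coefficients result from `A₂ = A - k₁ m`, `A₄ = A - k₄ n` and `A₃ = A₂ - k₂ (α m + β n)` by
  -- eliminating `m` and `n`. The coefficients of `A` then force `ζ = ξ + η - 1`.
  obtain ⟨ξ, hξ⟩ : ∃ ξ : ℝ → ℝ, ξ = fun t => 1 + k₂ t * α / k₁ t := ⟨_, rfl⟩
  obtain ⟨η, hη⟩ : ∃ η : ℝ → ℝ, η = fun t => k₂ t * β / k₄ t := ⟨_, rfl⟩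
  have dξ : ContDiffOn ℝ ∞ ξ I := by
    rw [hξ]; exact contDiffOn_const.add ((d₂.mul contDiffOn_const).div d₁ n₁)
  have dη : ContDiffOn ℝ ∞ η I := by
    rw [hη]; exact (d₂.mul contDiffOn_const).div d₄ n₄
  have dζ : ContDiffOn ℝ ∞ (fun t => ξ t + η t - 1) I := (dξ.add dη).sub contDiffOn_const
  have rel : ∀ t ∈ I, reflect n' (reflect m (A t)) = ξ t • reflect m (A t) +
      η t • reflect n (A t) - (ξ t + η t - 1) • A t := fun t ht => by
    have e1 : reflect m (A t) = A t - k₁ t • m := by rw [reflect_apply, hk₁]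
    have e4 : reflect n (A t) = A t - k₄ t • n := by rw [reflect_apply, hk₄]
    have e2 : reflect n' (reflect m (A t)) = A t - k₁ t • m - k₂ t • (α • m + β • n) := by
      rw [reflect_apply, ← en', ← e1, hk₂]
    have f1 : ξ t * k₁ t = k₁ t + k₂ t * α := by
      have := n₁ t ht
      rw [hξ]; field_simp
    have f4 : η t * k₄ t = k₂ t * β := by
      have := n₄ t ht
      rw [hη]; field_simp
    have g1 : (ξ t * k₁ t) • m = (k₁ t + k₂ t * α) • m := by rw [f1]
    have g4 : (η t * k₄ t) • n = (k₂ t * β) • n := by rw [f4]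
    rw [e2, e1, e4]
    have : ξ t • (A t - k₁ t • m) + η t • (A t - k₄ t • n) - (ξ t + η t - 1) • A t =
        A t - (ξ t * k₁ t) • m - (η t * k₄ t) • n := by module
    rw [this, g1, g4]; module
  refine ⟨ξ, η, fun t => ξ t + η t - 1, rel, dξ, dη, dζ, ?_⟩
  refine pos_of_ne_zero isPreconnected_Icc dζ.continuousOn (fun t ht h0 => ?_) zero_mem_I ?_
  -- If `ζ` vanished, isotropy of `A₃ = ξ A₂ + η A₄` would make `ξ * η * ⟨A₂, A₄⟩` zero; but `⟨A₂,
  -- A₃⟩` and `⟨A₄, A₃⟩` are non-zero.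
  · have hpt := arc.isPt_circArc t
    have q2 := isPt_reflect hpt rm pm
    have q4 := isPt_reflect hpt rn pn
    have q3 := isPt_reflect q2 rn' pn'
    have l2 := q2.lie_reflect_neg pn' (hn' t ht)
    have l4 := q4.lie_reflect_neg pm' (hm' t ht)
    have l3 := q3.null
    rw [← comm] at l4
    have r := rel t ht
    rw [h0, zero_smul, sub_zero] at r
    rw [← hA] at q2 q4 q3 l2 l4 l3
    rw [r] at l2 l3 l4
    simp only [lie_add_left, lie_add_right, lie_smul_left, lie_smul_right, q2.null, q4.null,
      lie_comm (reflect n (A t)) (reflect m (A t))] at l2 l3 l4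
    have h1 : η t * lie (reflect m (A t)) (reflect n (A t)) ≠ 0 := by linarith
    have h2 : ξ t ≠ 0 := by
      intro h
      rw [h] at l4
      linarith
    exact mul_ne_zero h2 h1 (by linarith)
  · have r := rel 0 zero_mem_I
    rw [hA, circArc_zero, relP] at r
    -- At `t = 0` the relation is unique, since three of the vertices are independent, so `ζ 0` is
    -- the given positive `z`.
    obtain ⟨h1, -, -⟩ := linearIndependent_of_isPt arc.ptP (isPt_reflect arc.ptP rm pm)
      (isPt_reflect arc.ptP rn pn) (arc.ptP.lie_reflect_neg pm hmP)
      (arc.ptP.lie_reflect_neg pn hnP) neg (x := (ξ 0 + η 0 - 1) - z) (y := x - ξ 0)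
      (z := y - η 0) (by
        rw [← sub_eq_zero] at r
        rw [← r]; module)
    linarith

theorem bit_false : bit false = 0 := rfl
theorem bit_true : bit true = 1 := rfl

theorem bit_mem (b : Bool) : bit b ∈ I := by
  cases b
  exacts [zero_mem_I, one_mem_I]

theorem mem_image {g : ℝ → ℝ → Space} {u v : ℝ} (hu : u ∈ I) (hv : v ∈ I) : g u v ∈ image g :=
  ⟨(u, v), ⟨hu, hv⟩, rfl⟩

theorem SamePatch.map_zero_zero {f g : ℝ → ℝ → Space} (h : SamePatch f g) : f 0 0 = g 0 0 := by
  obtain ⟨α, β, hα, hβ, e⟩ := h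
  rw [e 0 zero_mem_I 0 zero_mem_I, hα.map_zero, hβ.map_zero]

/-! ### Tubes between faces -/

/-- The coordinate lines of the patch `g` with constant first parameter are the circular arcs from
`A t` to `A' t` with direction `b`. -/
def HasLines (g : ℝ → ℝ → Space) (A A' : ℝ → LieVec) (b : LieVec) (φ : ℝ → ℝ) : Prop :=
  IsReparam φ ∧ ∀ t ∈ I, ∃ ψ, IsReparam ψ ∧ ∀ u ∈ I,
    g (φ t) u = toSpace (circArc (A t) (A' t) b (ψ u))

namespace HasLines

variable {g g' : ℝ → ℝ → Space} {A A' : ℝ → LieVec} {b : LieVec} {φ φ' : ℝ → ℝ}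

theorem left (h : HasLines g A A' b φ) {t : ℝ} (ht : t ∈ I) : g (φ t) 0 = toSpace (A t) := by
  obtain ⟨ψ, hψ, e⟩ := h.2 t ht
  rw [e 0 zero_mem_I, hψ.map_zero, circArc_zero]

theorem right (h : HasLines g A A' b φ) {t : ℝ} (ht : t ∈ I) : g (φ t) 1 = toSpace (A' t) := by
  obtain ⟨ψ, hψ, e⟩ := h.2 t ht
  rw [e 1 one_mem_I, hψ.map_one, circArc_one]

theorem image_eq (h : HasLines g A A' b φ) {t : ℝ} (ht : t ∈ I) :
    (fun u => g (φ t) u) '' I = (fun u => toSpace (circArc (A t) (A' t) b u)) '' I := by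
  obtain ⟨ψ, hψ, e⟩ := h.2 t ht
  rw [← hψ.image_comp_eq fun u => toSpace (circArc (A t) (A' t) b u)]
  exact image_congr e

theorem mem_image (h : HasLines g A A' b φ) {t u : ℝ} (ht : t ∈ I) (hu : u ∈ I) :
    ∃ v ∈ I, g (φ t) v = toSpace (circArc (A t) (A' t) b u) := by
  have : toSpace (circArc (A t) (A' t) b u) ∈ (fun u => g (φ t) u) '' I := by
    rw [h.image_eq ht]; exact mem_image_of_mem _ hu
  exact this

theorem ne_of_disjoint {B B' : ℝ → LieVec} {b' : LieVec} (h : HasLines g A A' b φ)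
    (h' : HasLines g' B B' b' φ')
    (hd : ∀ u ∈ I, ∀ v ∈ I, ∀ u' ∈ I, ∀ v' ∈ I, g u v ≠ g' u' v') :
    ∀ t ∈ I, ∀ u ∈ I, ∀ u' ∈ I, toSpace (circArc (A t) (A' t) b u) ≠
      toSpace (circArc (B t) (B' t) b' u') := by
  intro t ht u hu u' hu'
  obtain ⟨v, hv, e⟩ := h.mem_image ht hu
  obtain ⟨v', hv', e'⟩ := h'.mem_image ht hu'
  rw [← e, ← e']
  exact hd _ (h.1.mem ht) _ hv _ (h'.1.mem ht) _ hv'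

end HasLines

/-- The tube `T` connects the faces `face i false` and `face i true` along the remaining faces. -/
structure Tube.Spans (T : Tube) (face : Fin 3 → Bool → ℝ → ℝ → Space) (i : Fin 3) : Prop where
  side₁ : ∃ φ, HasLines (face (i + 2) false) T.A₁ T.A₂ T.b φ
  side₂ : ∃ φ, HasLines (fun u v => face (i + 1) true v u) T.A₂ T.A₃ (reflect T.m T.c) φ
  side₃ : ∃ φ, HasLines (face (i + 2) true) T.A₄ T.A₃ (reflect T.n T.b) φ
  side₄ : ∃ φ, HasLines (fun u v => face (i + 1) false v u) T.A₁ T.A₄ T.c φ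
  start : SamePatch (T.data 0).std (face i false)
  finish : SamePatch (T.data 1).std (face i true)

theorem IsPatch.exists_data_of_vertices {g : ℝ → ℝ → Space} (hg : IsPatch g)
    {A₁ A₂ A₃ A₄ : LieVec}
    (h₁ : IsPt A₁) (h₂ : IsPt A₂) (h₃ : IsPt A₃) (h₄ : IsPt A₄) (e₁ : g 0 0 = toSpace A₁)
    (e₂ : g 1 0 = toSpace A₂) (e₃ : g 1 1 = toSpace A₃) (e₄ : g 0 1 = toSpace A₄) :
    ∃ (D : PatchData) (k₁ k₂ k₃ k₄ : ℝ), D.IsGood ∧ SamePatch g D.std ∧ 0 < k₁ ∧ 0 < k₂ ∧ 0 < k₃ ∧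
      0 < k₄ ∧ D.P = k₁ • A₁ ∧ D.P + D.Y = k₂ • A₂ ∧ D.P + D.Y + D.Z = k₃ • A₃ ∧
      D.P + D.Z = k₄ • A₄ := by
  obtain ⟨D, hD, α, β, hα, hβ, e⟩ := hg.exists_data
  rw [e _ zero_mem_I _ zero_mem_I, hα.map_zero, hβ.map_zero, PatchData.std,
    PatchData.F_zero_zero] at e₁
  rw [e _ one_mem_I _ zero_mem_I, hα.map_one, hβ.map_zero, PatchData.std,
    PatchData.F_one_zero] at e₂
  rw [e _ one_mem_I _ one_mem_I, hα.map_one, hβ.map_one, PatchData.std,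
    PatchData.F_one_one] at e₃
  rw [e _ zero_mem_I _ one_mem_I, hα.map_zero, hβ.map_one, PatchData.std,
    PatchData.F_zero_one] at e₄
  obtain ⟨k₁, p₁, f₁⟩ := exists_smul_of_toSpace_eq h₁ hD.pt e₁.symm
  obtain ⟨k₂, p₂, f₂⟩ := exists_smul_of_toSpace_eq h₂ (hD.arc₁.isPt_end hD.pt) e₂.symm
  obtain ⟨k₄, p₄, f₄⟩ := exists_smul_of_toSpace_eq h₄ (hD.arc₂.isPt_end hD.pt) e₄.symm
  have hD3 : IsPt (D.P + D.Y + D.Z) := by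
    rw [← PatchData.F_one_one]; exact hD.isPt_F one_mem_I one_mem_I
  obtain ⟨k₃, p₃, f₃⟩ := exists_smul_of_toSpace_eq h₃ hD3 e₃.symm
  exact ⟨D, k₁, k₂, k₃, k₄, hD, ⟨α, β, hα, hβ, e⟩, p₁, p₂, p₃, p₄, f₁, f₂, f₃, f₄⟩

/-- The linear relation between the vertices of a patch. -/
theorem IsPatch.exists_relation {g : ℝ → ℝ → Space} (hg : IsPatch g) {A₁ A₂ A₃ A₄ : LieVec}
    (h₁ : IsPt A₁) (h₂ : IsPt A₂) (h₃ : IsPt A₃) (h₄ : IsPt A₄) (e₁ : g 0 0 = toSpace A₁)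
    (e₂ : g 1 0 = toSpace A₂) (e₃ : g 1 1 = toSpace A₃) (e₄ : g 0 1 = toSpace A₄) :
    ∃ x y z : ℝ, 0 < z ∧ A₃ = x • A₂ + y • A₄ - z • A₁ := by
  obtain ⟨D, k₁, k₂, k₃, k₄, -, -, p₁, -, p₃, -, f₁, f₂, f₃, f₄⟩ :=
    hg.exists_data_of_vertices h₁ h₂ h₃ h₄ e₁ e₂ e₃ e₄
  refine ⟨k₃⁻¹ * k₂, k₃⁻¹ * k₄, k₃⁻¹ * k₁, by positivity, ?_⟩
  rw [mul_smul, mul_smul, mul_smul, ← f₂, ← f₄, ← f₁]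
  have : A₃ = k₃⁻¹ • (D.P + D.Y + D.Z) := by
    rw [f₃, smul_smul, inv_mul_cancel₀ p₃.ne', one_smul]
  rw [this]; module

namespace PatchData.IsGood

variable {D : PatchData}

theorem samePatch_line (h : D.IsGood) {g : ℝ → ℝ → Space} (hs : SamePatch g D.std) :
    ∃ α, IsReparam α ∧ ∀ u ∈ I,
      g u 0 = toSpace (circArc D.P (D.P + D.Y) (unitDir D.P D.Y D.B) (α u)) := by
  obtain ⟨α, β, hα, hβ, e⟩ := hs
  exact ⟨α, hα, fun u hu => by
    rw [e u hu 0 zero_mem_I, hβ.map_zero, PatchData.std, h.F_u_zero_eq]⟩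

theorem samePatch_line' (h : D.IsGood) {g : ℝ → ℝ → Space} (hs : SamePatch g D.std) :
    ∃ β, IsReparam β ∧ ∀ v ∈ I,
      g 0 v = toSpace (circArc D.P (D.P + D.Z) (unitDir D.P D.Z D.C) (β v)) := by
  obtain ⟨α, β, hα, hβ, e⟩ := hs
  refine h.swap.samePatch_line (g := fun u v => g v u) ⟨β, α, hβ, hα, fun u hu v hv => ?_⟩
  rw [std_swap]
  exact e v hv u hu

end PatchData.IsGood

namespace Tube.IsTube

variable {T : Tube} {g : ℝ → ℝ → Space}

/-- A patch with the vertices and the directions of the patch of a tube. -/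
theorem samePatch_of_hasDirection (h : T.IsTube) {t : ℝ} (ht : t ∈ I) (hg : IsPatch g)
    (e₁ : g 0 0 = toSpace (T.A₁ t)) (e₂ : g 1 0 = toSpace (T.A₂ t)) (e₃ : g 1 1 = toSpace (T.A₃ t))
    (e₄ : g 0 1 = toSpace (T.A₄ t)) (hA : (T.A₁ t).2.1 ≠ 0)
    (hb : HasDirection (fun u => g u 0) (dir (T.A₁ t) T.b))
    (hc : HasDirection (fun v => g 0 v) (dir (T.A₁ t) T.c)) : SamePatch (T.data t).std g := by
  obtain ⟨D, k₁, k₂, k₃, k₄, hD, hs, p₁, -, -, -, f₁, f₂, f₃, f₄⟩ :=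
    hg.exists_data_of_vertices (h.isPt₁ t) (h.isPt₂ t) (h.isPt₃ t) (h.isPt₄ t) e₁ e₂ e₃ e₄
  have hP0 : D.P.2.1 ≠ 0 := by rw [f₁]; exact mul_ne_zero p₁.ne' hA
  have aux : ∀ {Y B w : LieVec}, IsPreArc D.P Y B → rad w = 0 → lie (T.A₁ t) w = 0 →
      dir D.P (unitDir D.P Y B) = dir (T.A₁ t) w →
      ∃ x : ℝ, unitDir D.P Y B = w + x • T.A₁ t := by
    intro Y B w hY hw hw' hd
    have hPb := (hY.arcData hD.pt).Pb
    nth_rw 1 [f₁] at hd hPb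
    rw [dir_smul p₁.ne'] at hd
    rw [lie_smul_left] at hPb
    exact eq_add_smul_of_dir (h.isPt₁ t) hA hw (hY.arcData hD.pt).rad hw'
      ((mul_eq_zero.1 hPb).resolve_left p₁.ne') hd.symm
  obtain ⟨α, hα, eα⟩ := hD.samePatch_line hs
  obtain ⟨β, hβ, eβ⟩ := hD.samePatch_line' hs
  obtain ⟨x, hx⟩ := aux hD.arc₁ h.rad_b (h.orth_b t ht)
    (HasDirection.eq_dir (hD.arc₁.arcData hD.pt) hP0 hα eα hb)
  obtain ⟨y, hy⟩ := aux hD.arc₂ h.rad_c (h.orth_c t ht)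
    (HasDirection.eq_dir (hD.arc₂.arcData hD.pt) hP0 hβ eβ hc)
  have : D.std = (T.data t).std := by
    funext u v
    exact h.std_eq ht hD.toIsPre p₁ f₁ f₂ f₄ f₃ hx hy u v
  rw [← this]
  exact hs.symm

/-- A patch with the vertices and two sides of the patch of a tube. -/
theorem samePatch_of_image (h : T.IsTube) {t : ℝ} (ht : t ∈ I) (hg : IsPatch g)
    (e₁ : g 0 0 = toSpace (T.A₁ t)) (e₂ : g 1 0 = toSpace (T.A₂ t)) (e₃ : g 1 1 = toSpace (T.A₃ t))
    (e₄ : g 0 1 = toSpace (T.A₄ t))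
    (hb : (fun u => g u 0) '' I = (fun u => toSpace (circArc (T.A₁ t) (T.A₂ t) T.b u)) '' I)
    (hc : (fun v => g 0 v) '' I = (fun v => toSpace (circArc (T.A₁ t) (T.A₄ t) T.c v)) '' I) :
    SamePatch g (T.data t).std := by
  obtain ⟨D, k₁, k₂, k₃, k₄, hD, hs, p₁, -, -, -, f₁, f₂, f₃, f₄⟩ :=
    hg.exists_data_of_vertices (h.isPt₁ t) (h.isPt₂ t) (h.isPt₃ t) (h.isPt₄ t) e₁ e₂ e₃ e₄
  obtain ⟨α, hα, eα⟩ := hD.samePatch_line hs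
  obtain ⟨β, hβ, eβ⟩ := hD.samePatch_line' hs
  obtain ⟨x, hx⟩ := (h.arc₁₂b ht).eq_of_image (hD.arc₁.arcData hD.pt) p₁ f₁ f₂
    (by rw [← hb, ← hα.image_comp_eq]; exact (image_congr eα).ge)
  obtain ⟨y, hy⟩ := (h.arc₁₄c ht).eq_of_image (hD.arc₂.arcData hD.pt) p₁ f₁ f₄
    (by rw [← hc, ← hβ.image_comp_eq]; exact (image_congr eβ).ge)
  have : D.std = (T.data t).std := by
    funext u v
    exact h.std_eq ht hD.toIsPre p₁ f₁ f₂ f₄ f₃ hx hy u v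
  rw [← this]
  exact hs

end Tube.IsTube

/-- The common points of adjacent faces. -/
theorem eq_of_adjacent {g g' : ℝ → ℝ → Space} (hg : IsPatch g) (hg' : IsPatch g') {b c : Bool}
    (hadj : image g ∩ image g' ⊆ (fun v => g (bit c) v) '' I) {φ φ' : ℝ → ℝ} (hφ : IsReparam φ)
    (hφ' : IsReparam φ') {A : ℝ → Space} (e : ∀ t ∈ I, g (bit c) (φ t) = A t)
    (e' : ∀ t ∈ I, g' (φ' t) (bit b) = A t) {x : Space} {t t' : ℝ} (ht : t ∈ I) (ht' : t' ∈ I)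
    (hx : x ∈ (fun w => g w (φ t)) '' I) (hx' : x ∈ (fun w => g' (φ' t') w) '' I) :
    t' = t ∧ x = A t := by
  obtain ⟨w, hw, rfl⟩ := hx
  obtain ⟨w', hw', he⟩ := hx'
  simp only at he
  -- A common point of the two coordinate lines lies on the common arc; injectivity of both faces
  -- then identifies it there and equates the parameters.
  obtain ⟨v, hv, hev⟩ := hadj ⟨mem_image hw (hφ.mem ht), by
    rw [← he]; exact mem_image (hφ'.mem ht') hw'⟩
  simp only at hev
  obtain ⟨h1, -⟩ := hg.injOn (bit_mem c) hv hw (hφ.mem ht) hev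
  have h2 : g w (φ t) = A t := by rw [← h1, e t ht]
  refine ⟨?_, h2⟩
  rw [h2, ← e' t ht] at he
  exact hφ'.injOn ht' ht (hg'.injOn (hφ'.mem ht') hw' (hφ'.mem ht) (bit_mem b) he).1

section

variable {Q : Cube} {face : Fin 3 → Bool → ℝ → ℝ → Space} {i : Fin 3} {T : Tube}

theorem Tube.IsTube.boundaryOnFaces (h : T.IsTube) (hs : T.Spans face i) {t : ℝ} (ht : t ∈ I) :
    BoundaryOnFaces face i (T.data t).std := by
  obtain ⟨φ₁, h₁⟩ := hs.side₁
  obtain ⟨φ₂, h₂⟩ := hs.side₂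
  obtain ⟨φ₃, h₃⟩ := hs.side₃
  obtain ⟨φ₄, h₄⟩ := hs.side₄
  have aux : ∀ {γ γ' : ℝ → Space}, (∃ φ, IsReparam φ ∧ ∀ u ∈ I, γ u = γ' (φ u)) →
      γ '' I = γ' '' I := by
    rintro γ γ' ⟨φ, hφ, e⟩
    rw [← hφ.image_comp_eq γ']; exact image_congr e
  intro b
  cases b
  · exact ⟨⟨_, h₁.1.mem ht, (aux (h.side_zero ht)).trans (h₁.image_eq ht).symm⟩,
      ⟨_, h₄.1.mem ht, (aux (h.side_zero' ht)).trans (h₄.image_eq ht).symm⟩⟩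
  · exact ⟨⟨_, h₃.1.mem ht, (aux (h.side_one ht)).trans (h₃.image_eq ht).symm⟩,
      ⟨_, h₂.1.mem ht, (aux (h.side_one' ht)).trans (h₂.image_eq ht).symm⟩⟩

theorem Tube.IsTube.isSmoothFamily (h : T.IsTube) (hs : T.Spans face i) :
    IsSmoothFamily face i fun t => (T.data t).std where
  smooth := h.contDiffOn_std
  immersion t ht p hp := (h.isGood ht).injective_fderivWithin hp
  velocity t ht := by
    obtain ⟨v, hv, hv0⟩ := h.arc.hasDerivAt t
    have e : (fun t => pt ((T.data t).std 0 0)) = fun t => pt (toSpace (circArc T.P T.Q T.e t)) := by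
      funext t
      rw [PatchData.std, PatchData.F_zero_zero]; rfl
    rw [e, hv.hasDerivWithinAt.derivWithin (uniqueDiffOn_Icc zero_lt_one t ht)]
    exact hv0
  patch t ht := (h.isGood ht).isPatch
  start := hs.start
  finish := hs.finish
  boundary t ht := h.boundaryOnFaces hs ht

theorem Tube.IsTube.eq_of_samePatch (h : T.IsTube) {g : ℝ → ℝ → Space} {t t' : ℝ}
    (hg : SamePatch g (T.data t).std) (hg' : SamePatch g (T.data t').std) : t = t' := by
  have := hg.map_zero_zero.symm.trans hg'.map_zero_zero
  rw [PatchData.std, PatchData.std, PatchData.F_zero_zero, PatchData.F_zero_zero] at this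
  exact h.arc.eq_of_toSpace this

/-- Each corner of `g` lies on coordinate lines of two adjacent faces, so by `eq_of_adjacent` the
two lines have the same parameter and the corner is on the edge. Going round the corners leaves a
single `t`, and then the vertices and two sides determine the patch. -/
theorem Tube.IsTube.exists_samePatch (h : T.IsTube) (hs : T.Spans face i)
    (hface : ∀ i b, IsPatch (face i b))
    (hadj : ∀ b c, image (face (i + 1) b) ∩ image (face (i + 2) c) ⊆
      (fun v => face (i + 1) b (bit c) v) '' I) {g : ℝ → ℝ → Space} (hg : IsPatch g)
    (hgb : BoundaryOnFaces face i g) : ∃ t ∈ I, SamePatch g (T.data t).std := by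
  obtain ⟨φ₁, h₁⟩ := hs.side₁
  obtain ⟨φ₂, h₂⟩ := hs.side₂
  obtain ⟨φ₃, h₃⟩ := hs.side₃
  obtain ⟨φ₄, h₄⟩ := hs.side₄
  obtain ⟨⟨τ₁, hτ₁, E₁⟩, ⟨τ₄, hτ₄, E₄⟩⟩ := hgb false
  obtain ⟨⟨τ₃, hτ₃, E₃⟩, ⟨τ₂, hτ₂, E₂⟩⟩ := hgb true
  rw [bit_false] at E₁ E₄
  rw [bit_true] at E₃ E₂
  obtain ⟨t₁, ht₁, rfl⟩ := h₁.1.surj hτ₁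
  obtain ⟨t₂, ht₂, rfl⟩ := h₂.1.surj hτ₂
  obtain ⟨t₃, ht₃, rfl⟩ := h₃.1.surj hτ₃
  obtain ⟨t₄, ht₄, rfl⟩ := h₄.1.surj hτ₄
  have m₁ : ∀ u ∈ I, g u 0 ∈ (fun u => face (i + 2) false (φ₁ t₁) u) '' I := fun u hu => by
    rw [← E₁]; exact mem_image_of_mem _ hu
  have m₃ : ∀ u ∈ I, g u 1 ∈ (fun u => face (i + 2) true (φ₃ t₃) u) '' I := fun u hu => by
    rw [← E₃]; exact mem_image_of_mem _ hu
  have m₂ : ∀ v ∈ I, g 1 v ∈ (fun v => face (i + 1) true v (φ₂ t₂)) '' I := fun v hv => by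
    rw [← E₂]; exact mem_image_of_mem _ hv
  have m₄ : ∀ v ∈ I, g 0 v ∈ (fun v => face (i + 1) false v (φ₄ t₄)) '' I := fun v hv => by
    rw [← E₄]; exact mem_image_of_mem _ hv
  obtain ⟨r₁, v₁⟩ := eq_of_adjacent (hface (i + 1) false) (hface (i + 2) false) (b := false)
    (hadj false false) h₄.1 h₁.1 (A := fun t => toSpace (T.A₁ t)) (fun t ht => h₄.left ht)
    (fun t ht => h₁.left ht) ht₄ ht₁ (m₄ _ zero_mem_I) (m₁ _ zero_mem_I)
  obtain ⟨r₂, v₂⟩ := eq_of_adjacent (hface (i + 1) true) (hface (i + 2) false) (b := true)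
    (hadj true false) h₂.1 h₁.1 (A := fun t => toSpace (T.A₂ t)) (fun t ht => h₂.left ht)
    (fun t ht => h₁.right ht) ht₂ ht₁ (m₂ _ zero_mem_I) (m₁ _ one_mem_I)
  obtain ⟨r₃, v₃⟩ := eq_of_adjacent (hface (i + 1) true) (hface (i + 2) true) (b := true)
    (hadj true true) h₂.1 h₃.1 (A := fun t => toSpace (T.A₃ t)) (fun t ht => h₂.right ht)
    (fun t ht => h₃.right ht) ht₂ ht₃ (m₂ _ one_mem_I) (m₃ _ one_mem_I)
  obtain ⟨r₄, v₄⟩ := eq_of_adjacent (hface (i + 1) false) (hface (i + 2) true) (b := false)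
    (hadj false true) h₄.1 h₃.1 (A := fun t => toSpace (T.A₄ t)) (fun t ht => h₄.right ht)
    (fun t ht => h₃.left ht) ht₄ ht₃ (m₄ _ one_mem_I) (m₃ _ zero_mem_I)
  subst r₁
  subst r₂
  exact ⟨t₁, ht₁, h.samePatch_of_image ht₁ hg v₁ v₂ v₃ v₄ (E₁.trans (h₁.image_eq ht₁))
    (E₄.trans (h₄.image_eq ht₁))⟩

/-- Each member of the other family is a member of the tube for some `θ t`. The vertex `Ψ t 0 0`
runs on the edge with non-zero velocity, which makes `θ` monotone. -/
theorem Tube.IsTube.exists_reparam (h : T.IsTube) (hs : T.Spans face i)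
    (hface : ∀ i b, IsPatch (face i b))
    (hadj : ∀ b c, image (face (i + 1) b) ∩ image (face (i + 2) c) ⊆
      (fun v => face (i + 1) b (bit c) v) '' I) {Ψ : ℝ → ℝ → ℝ → Space}
    (hΨ : IsSmoothFamily face i Ψ) :
    ∃ θ : ℝ → ℝ, IsReparam θ ∧ ∀ t ∈ I, SamePatch (Ψ t) (T.data (θ t)).std := by
  choose! θ hθ hθ' using fun t ht =>
    h.exists_samePatch hs hface hadj (hΨ.patch t ht) (hΨ.boundary t ht)
  refine ⟨θ, h.arc.isReparam_of_curve (X := fun t => pt (Ψ t 0 0)) ?_ hΨ.velocity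
    (fun t ht => ?_) ?_ ?_, hθ'⟩
  · have h1 := hΨ.smooth.differentiableOn (by simp)
    have h2 : DifferentiableOn ℝ (fun t : ℝ => (t, (0 : ℝ), (0 : ℝ))) I := by fun_prop
    exact h1.comp h2 fun t ht => ⟨ht, zero_mem_I, zero_mem_I⟩
  · rw [(hθ' t ht).map_zero_zero, PatchData.std, PatchData.F_zero_zero]; rfl
  · exact h.eq_of_samePatch (hθ' 0 zero_mem_I) (hΨ.start.trans hs.start.symm)
  · exact h.eq_of_samePatch (hθ' 1 one_mem_I) (hΨ.finish.trans hs.finish.symm)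

end

/-! ### The tube of a cube -/

theorem corner_add_one (i : Fin 3) (b c d : Bool) : corner (i + 1) b c d = corner i d b c := by
  revert i b c d; decide

theorem corner_add_two (i : Fin 3) (b c d : Bool) : corner (i + 2) b c d = corner i c d b := by
  revert i b c d; decide

theorem shift_corner (i : Fin 3) (b c d : Bool) : shift (corner i b c d) i = corner i true c d := by
  revert i b c d; decide

theorem shift_corner_one (i : Fin 3) (b c d : Bool) :
    shift (corner i b c d) (i + 1) = corner i b true d := by
  revert i b c d; decide

theorem shift_corner_two (i : Fin 3) (b c d : Bool) :
    shift (corner i b c d) (i + 2) = corner i b c true := by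
  revert i b c d; decide

theorem corner_apply (i : Fin 3) (b c d : Bool) :
    corner i b c d i = b ∧ corner i b c d (i + 1) = c ∧ corner i b c d (i + 2) = d := by
  revert i b c d; decide

theorem eq_corner (i : Fin 3) (ε : Fin 3 → Bool) : ε = corner i (ε i) (ε (i + 1)) (ε (i + 2)) := by
  revert i ε; decide

theorem add_one_add_one (i : Fin 3) : i + 1 + 1 = i + 2 := by revert i; decide
theorem add_one_add_two (i : Fin 3) : i + 1 + 2 = i := by revert i; decide
theorem add_two_add_one (i : Fin 3) : i + 2 + 1 = i := by revert i; decide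
theorem add_two_add_two (i : Fin 3) : i + 2 + 2 = i + 1 := by revert i; decide
theorem distinct (i : Fin 3) : i ≠ i + 1 ∧ i ≠ i + 2 ∧ i + 1 ≠ i + 2 := by revert i; decide

theorem Cube.evolution_of_ne (Q : Cube) {ε : Fin 3 → Bool} {i l : Fin 3} (h : ε i = false)
    (hl : l ≠ i) : Q.B (shift ε i) l = refl (Q.x ε) (Q.x (shift ε i)) (Q.B ε l) := by
  rw [Q.evolution ε i h l, if_neg hl]

/-- The direction of an arc at its second end point, for vectors orthogonal to both ends. -/
theorem dir_lift_eq_refl {x y : E3} (hxy : x ≠ y) {b : LieVec} (hb : rad b = 0)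
    (hx : lie (lift x) b = 0) (hy : lie (lift y) b = 0) :
    dir (lift y) b = refl x y (dir (lift x) b) := by
  have hd : ‖x - y‖ ^ 2 ≠ 0 := pow_ne_zero 2 (norm_ne_zero_iff.2 (sub_ne_zero.2 hxy))
  have h1 : lie (lift x - lift y) (lift x - lift y) = ‖x - y‖ ^ 2 := by
    simp only [lie_sub_left, lie_sub_right, (isPt_lift _).null, lie_comm (lift y) (lift x),
      lie_lift]; ring
  have h2 : 2 * lie (lift x - lift y) (lift x) = ‖x - y‖ ^ 2 := by
    simp only [lie_sub_left, (isPt_lift _).null, lie_comm (lift y) (lift x), lie_lift]; ring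
  have h3 : reflect (lift x - lift y) (lift x) = (1 : ℝ) • lift y := by
    rw [reflect_apply, h1, h2, div_self hd]; module
  have h4 : reflect (lift x - lift y) b = b :=
    reflect_of_lie_eq_zero (by rw [lie_sub_left, hx, hy, sub_zero])
  rw [← dir_reflect hxy one_ne_zero h3 hb hx, h4]

theorem lift_mem_of_toSpace {C : Submodule ℝ LieVec} {A : LieVec} (hA : IsPt A) {x : E3}
    (h : toSpace A = x) (hC : A ∈ C) : lift x ∈ C := by
  obtain ⟨k, -, e⟩ := exists_smul_of_toSpace_eq hA (isPt_lift x) (by rw [h, toSpace_lift])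
  rw [e]; exact C.smul_mem _ hC

theorem mem_of_lift_mem {C : Submodule ℝ LieVec} {A : LieVec} (hA : IsPt A) {x : E3}
    (h : toSpace A = x) (hC : lift x ∈ C) : A ∈ C := by
  obtain ⟨k, -, e⟩ := exists_smul_of_toSpace_eq (isPt_lift x) hA (by rw [h, toSpace_lift])
  rw [e]; exact C.smul_mem _ hC

/-- The two lateral faces at the edge from the first vertex in direction `i` supply `m, b` and `n,
c`. The faces opposite to them are reached by reflecting this edge, and the frame evolution shows
that their transversal directions are the reflected `b` and `c`. -/
theorem exists_tube {Q : Cube} {face : Fin 3 → Bool → ℝ → ℝ → Space} (hface : Q.IsFaces face)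
    (hns : NonsingularFaces face) (hcirc : ¬ OnCircle (Set.range Q.x)) (i : Fin 3) :
    ∃ T : Tube, T.IsTube ∧ T.Spans face i := by
  obtain ⟨hi₁, hi₂, h₁₂⟩ := distinct i
  obtain ⟨X, hX⟩ : ∃ X : Bool → Bool → Bool → E3, X = fun b c d => Q.x (corner i b c d) := ⟨_, rfl⟩
  have vi : ∀ b c d, face i b (bit c) (bit d) = (X b c d : Space) := fun b c d => by
    rw [hface.vertices, hX]
  have vj : ∀ b c d, face (i + 1) b (bit c) (bit d) = (X d b c : Space) := fun b c d => by
    rw [hface.vertices, hX, corner_add_one]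
  have vk : ∀ b c d, face (i + 2) b (bit c) (bit d) = (X c d b : Space) := fun b c d => by
    rw [hface.vertices, hX, corner_add_two]
  obtain ⟨B, hB⟩ : ∃ B : Bool → Bool → Bool → Fin 3 → E3, B = fun b c d => Q.B (corner i b c d) :=
    ⟨_, rfl⟩
  have fi₁ : ∀ b, HasDirection (fun u => face i b u 0) (B b false false (i + 1)) := fun b => by
    rw [hB]; exact hface.frame₁ i b
  have fi₂ : ∀ b, HasDirection (fun v => face i b 0 v) (B b false false (i + 2)) := fun b => by
    rw [hB]; exact hface.frame₂ i b
  have fj₁ : ∀ b, HasDirection (fun u => face (i + 1) b u 0) (B false b false (i + 2)) := fun b => by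
    have := hface.frame₁ (i + 1) b
    rw [corner_add_one, add_one_add_one] at this
    rw [hB]; exact this
  have fj₂ : ∀ b, HasDirection (fun v => face (i + 1) b 0 v) (B false b false i) := fun b => by
    have := hface.frame₂ (i + 1) b
    rw [corner_add_one, add_one_add_two] at this
    rw [hB]; exact this
  have fk₁ : ∀ b, HasDirection (fun u => face (i + 2) b u 0) (B false false b i) := fun b => by
    have := hface.frame₁ (i + 2) b
    rw [corner_add_two, add_two_add_one] at this
    rw [hB]; exact this
  have fk₂ : ∀ b, HasDirection (fun v => face (i + 2) b 0 v) (B false false b (i + 1)) := fun b => by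
    have := hface.frame₂ (i + 2) b
    rw [corner_add_two, add_two_add_two] at this
    rw [hB]; exact this
  have evi : ∀ l, l ≠ i → B true false false l =
      refl (X false false false) (X true false false) (B false false false l) := fun l hl => by
    have := Q.evolution_of_ne (ε := corner i false false false) (corner_apply i _ _ _).1 hl
    rw [shift_corner] at this
    rw [hB, hX]; exact this
  have evj : ∀ l, l ≠ i + 1 → B false true false l =
      refl (X false false false) (X false true false) (B false false false l) := fun l hl => by
    have := Q.evolution_of_ne (ε := corner i false false false) (corner_apply i _ _ _).2.1 hl
    rw [shift_corner_one] at this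
    rw [hB, hX]; exact this
  have evk : ∀ l, l ≠ i + 2 → B false false true l =
      refl (X false false false) (X false false true) (B false false false l) := fun l hl => by
    have := Q.evolution_of_ne (ε := corner i false false false) (corner_apply i _ _ _).2.2 hl
    rw [shift_corner_two] at this
    rw [hB, hX]; exact this
  have hort : Orthonormal ℝ (B false false false) := by rw [hB]; exact Q.orthonormal _
  have inj : ∀ (l : Fin 3) (b c d c' d' : Bool), face l b (bit c) (bit d) = face l b (bit c') (bit d') →
      bit c = bit c' ∧ bit d = bit d' := fun l b c d c' d' h =>
    (hface.patch l b).injOn (bit_mem _) (bit_mem _) (bit_mem _) (bit_mem _) h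
  have hbit : bit false ≠ bit true := by rw [bit_false, bit_true]; exact zero_ne_one
  have ne₁ : X false false false ≠ X true false false := fun h =>
    hbit (inj (i + 2) false false false true false (by rw [vk, vk, h])).1
  have ne₂ : X false false false ≠ X false true false := fun h =>
    hbit (inj (i + 2) false false false false true (by rw [vk, vk, h])).2
  have ne₄ : X false false false ≠ X false false true := fun h =>
    hbit (inj (i + 1) false false false true false (by rw [vj, vj, h])).1
  have ne₂₄ : X false true false ≠ X false false true := fun h =>
    hbit (inj i false false true true false (by rw [vi, vi, h])).1
  have vi00 := fun b => vi b false false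
  have vi10 := fun b => vi b true false
  have vi01 := fun b => vi b false true
  have vi11 := fun b => vi b true true
  have vj00 := fun b => vj b false false
  have vj10 := fun b => vj b true false
  have vj01 := fun b => vj b false true
  have vj11 := fun b => vj b true true
  have vk00 := fun b => vk b false false
  have vk10 := fun b => vk b true false
  have vk01 := fun b => vk b false true
  have vk11 := fun b => vk b true true
  simp only [bit_false, bit_true] at vi00 vi10 vi01 vi11 vj00 vj10 vj01 vj11 vk00 vk10 vk01 vk11
  obtain ⟨P, hP⟩ : ∃ P, P = lift (X false false false) := ⟨_, rfl⟩
  obtain ⟨R, hR⟩ : ∃ R, R = lift (X true false false) := ⟨_, rfl⟩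
  obtain ⟨e, he⟩ : ∃ e, e = liftDir (X false false false) (B false false false i) := ⟨_, rfl⟩
  have arc : ArcData P R e := by
    rw [hP, hR, he]; exact arcData_lift ne₁ (hort.1 i)
  have hP0 : P.2.1 ≠ 0 := by rw [hP]; exact one_ne_zero
  have tP : toSpace P = X false false false := by rw [hP, toSpace_lift]
  have tR : toSpace R = X true false false := by rw [hR, toSpace_lift]
  have de : dir P e = B false false false i := by rw [hP, he, dir_liftDir]
  obtain ⟨m, b, φ₁, rm, pm, rb, ub, db, hφ₁, ob, hm, l₁⟩ :=
    (hface.patch (i + 2) false).exists_reflection arc hP0 (by rw [vk00, tP]) (by rw [vk10, tR])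
      (fk₁ false) de (fk₂ false)
  obtain ⟨n, c, φ₄, rn, pn, rc, uc, dc, hφ₄, oc, hn, l₄⟩ :=
    (hface.patch (i + 1) false).swap.exists_reflection arc hP0 (by rw [vj00, tP])
      (by rw [vj01, tR]) (fj₂ false) de (fj₁ false)
  have L₁ : HasLines (face (i + 2) false) (circArc P R e) (fun t => reflect m (circArc P R e t)) b
    φ₁ := ⟨hφ₁, l₁⟩
  have L₄ : HasLines (fun u v => face (i + 1) false v u) (circArc P R e)
    (fun t => reflect n (circArc P R e t)) c φ₄ := ⟨hφ₄, l₄⟩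
  have tmP : toSpace (reflect m P) = X false true false := by
    have := L₁.right zero_mem_I
    rw [hφ₁.map_zero, circArc_zero, vk01] at this
    exact this.symm
  have tmR : toSpace (reflect m R) = X true true false := by
    have := L₁.right one_mem_I
    rw [hφ₁.map_one, circArc_one, vk11] at this
    exact this.symm
  have tnP : toSpace (reflect n P) = X false false true := by
    have := L₄.right zero_mem_I
    rw [hφ₄.map_zero, circArc_zero, vj10] at this
    exact this.symm
  have tnR : toSpace (reflect n R) = X true false true := by
    have := L₄.right one_mem_I
    rw [hφ₄.map_one, circArc_one, vj11] at this
    exact this.symm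
  obtain ⟨m', φ₃, rm', pm', hφ₃, hm', l₃⟩ :=
    (hface.patch (i + 2) true).exists_reflection_of_reflect ne₄ (e := e) (n := n) (b := b)
      (hP ▸ hR ▸ arc) rn pn (hP ▸ tnP) (vk00 true) (by rw [← hR, tnR, vk10])
      (fk₁ true) (by rw [← hP, de, evk _ hi₂]) (fk₂ true) (by rw [← hP, db, evk _ h₁₂]) rb
      (hP ▸ hR ▸ ob)
  obtain ⟨n', φ₂, rn', pn', hφ₂, hn', l₂⟩ :=
    (hface.patch (i + 1) true).swap.exists_reflection_of_reflect ne₂ (e := e) (n := m) (b := c)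
      (hP ▸ hR ▸ arc) rm pm (hP ▸ tmP) (vj00 true) (by rw [← hR, tmR, vj01])
      (fj₂ true) (by rw [← hP, de, evj _ hi₁]) (fj₁ true) (by rw [← hP, dc, evj _ h₁₂.symm]) rc
      (hP ▸ hR ▸ oc)
  rw [← hP, ← hR] at hm' l₃ hn' l₂
  have L₃ : HasLines (face (i + 2) true) (fun t => reflect n (circArc P R e t))
    (fun t => reflect m' (reflect n (circArc P R e t))) (reflect n b) φ₃ := ⟨hφ₃, l₃⟩
  have L₂ : HasLines (fun u v => face (i + 1) true v u) (fun t => reflect m (circArc P R e t))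
    (fun t => reflect n' (reflect m (circArc P R e t))) (reflect m c) φ₂ := ⟨hφ₂, l₂⟩
  have tnmP : toSpace (reflect n' (reflect m P)) = X false true true := by
    have := L₂.right zero_mem_I
    rw [hφ₂.map_zero, circArc_zero, vj10] at this
    exact this.symm
  have tnmR : toSpace (reflect n' (reflect m R)) = X true true true := by
    have := L₂.right one_mem_I
    rw [hφ₂.map_one, circArc_one, vj11] at this
    exact this.symm
  have tmnP : toSpace (reflect m' (reflect n P)) = X false true true := by
    have := L₃.right zero_mem_I
    rw [hφ₃.map_zero, circArc_zero, vk01] at this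
    exact this.symm
  have tmnR : toSpace (reflect m' (reflect n R)) = X true true true := by
    have := L₃.right one_mem_I
    rw [hφ₃.map_one, circArc_one, vk11] at this
    exact this.symm
  have pmP := isPt_reflect arc.ptP rm pm
  have pmR := isPt_reflect arc.ptQ rm pm
  have pnP := isPt_reflect arc.ptP rn pn
  have pnR := isPt_reflect arc.ptQ rn pn
  have pnmP := isPt_reflect pmP rn' pn'
  have pnmR := isPt_reflect pmR rn' pn'
  obtain ⟨x, y, z, hz, relP⟩ := (hface.patch i false).exists_relation arc.ptP pmP pnmP pnP
    (by rw [vi00, tP]) (by rw [vi10, tmP]) (by rw [vi11, tnmP]) (by rw [vi01, tnP])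
  obtain ⟨x', y', z', -, relR⟩ := (hface.patch i true).exists_relation arc.ptQ pmR pnmR pnR
    (by rw [vi00, tR]) (by rw [vi10, tmR]) (by rw [vi11, tnmR]) (by rw [vi01, tnR])
  obtain ⟨μ, hμ, eP⟩ := exists_smul_of_toSpace_eq pnmP (isPt_reflect pnP rm' pm')
    (tnmP.trans tmnP.symm)
  obtain ⟨μ', -, eR⟩ := exists_smul_of_toSpace_eq pnmR (isPt_reflect pnR rm' pm')
    (tnmR.trans tmnR.symm)
  -- Equality would put the lifts of all eight vertices into the span of three of them, hence all
  -- vertices on one circle.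
  have hne : Submodule.span ℝ {P, reflect m P, reflect n P} ≠
      Submodule.span ℝ {R, reflect m R, reflect n R} := by
    intro hS
    refine hcirc (onCircle_of_mem_span (p₁ := X false false false) (p₂ := X false true false)
      (p₃ := X false false true) ?_)
    set C := Submodule.span ℝ {P, reflect m P, reflect n P} with hC
    have q₁ : P ∈ C := Submodule.subset_span (by simp)
    have q₂ : reflect m P ∈ C := Submodule.subset_span (by simp)
    have q₄ : reflect n P ∈ C := Submodule.subset_span (by simp)
    have q₃ : reflect n' (reflect m P) ∈ C := by
      rw [relP]
      exact C.sub_mem (C.add_mem (C.smul_mem _ q₂) (C.smul_mem _ q₄)) (C.smul_mem _ q₁)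
    have s₁ : R ∈ C := by rw [hS]; exact Submodule.subset_span (by simp)
    have s₂ : reflect m R ∈ C := by rw [hS]; exact Submodule.subset_span (by simp)
    have s₄ : reflect n R ∈ C := by rw [hS]; exact Submodule.subset_span (by simp)
    have s₃ : reflect n' (reflect m R) ∈ C := by
      rw [relR]
      exact C.sub_mem (C.add_mem (C.smul_mem _ s₂) (C.smul_mem _ s₄)) (C.smul_mem _ s₁)
    have hle : C ≤ Submodule.span ℝ {lift (X false false false), lift (X false true false),
        lift (X false false true)} := by
      rw [hC, Submodule.span_le]
      rintro v (rfl | rfl | rfl)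
      · exact mem_of_lift_mem arc.ptP tP (Submodule.subset_span (by simp))
      · exact mem_of_lift_mem pmP tmP (Submodule.subset_span (by simp))
      · exact mem_of_lift_mem pnP tnP (Submodule.subset_span (by simp))
    have hall : ∀ b c d, lift (X b c d) ∈ C := by
      rintro (_ | _) (_ | _) (_ | _)
      · exact lift_mem_of_toSpace arc.ptP tP q₁
      · exact lift_mem_of_toSpace pnP tnP q₄
      · exact lift_mem_of_toSpace pmP tmP q₂
      · exact lift_mem_of_toSpace pnmP tnmP q₃
      · exact lift_mem_of_toSpace arc.ptQ tR s₁
      · exact lift_mem_of_toSpace pnR tnR s₄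
      · exact lift_mem_of_toSpace pmR tmR s₂
      · exact lift_mem_of_toSpace pnmR tnmR s₃
    rintro _ ⟨ε, rfl⟩
    have := hle (hall (ε i) (ε (i + 1)) (ε (i + 2)))
    have hε : X (ε i) (ε (i + 1)) (ε (i + 2)) = Q.x ε := by
      rw [hX]; exact congrArg Q.x (eq_corner i ε).symm
    rwa [hε] at this
  have neg : lie (reflect m P) (reflect n P) < 0 :=
    lie_neg_of_ne pmP pnP (by rw [tmP, tnP]; exact fun h => ne₂₄ (OnePoint.coe_injective h))
  obtain ⟨comm, ξ, η, ζ, rel, dξ, dη, dζ, hζ⟩ := exists_tube_relation arc rm rn rn' pm pn pm' pn'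
    hm hn hm' hn' neg hz relP relR eP eR hμ hne
  have L₃' : HasLines (face (i + 2) true) (fun t => reflect n (circArc P R e t))
      (fun t => reflect n' (reflect m (circArc P R e t))) (reflect n b) φ₃ := by
    simp only [comm]; exact L₃
  have disj : ∀ (l : Fin 3), ∀ u ∈ I, ∀ v ∈ I, ∀ u' ∈ I, ∀ v' ∈ I,
      face l false u v ≠ face l true u' v' := fun l u hu v hv u' hu' v' hv' h =>
    disjoint_left.1 (hns.opposite l) (mem_image hu hv) (h ▸ mem_image hu' hv')
  have oP := ob 0 zero_mem_I
  have oR := ob 1 one_mem_I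
  have oP' := oc 0 zero_mem_I
  have oR' := oc 1 one_mem_I
  rw [circArc_zero] at oP oP'
  rw [circArc_one] at oR oR'
  obtain ⟨T, hT⟩ : ∃ T : Tube, T = ⟨P, R, e, m, n, m', n', b, c, ξ, η, ζ⟩ := ⟨_, rfl⟩
  have hbc : lie b c = 0 := by
    rw [lie_eq_inner_dir arc.ptP hP0 rb oP oP', db, dc]
    exact hort.2 h₁₂
  have hTube : T.IsTube := by
    rw [hT]
    exact ⟨arc, rm, rn, rm', rn', pm, pn, pm', pn', hm, hn, hm', hn', comm, rel, dξ, dη, dζ, hζ,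
      rb, rc, ub, uc, hbc, ob, oc, L₁.ne_of_disjoint L₃' (disj (i + 2)),
      L₄.ne_of_disjoint L₂ fun u hu v hv u' hu' v' hv' => disj (i + 1) v hv u hu v' hv' u' hu'⟩
  have A₁0 : T.A₁ 0 = P := by rw [hT]; exact circArc_zero _ _ _
  have A₁1 : T.A₁ 1 = R := by rw [hT]; exact circArc_one _ _ _
  have A₂0 : T.A₂ 0 = reflect m P := by rw [Tube.A₂, A₁0, hT]
  have A₂1 : T.A₂ 1 = reflect m R := by rw [Tube.A₂, A₁1, hT]
  have A₄0 : T.A₄ 0 = reflect n P := by rw [Tube.A₄, A₁0, hT]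
  have A₄1 : T.A₄ 1 = reflect n R := by rw [Tube.A₄, A₁1, hT]
  have A₃0 : T.A₃ 0 = reflect n' (reflect m P) := by rw [Tube.A₃, A₂0, hT]
  have A₃1 : T.A₃ 1 = reflect n' (reflect m R) := by rw [Tube.A₃, A₂1, hT]
  have hTb : T.b = b := by rw [hT]
  have hTc : T.c = c := by rw [hT]
  have hR0 : R.2.1 ≠ 0 := by rw [hR]; exact one_ne_zero
  -- The vector `b` is orthogonal to both ends of the edge, so its Euclidean directions there are
  -- related by the reflection in the bisecting plane, just as the frames are.
  have dbR : dir R b = B true false false (i + 1) := by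
    rw [evi _ hi₁.symm, ← db, hP, hR]
    exact dir_lift_eq_refl ne₁ rb (hP ▸ oP) (hR ▸ oR)
  have dcR : dir R c = B true false false (i + 2) := by
    rw [evi _ hi₂.symm, ← dc, hP, hR]
    exact dir_lift_eq_refl ne₁ rc (hP ▸ oP') (hR ▸ oR')
  refine ⟨T, hTube, ⟨φ₁, ?_⟩, ⟨φ₂, ?_⟩, ⟨φ₃, ?_⟩, ⟨φ₄, ?_⟩, ?_, ?_⟩
  · rw [hT]; exact L₁
  · rw [hT]; exact L₂
  · rw [hT]; exact L₃'
  · rw [hT]; exact L₄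
  · refine hTube.samePatch_of_hasDirection zero_mem_I (hface.patch i false) ?_ ?_ ?_ ?_ ?_ ?_ ?_
    · rw [A₁0, vi00, tP]
    · rw [A₂0, vi10, tmP]
    · rw [A₃0, vi11, tnmP]
    · rw [A₄0, vi01, tnP]
    · rwa [A₁0]
    · rw [A₁0, hTb, db]; exact fi₁ false
    · rw [A₁0, hTc, dc]; exact fi₂ false
  · refine hTube.samePatch_of_hasDirection one_mem_I (hface.patch i true) ?_ ?_ ?_ ?_ ?_ ?_ ?_
    · rw [A₁1, vi00, tR]
    · rw [A₂1, vi10, tmR]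
    · rw [A₃1, vi11, tnmR]
    · rw [A₄1, vi01, tnR]
    · rwa [A₁1]
    · rw [A₁1, hTb, dbR]; exact fi₁ true
    · rw [A₁1, hTc, dcR]; exact fi₂ true

end Cyclidic

/-! ### The theorem -/

theorem mainTheorem8 (Q : Cyclidic.Cube) (face : Fin 3 → Bool → ℝ → ℝ → Cyclidic.Space)
    (hface : Q.IsFaces face) (hns : Cyclidic.NonsingularFaces face)
    (hcirc : ¬ Cyclidic.OnCircle (Set.range Q.x)) (i : Fin 3) :
    ∃ Φ : ℝ → ℝ → ℝ → Cyclidic.Space,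
      Cyclidic.IsSmoothFamily face i Φ ∧
      (∀ Ψ : ℝ → ℝ → ℝ → Cyclidic.Space, Cyclidic.IsSmoothFamily face i Ψ →
        ∃ θ : ℝ → ℝ, Cyclidic.IsReparam θ ∧
          ∀ t ∈ Cyclidic.I, Cyclidic.SamePatch (Ψ t) (Φ (θ t))) ∧
      (∀ g : ℝ → ℝ → Cyclidic.Space,
        Cyclidic.IsPatch g → Cyclidic.BoundaryOnFaces face i g →
          ∃! t : ℝ, t ∈ Cyclidic.I ∧ Cyclidic.SamePatch g (Φ t)) := by
  obtain ⟨T, hT, hs⟩ := Cyclidic.exists_tube hface hns hcirc i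
  have hadj : ∀ b c, Cyclidic.image (face (i + 1) b) ∩ Cyclidic.image (face (i + 2) c) ⊆
      (fun v => face (i + 1) b (Cyclidic.bit c) v) '' Cyclidic.I := fun b c => by
    have := hns.adjacent₁ (i + 1) b c
    rwa [Cyclidic.add_one_add_one] at this
  refine ⟨fun t => (T.data t).std, hT.isSmoothFamily hs,
    fun Ψ hΨ => hT.exists_reparam hs hface.patch hadj hΨ, fun g hg hgb => ?_⟩
  obtain ⟨t, ht, hgt⟩ := hT.exists_samePatch hs hface.patch hadj hg hgb
  exact ⟨t, ⟨ht, hgt⟩, fun t' ht' => hT.eq_of_samePatch ht'.2 hgt⟩
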